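/- Let $W\subset S^3$ be an unknotted handlebody of some genus $k\ge 0$, i.e. $W$ is a handlebody (a closed 3-ball with $k$ 1-handles attached) whose exterior $M=S^3\setminus\operatorname{Int}W$ is also a handlebody (with $\partial M=\partial W$). Let $P\subset\partial M$ be a finite set (possibly empty) and let $\Gamma\subset M$ be a spatial graph, i.e. a subspace of $S^3=\mathbb R^3\cup\{\infty\}$ which is ambient isotopic in $S^3$ to a finite (possibly empty) union of straight line segments in $\mathbb R^3$, such that $\partial M\cap\Gamma=P\cap\partial\Gamma$, where $\partial\Gamma$ is the set of univalent vertices of $\Gamma$. Fix basepoints $\ast\in M\setminus\Gamma$ and $\ast_\partial\in\partial M\setminus P$. Let $G$ be a group and let $X_G$ be a CW complex with basepoint $x_0$, with a fixed isomorphism $\pi_1(X_G,x_0)\cong G$ and with $\pi_2(X_G,x_0)=0$. Let $f_0\colon\partial M\setminus P\to X_G$ be a continuous map with $f_0(\ast_\partial)=x_0$. Let $\mathrm{Map}_0(M\setminus\Gamma,X_G;f_0)$ be the set of continuous maps $f\colon M\setminus\Gamma\to X_G$ such that $f(\ast)=x_0$ and $f|_{\partial M\setminus P}$ is (freely) homotopic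 to $f_0$, and let $\simeq$ be the relation of basepoint-preserving homotopy on it. Let $\iota\colon\partial M\setminus P\hookrightarrow M\setminus\Gamma$ be the inclusion. Then there is a path in $M\setminus\Gamma$ from $\ast$ to $\ast_\partial$, and for every choice of such a path, with $\iota_\ast\colon\pi_1(\partial M\setminus P,\ast_\partial)\to\pi_1(M\setminus\Gamma,\ast)$ the homomorphism induced by $\iota$ and the path, the assignment $[f]\mapsto f_\ast$ (composed with $\pi_1(X_G,x_0)\cong G$) is a well-defined bijection $$\theta\colon \mathrm{Map}_0(M\setminus\Gamma,X_G;f_0)/{\simeq}\;\longrightarrow\;\{\varphi\in\mathrm{Hom}(\pi_1(M\setminus\Gamma,\ast),G)\mid \varphi\circ\iota_\ast\text{ is conjugate to }(f_0)_\ast\},$$ where two homomorphisms into $G$ are conjugate if they differ by an inner automorphism of $G$. -/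

import Mathlib

open Topology

/-- Euclidean `n`-space. -/
abbrev Euc (n : ℕ) : Type := EuclideanSpace ℝ (Fin n)

/-- The closed unit `n`-disc. -/
abbrev Disc (n : ℕ) : Type := Metric.closedBall (0 : Euc n) 1

/-- The 3-sphere, as the one-point compactification of `ℝ³`. -/
abbrev S3 : Type := OnePoint (Euc 3)

/-- `IsHandlebody k W B`: the subspace `W` of the 3-sphere is a handlebody of genus `k` with
boundary surface `B`, i.e. `W` is obtained from a 0-handle (an embedded closed 3-ball) by attaching
`k` 1-handles (pairwise disjoint embedded copies of `[-1,1] × D²`), where each handle meets the ball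
exactly in its two end discs `{±1} × D²`, which lie on the boundary sphere of the ball.
The boundary of the result consists of the boundary sphere of the ball with the open attaching discs
removed, together with the sides `[-1,1] × S¹` of the handles.
Since `S3` is compact Hausdorff, the subspace topology on `W` is the gluing topology;
a 3-dimensional submanifold of the 3-sphere is automatically orientable. -/
def IsHandlebody (k : ℕ) (W B : Set S3) : Prop :=
  ∃ (b : Disc 3 → S3) (h : Fin k → Set.Icc (-1 : ℝ) 1 × Disc 2 → S3),
    IsEmbedding b ∧ (∀ i, IsEmbedding (h i)) ∧
    (∀ i j, i ≠ j → Disjoint (Set.range (h i)) (Set.range (h j))) ∧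
    (∀ i q, h i q ∈ Set.range b ↔ |(q.1 : ℝ)| = 1) ∧
    (∀ i q, |(q.1 : ℝ)| = 1 → h i q ∈ b '' {y | ‖(y : Euc 3)‖ = 1}) ∧
    W = Set.range b ∪ ⋃ i, Set.range (h i) ∧
    B = (b '' {y | ‖(y : Euc 3)‖ = 1} \
          ⋃ i, h i '' {q | |(q.1 : ℝ)| = 1 ∧ ‖(q.2 : Euc 2)‖ < 1}) ∪
        ⋃ i, h i '' {q | ‖(q.2 : Euc 2)‖ = 1}

/-- The exterior `S³ ∖ Int W` of a submanifold `W` of the 3-sphere with boundary `B`, where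
`Int W = W ∖ B`. -/
def exterior (W B : Set S3) : Set S3 := (W \ B)ᶜ

/-- `W` is an unknotted handlebody of genus `k` in the 3-sphere, with boundary `B`: it is a
handlebody, and its exterior is also a handlebody (with the same boundary). -/
def IsUnknottedHandlebody (k : ℕ) (W B : Set S3) : Prop :=
  IsHandlebody k W B ∧ ∃ m : ℕ, IsHandlebody m (exterior W B) B

/-- `A` and `A'` are ambient isotopic subsets of the 3-sphere. -/
def AmbientIsotopic (A A' : Set S3) : Prop :=
  ∃ H : C(unitInterval × S3, S3), (∀ x, H (0, x) = x) ∧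
    (∀ t, IsHomeomorph fun x => H (t, x)) ∧ (fun x => H (1, x)) '' A = A'

/-- The underlying subspace of a (finite, possibly empty) spatial graph in the 3-sphere: a subset
ambient isotopic to a finite union of straight line segments in `ℝ³`. Isolated vertices are
degenerate segments. -/
def IsSpatialGraph (Γ : Set S3) : Prop :=
  ∃ (n : ℕ) (u v : Fin n → Euc 3),
    AmbientIsotopic Γ (⋃ i, (fun x : Euc 3 => (x : S3)) '' segment ℝ (u i) (v i))

/-- The set `∂Γ` of end points (univalent vertices) of a graph `Γ`: the points having an open
neighbourhood in `Γ` homeomorphic to `[0,1)`, with the point corresponding to `0`. -/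
def graphEnds (Γ : Set S3) : Set S3 :=
  {x | ∃ U : Set S3, IsOpen U ∧ ∃ (hx : x ∈ Γ ∩ U) (e : ↥(Γ ∩ U) ≃ₜ Set.Ico (0 : ℝ) 1),
    (e ⟨x, hx⟩ : ℝ) = 0}

/-- `∂M ∖ P` is contained in `M ∖ Γ`. -/
theorem boundary_diff_subset {W B P Γ : Set S3} (hB : B ∩ Γ = P ∩ graphEnds Γ) :
    B \ P ⊆ exterior W B \ Γ := by
  rintro x ⟨hxB, hxP⟩
  refine ⟨fun hx => hx.2 hxB, fun hxΓ => hxP ?_⟩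
  have hmem : x ∈ B ∩ Γ := ⟨hxB, hxΓ⟩
  rw [hB] at hmem
  exact hmem.1

/-- The inclusion `ι : ∂M ∖ P → M ∖ Γ`, where `M = exterior W B` and `∂M = B`. -/
def boundaryInclusion {W B P Γ : Set S3} (hB : B ∩ Γ = P ∩ graphEnds Γ) :
    C(↥(B \ P), ↥(exterior W B \ Γ)) :=
  ContinuousMap.inclusion (boundary_diff_subset hB)

section Fields

variable {S U X : Type*} [TopologicalSpace S] [TopologicalSpace U] [TopologicalSpace X]

/-- The set `Map₀(U, X; f₀)` of based maps `f : (U, pt) → (X, x₀)` whose restriction along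
`ι : S → U` is (freely) homotopic to `f₀`. -/
def BasedFields (ι : C(S, U)) (f₀ : C(S, X)) (pt : U) (x₀ : X) : Type _ :=
  {f : C(U, X) // f pt = x₀ ∧ (f.comp ι).Homotopic f₀}

/-- The equivalence relation of basepoint-preserving homotopy on `Map₀(U, X; f₀)`. -/
def basedHomotopy (ι : C(S, U)) (f₀ : C(S, X)) (pt : U) (x₀ : X) :
    Setoid (BasedFields ι f₀ pt x₀) where
  r f g := f.1.HomotopicRel g.1 {pt}
  iseqv :=
    ⟨fun f => .refl f.1, fun h => h.symm, fun h h' => h.trans h'⟩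

/-- The homomorphism `π₁(S, s) → π₁(U, pt)` induced by `ι : S → U` and a path `γ` from `pt` to
`ι s`. -/
noncomputable def inducedAlong (ι : C(S, U)) {pt : U} {s : S} (γ : Path pt (ι s)) :
    FundamentalGroup S s →* FundamentalGroup U pt :=
  (FundamentalGroup.fundamentalGroupMulEquivOfPath γ).symm.toMonoidHom.comp
    (FundamentalGroup.map ι s)

end Fields

/-- Two homomorphisms `H → G` are conjugate if they differ by an inner automorphism of `G`. -/
def AreConj {H G : Type*} [Group H] [Group G] (α β : H →* G) : Prop :=
  ∃ g : G, ∀ x, g * α x * g⁻¹ = β x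

/-! Both `exterior W B \ Γ` and `B \ P` are path-connected retracts of open subsets of `ℝ³`. The
theorem is therefore a statement of obstruction theory about a connected open set `O ⊆ ℝ³` and a
target with vanishing `π₂`.

Retracts. A handlebody minus a spine (the centre of the 0-handle, the cores of the 1-handles and the
radii joining them) retracts radially onto its boundary. Applied to `W`, this gives a retraction of
the complement of a spine onto the exterior. Applied once more to the exterior, it gives a
retraction of an open set onto the surface. Deleting the preimage of `Γ` or of `P` keeps the source
open (`IsUnknottedHandlebody.isOpenRetract`).

Realizing homomorphisms. `O` is cut into dyadic cells, small near the frontier. Vertices go to the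
base point and edges follow the homomorphism. The boundary of a square extends because its two
halves are homotopic in `O`, and cubes are filled because `π₂ = 0` (`DyadicBox.exists_map_of_hom`).

Constructing homotopies. If two maps correspond on loops under a path `δ`, a homotopy is built on
prisms over cells. Vertices and edges use `δ`, and squares use `π₂ = 0`. Prisms over cubes are
4-dimensional and would meet `π₃`. This is avoided because there is always a higher neighbouring
cube, so no component of the adjacency graph of cubes is finite. Each cube can be matched with a
square that it shares with a cube of larger rank. The prism over a matched square is left free, and
the prism over the cube retracts onto the rest of its boundary, so the homotopy extends over the
cubes in order of rank (`DyadicBox.exists_matching`, `DyadicBox.exists_homotopy`). In effect `O` is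
treated as a 2-dimensional complex.

Classification. A conjugating element of `π₁` is the same thing as a track for the base point. The
homotopy theorem on `B \ P` thus turns conjugacy on loops into free homotopy with `f₀`. On `exterior
W B \ Γ`, the homotopy theorem with constant track gives injectivity, and the realization theorem
gives surjectivity (`exists_bijective_of_isOpenRetract`).

Connectedness. A segment does not separate a ball around one of its points, so removing a spatial
graph from a connected open set leaves it connected. For the surface, the boundary sphere of the
0-handle minus finitely many disjoint star-shaped sets and points is connected, by a criterion using
continuous logarithms. It projects into `B \ P`, and the sides of the 1-handles are then attached to
its image. -/

/-! ### Gluing of maps, subdivision of paths, and filling of squares. -/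

open Set unitInterval in
theorem exists_continuousOn_extension_of_locallyFinite {Z T ι : Type*} [TopologicalSpace Z]
    [TopologicalSpace T] {A : Set Z} (hA : IsClosed A) {e : ι → Set Z} (he : ∀ i, IsClosed (e i))
    (hlf : LocallyFinite e) (hint : ∀ i j, i ≠ j → e i ∩ e j ⊆ A) {f : Z → T}
    (hf : ContinuousOn f A)
    (hg : ∀ i, ∃ g : Z → T, ContinuousOn g (e i) ∧ EqOn g f (e i ∩ A)) :
    ∃ F : Z → T, ContinuousOn F (A ∪ ⋃ i, e i) ∧ EqOn F f A := by
  classical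
  choose g hgc hgA using hg
  let F : Z → T := fun z => if z ∈ A then f z else if h : ∃ i, z ∈ e i then g h.choose z else f z
  have hFA : EqOn F f A := fun z hz => by simp [F, hz]
  have hFe : ∀ i, EqOn F (g i) (e i) := by
    intro i z hz
    by_cases hzA : z ∈ A
    · rw [hFA hzA, hgA i ⟨hz, hzA⟩]
    · have h : ∃ i, z ∈ e i := ⟨i, hz⟩
      have hi : h.choose = i := by
        by_contra hne
        exact hzA (hint _ _ hne ⟨h.choose_spec, hz⟩)
      simp only [F, hzA, if_false, dif_pos h, hi]
  refine ⟨F, ContinuousOn.union_of_isClosed (hf.congr hFA) ?_ hA (hlf.isClosed_iUnion he), hFA⟩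
  exact hlf.continuousOn_iUnion he fun i => (hgc i).congr (hFe i)

-- By compactness of the interval, a path is homotopic to a finite concatenation of pieces, each
-- inside one of the neighbourhoods. Only stability under concatenation and homotopy is then needed.
open Set unitInterval in
theorem Path.forall_of_local {Z : Type*} [TopologicalSpace Z] (Good : ∀ {x y : Z}, Path x y → Prop)
    (htrans : ∀ {x y z : Z} (p : Path x y) (q : Path y z), Good p → Good q → Good (p.trans q))
    (hhom : ∀ {x y : Z} (p q : Path x y), p.Homotopic q → Good p → Good q)
    (hloc : ∀ z : Z, ∃ N ∈ 𝓝 z, ∀ {x y : Z} (p : Path x y), range p ⊆ N → Good p)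
    {x y : Z} (p : Path x y) : Good p := by
  choose N hN hgood using hloc
  have hcast : ∀ {x y x' y' : Z} (q : Path x y) (hx : x' = x) (hy : y' = y),
      Good (q.cast hx hy) → Good q := by
    intro x y x' y' q hx hy h
    subst hx hy
    exact h
  obtain ⟨t, ht0, htm, ⟨n, hn⟩, ht⟩ := exists_monotone_Icc_subset_open_cover_unitInterval
    (c := fun z : Z => p ⁻¹' (interior (N z)))
    (fun z => isOpen_interior.preimage p.continuous)
    (fun s _ => mem_iUnion.2 ⟨p s, mem_interior_iff_mem_nhds.2 (hN _)⟩)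
  have key : ∀ m, Good (p.subpath 0 (t m)) := by
    intro m
    induction m with
    | zero =>
      rw [ht0, Path.subpath_self]
      refine hgood (p 0) _ ?_
      rintro _ ⟨s, rfl⟩
      exact mem_of_mem_nhds (hN _)
    | succ m ih =>
      refine hhom _ _ ⟨Path.Homotopy.subpathTransSubpath p 0 (t m) (t (m + 1))⟩ (htrans _ _ ih ?_)
      obtain ⟨z, hz⟩ := ht m
      refine hgood z _ ?_
      rw [Path.range_subpath_of_le _ _ _ (htm (Nat.le_succ m))]
      rintro _ ⟨s, hs, rfl⟩
      exact interior_subset (hz hs)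
  have := key n
  rw [hn n le_rfl, Path.subpath_zero_one] at this
  exact hcast p _ _ this

theorem Topology.IsQuotientMap.exists_continuousMap_comp_eq {A B T : Type*} [TopologicalSpace A]
    [TopologicalSpace B] [TopologicalSpace T] {q : A → B} (hq : IsQuotientMap q) (g : C(A, T))
    (hg : ∀ x y, q x = q y → g x = g y) : ∃ F : C(B, T), ∀ x, F (q x) = g x := by
  have h : ∀ x, g (Function.surjInv hq.surjective (q x)) = g x := fun x =>
    hg _ _ (Function.surjInv_eq hq.surjective (q x))
  refine ⟨⟨fun b => g (Function.surjInv hq.surjective b), ?_⟩, h⟩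
  rw [hq.continuous_iff]
  exact g.continuous.congr fun x => (h x).symm

open Set unitInterval in
/-- A map on the boundary of a square extends to the square if the two paths
between opposite corners are homotopic. -/
theorem exists_square_of_homotopic {T : Type*} [TopologicalSpace T] {p q p' q' : T}
    (α : Path p q) (β : Path p' q') (l : Path p p') (r : Path q q')
    (h : (α.trans r).Homotopic (l.trans β)) :
    ∃ F : C(I × I, T), (∀ s, F (s, 0) = α s) ∧ (∀ s, F (s, 1) = β s) ∧
      (∀ t, F (0, t) = l t) ∧ (∀ t, F (1, t) = r t) := by
  obtain ⟨Θ⟩ := h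
  -- the quotient map of the square collapsing two opposite sides
  let m : ℝ → ℝ := fun c => max 0 (c - 1)
  let w : ℝ → ℝ := fun c => min c (2 - c)
  have hw0 : ∀ y : I, 0 ≤ w (2 * y) := fun y => by
    have := y.2.1; have := y.2.2
    exact le_min (by linarith) (by linarith)
  have hsum : ∀ c : ℝ, 2 * m c + w c = c := by
    intro c
    simp only [m, w]
    rcases le_total c 1 with hc | hc
    · rw [max_eq_left (by linarith), min_eq_left (by linarith)]; ring
    · rw [max_eq_right (by linarith), min_eq_right (by linarith)]; ring
  have hm1 : ∀ y : I, m (2 * y) + w (2 * y) ≤ 1 := by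
    intro y
    have := y.2.2
    have h1 := hsum (2 * y)
    have : 2 * (y : ℝ) - 1 ≤ m (2 * y) := le_max_right _ _
    linarith
  have hm0 : ∀ c, 0 ≤ m c := fun c => le_max_left _ _
  -- The antidiagonal `s + t = c` of the square starts at coordinate `m c` and has extent `w c`. The
  -- parameter `x.2` selects the antidiagonal `c = 2 * x.2`, and `x.1` moves along it. Thus `x.1 =
  -- 0` traces bottom then right, and `x.1 = 1` traces left then top, which are the two concatenated
  -- paths.
  let κ : I × I → I × I := fun x =>
    (⟨m (2 * x.2) + w (2 * x.2) * (1 - x.1), by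
        have h1 := hm0 (2 * x.2); have h2 := hw0 x.2; have h3 := x.1.2.2
        have : 0 ≤ w (2 * x.2) * (1 - x.1) := mul_nonneg h2 (by linarith)
        linarith, by
        have h1 := hm1 x.2; have h2 := hw0 x.2; have h3 := x.1.2.1
        nlinarith⟩,
     ⟨m (2 * x.2) + w (2 * x.2) * x.1, by
        have h1 := hm0 (2 * x.2); have h2 := hw0 x.2; have h3 := x.1.2.1
        have : 0 ≤ w (2 * x.2) * x.1 := mul_nonneg h2 (by linarith)
        linarith, by
        have h1 := hm1 x.2; have h2 := hw0 x.2; have h3 := x.1.2.2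
        nlinarith⟩)
  have hκc : Continuous κ := by
    refine Continuous.prodMk (Continuous.subtype_mk ?_ _) (Continuous.subtype_mk ?_ _) <;>
    · simp only [m, w]; fun_prop
  have hκadd : ∀ x : I × I, ((κ x).1 : ℝ) + (κ x).2 = 2 * x.2 := by
    intro x
    have := hsum (2 * x.2)
    simp only [κ]
    linarith
  have hκsurj : ∀ (s t : I), ∀ (τ y : I), (2 * y : ℝ) = s + t →
      w (2 * y) * τ = t - m (2 * y) → κ (τ, y) = (s, t) := by
    intro s t τ y h1 h2
    have h3 := hκadd (τ, y)
    have h4 : (κ (τ, y)).2 = t := by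
      apply Subtype.ext
      simp only [κ]
      linarith
    refine Prod.ext ?_ h4
    apply Subtype.ext
    rw [h4] at h3
    simp only at h3 ⊢
    linarith
  have hsurj : Function.Surjective κ := by
    rintro ⟨s, t⟩
    have hs := s.2; have ht := t.2
    have hy : ((s : ℝ) + t) / 2 ∈ I := ⟨by linarith [hs.1, ht.1], by linarith [hs.2, ht.2]⟩
    have e1 : (2 : ℝ) * (((s : ℝ) + t) / 2) = s + t := by ring
    have hm_le : m (s + t) ≤ t := max_le ht.1 (by linarith [hs.2])
    have hle : (t : ℝ) - m (s + t) ≤ w (s + t) := by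
      have h1 := hsum (s + t)
      have : m ((s : ℝ) + t) ≤ s := max_le hs.1 (by linarith [ht.2])
      linarith
    rcases eq_or_lt_of_le (hw0 ⟨_, hy⟩) with h0 | h0
    · rw [e1] at h0
      refine ⟨(0, ⟨_, hy⟩), hκsurj s t 0 ⟨_, hy⟩ e1 ?_⟩
      simp only [e1]
      rw [← h0]
      simp only [zero_mul]
      linarith
    · simp only [e1] at h0
      refine ⟨(⟨((t : ℝ) - m (s + t)) / w (s + t), div_nonneg (by linarith) h0.le,
        (div_le_one h0).2 hle⟩, ⟨_, hy⟩), hκsurj s t _ ⟨_, hy⟩ e1 ?_⟩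
      simp only [e1]
      field_simp
  have hq : IsQuotientMap κ := hκc.isClosedMap.isQuotientMap hκc hsurj
  -- Only the two corners with `w = 0` have nontrivial fibres, and there `Θ` is constant because a
  -- path homotopy fixes end points.
  have hfib : ∀ x z, κ x = κ z → Θ x = Θ z := by
    rintro ⟨τ, y⟩ ⟨τ', y'⟩ hxy
    have h1 := hκadd (τ, y); have h2 := hκadd (τ', y')
    rw [hxy] at h1
    have hyy : y = y' := Subtype.ext (by simp only at h1 h2; linarith)
    subst hyy
    have h3 : w (2 * y) * τ = w (2 * y) * τ' := by
      have := congrArg (fun z : I × I => (z.2 : ℝ)) hxy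
      simp only [κ] at this
      linarith
    rcases mul_eq_mul_left_iff.1 h3 with h4 | h4
    · rw [Subtype.ext h4]
    · have : y = 0 ∨ y = 1 := by
        simp only [w] at h4
        rcases min_choice (2 * (y : ℝ)) (2 - 2 * y) with h5 | h5
        · left; apply Subtype.ext; simp only [Icc.coe_zero]; linarith
        · right; apply Subtype.ext; simp only [Icc.coe_one]; linarith
      rcases this with rfl | rfl
      · rw [Path.Homotopy.source, Path.Homotopy.source]
      · rw [Path.Homotopy.target, Path.Homotopy.target]
  obtain ⟨F, hF⟩ := hq.exists_continuousMap_comp_eq Θ.toContinuousMap hfib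
  have hF : ∀ x, F (κ x) = Θ x := hF
  have half : ∀ s : I, (s : ℝ) / 2 ∈ I := fun s => ⟨by linarith [s.2.1], by linarith [s.2.2]⟩
  have half' : ∀ s : I, (1 + (s : ℝ)) / 2 ∈ I := fun s =>
    ⟨by linarith [s.2.1], by linarith [s.2.2]⟩
  refine ⟨F, fun s => ?_, fun s => ?_, fun t => ?_, fun t => ?_⟩
  · have : κ (0, ⟨_, half s⟩) = (s, 0) := by
      refine hκsurj _ _ _ _ (by simp; ring) ?_
      have : (2 : ℝ) * ((s : ℝ) / 2) = s := by ring
      simp only [this, m, Icc.coe_zero]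
      rw [max_eq_left (by linarith [s.2.2])]; simp
    rw [← this, hF, Θ.apply_zero]
    simp only [Path.coe_toContinuousMap]
    rw [Path.trans_apply, dif_pos (by linarith [s.2.2])]
    congr 1
    exact Subtype.ext (by simp only; ring)
  · have : κ (1, ⟨_, half' s⟩) = (s, 1) := by
      refine hκsurj _ _ _ _ (by simp; ring) ?_
      have : (2 : ℝ) * ((1 + (s : ℝ)) / 2) = 1 + s := by ring
      simp only [this, m, w, Icc.coe_one]
      rw [max_eq_right (by linarith [s.2.1]), min_eq_right (by linarith [s.2.1])]; ring
    rw [← this, hF, Θ.apply_one]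
    simp only [Path.coe_toContinuousMap]
    rw [Path.trans_apply]
    split_ifs with h1
    · simp only at h1
      have : s = 0 := Subtype.ext (by simp only [Icc.coe_zero]; linarith [s.2.1])
      subst this
      have e : (⟨2 * ((1 + ((0 : I) : ℝ)) / 2), (unitInterval.mul_pos_mem_iff zero_lt_two).2
          ⟨(half' 0).1, h1⟩⟩ : I) = 1 := Subtype.ext (by simp)
      rw [e, l.target, β.source]
    · congr 1
      exact Subtype.ext (by simp only; ring)
  · have : κ (1, ⟨_, half t⟩) = (0, t) := by
      refine hκsurj _ _ _ _ (by simp; ring) ?_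
      have : (2 : ℝ) * ((t : ℝ) / 2) = t := by ring
      simp only [this, m, w, Icc.coe_one]
      rw [max_eq_left (by linarith [t.2.2]), min_eq_left (by linarith [t.2.2])]; ring
    rw [← this, hF, Θ.apply_one]
    simp only [Path.coe_toContinuousMap]
    rw [Path.trans_apply, dif_pos (by linarith [t.2.2])]
    congr 1
    exact Subtype.ext (by simp only; ring)
  · have : κ (0, ⟨_, half' t⟩) = (1, t) := by
      refine hκsurj _ _ _ _ (by simp; ring) ?_
      have : (2 : ℝ) * ((1 + (t : ℝ)) / 2) = 1 + t := by ring
      simp only [this, m, Icc.coe_zero]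
      rw [max_eq_right (by linarith [t.2.1])]; ring
    rw [← this, hF, Θ.apply_zero]
    simp only [Path.coe_toContinuousMap]
    rw [Path.trans_apply]
    split_ifs with h1
    · simp only at h1
      have : t = 0 := Subtype.ext (by simp only [Icc.coe_zero]; linarith [t.2.1])
      subst this
      have e : (⟨2 * ((1 + ((0 : I) : ℝ)) / 2), (unitInterval.mul_pos_mem_iff zero_lt_two).2
          ⟨(half' 0).1, h1⟩⟩ : I) = 1 := Subtype.ext (by simp)
      rw [e, α.target, r.source]
    · congr 1
      exact Subtype.ext (by simp only; ring)

/-! ### Ranking the vertices of an infinite locally finite graph. -/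

/-- In a locally finite graph without finite components, the vertices can be ranked by natural
numbers in such a way that each vertex has a neighbour of higher rank. -/
theorem SimpleGraph.exists_rank_lt_of_infinite {V : Type*} (G : SimpleGraph V)
    (hfin : ∀ v, (G.neighborSet v).Finite) (hinf : ∀ v, {w | G.Reachable v w}.Infinite) :
    ∃ r : V → ℕ, ∀ v, ∃ w, G.Adj v w ∧ r v < r w := by
  classical
  let ρ : V → V := fun v => (G.connectedComponentMk v).out
  have hρ : ∀ v, G.Reachable (ρ v) v := fun v =>
    SimpleGraph.ConnectedComponent.exact (G.connectedComponentMk v).out_eq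
  have hρeq : ∀ v w, G.Reachable v w → ρ v = ρ w := fun v w h => by
    simp only [ρ, SimpleGraph.ConnectedComponent.sound h]
  let d : V → ℕ := fun v => G.dist (ρ v) v
  -- The descendants of `v`: the vertices that some geodesic from the root `ρ v` reaches through
  -- `v`.
  let D : V → Set V := fun v => {w | G.Reachable v w ∧ d w = d v + G.dist v w}
  -- first step of a shortest walk
  have step : ∀ v w, G.Reachable v w → v ≠ w → ∃ u, G.Adj v u ∧ G.Reachable u w ∧
      G.dist v w = G.dist u w + 1 := by
    intro v w h hne
    obtain ⟨p, hp⟩ := h.exists_walk_length_eq_dist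
    cases p with
    | nil => exact absurd rfl hne
    | @cons _ u _ hadj q =>
      refine ⟨u, hadj, ⟨q⟩, ?_⟩
      have h1 : G.dist u w ≤ q.length := SimpleGraph.dist_le q
      obtain ⟨q', hq'⟩ := (show G.Reachable u w from ⟨q⟩).exists_walk_length_eq_dist
      have h2 : G.dist v w ≤ (SimpleGraph.Walk.cons hadj q').length := SimpleGraph.dist_le _
      simp only [SimpleGraph.Walk.length_cons] at hp h2
      omega
  have tri : ∀ u v w, G.Reachable u v → G.Reachable v w →
      G.dist u w ≤ G.dist u v + G.dist v w := by
    intro u v w h1 h2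
    obtain ⟨p, hp⟩ := h1.exists_walk_length_eq_dist
    obtain ⟨q, hq⟩ := h2.exists_walk_length_eq_dist
    have := SimpleGraph.dist_le (p.append q)
    rwa [SimpleGraph.Walk.length_append, hp, hq] at this
  have dle : ∀ v w, G.Reachable v w → d w ≤ d v + G.dist v w := by
    intro v w h
    have := tri (ρ v) v w (hρ v) h
    simp only [d]
    rw [← hρeq v w h]
    exact this
  have adjdist : ∀ {v w}, G.Adj v w → G.dist v w = 1 := fun h => SimpleGraph.dist_eq_one_iff_adj.2 h
  -- balls are finite
  have ball : ∀ n v, {w | G.Reachable v w ∧ d w ≤ n}.Finite := by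
    intro n
    induction n with
    | zero =>
      intro v
      refine (Set.finite_singleton (ρ v)).subset ?_
      rintro w ⟨h1, h2⟩
      have : G.dist (ρ w) w = 0 := Nat.le_zero.1 h2
      rw [(hρ w).dist_eq_zero_iff] at this
      rw [Set.mem_singleton_iff, hρeq v w h1, this]
    | succ n ih =>
      intro v
      refine ((ih v).union ((ih v).biUnion (fun u _ => hfin u))).subset ?_
      rintro w ⟨h1, h2⟩
      by_cases hw : d w ≤ n
      · exact Or.inl ⟨h1, hw⟩
      · right
        have hne : w ≠ ρ w := by
          intro h
          apply hw
          have : d w = 0 := by simp only [d]; rw [← h]; exact SimpleGraph.dist_self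
          omega
        obtain ⟨u, hu1, hu2, hu3⟩ := step w (ρ w) (hρ w).symm hne
        have hru : ρ u = ρ w := (hρeq w u hu1.reachable).symm
        have : d u = G.dist u (ρ w) := by simp only [d]; rw [hru, SimpleGraph.dist_comm]
        have h4 : d w = G.dist w (ρ w) := by simp only [d]; rw [SimpleGraph.dist_comm]
        rw [Set.mem_iUnion₂]
        exact ⟨u, ⟨h1.trans hu1.reachable, by omega⟩, hu1.symm⟩
  let Q : V → Finset V := fun v =>
    ((ball (d v + 1) v).subset (Set.inter_subset_left (t := {w | (D w).Finite}))).toFinset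
  have hQ : ∀ v w, w ∈ Q v ↔ (G.Reachable v w ∧ d w ≤ d v + 1) ∧ (D w).Finite := by
    intro v w
    simp only [Q, Set.Finite.mem_toFinset]; rfl
  -- A vertex with finitely many descendants steps towards the root, which enlarges `D`. A vertex
  -- with infinitely many steps to a child of the same kind, which exists since there are finitely
  -- many children. The supremum over `Q` makes a vertex of the second kind outrank all its children
  -- of the first kind, and `d v + 1` makes the rank grow along the second kind.
  refine ⟨fun v => if (D v).Finite then (D v).ncard else
    d v + 1 + (Q v).sup fun w => (D w).ncard, fun v => ?_⟩
  by_cases hv : (D v).Finite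
  -- Every vertex of the component descends from the root, so a root has infinitely many
  -- descendants.
  · have hne : v ≠ ρ v := by
      intro h
      have hd : ∀ w, G.Reachable v w → d w = G.dist v w := by
        intro w hw; simp only [d]; rw [← hρeq v w hw, ← h]
      refine (hinf v) (hv.subset fun w hw => ⟨hw, ?_⟩)
      rw [hd w hw, hd v (SimpleGraph.Reachable.refl _), SimpleGraph.dist_self, zero_add]
    obtain ⟨u, hu1, hu2, hu3⟩ := step v (ρ v) (hρ v).symm hne
    have hru : ρ u = ρ v := (hρeq v u hu1.reachable).symm
    have h5 : d u = G.dist u (ρ v) := by simp only [d]; rw [hru, SimpleGraph.dist_comm]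
    have h4 : d v = G.dist v (ρ v) := by simp only [d]; rw [SimpleGraph.dist_comm]
    refine ⟨u, hu1, ?_⟩
    beta_reduce
    rw [if_pos hv]
    by_cases hu : (D u).Finite
    · rw [if_pos hu]
      refine Set.ncard_lt_ncard ⟨?_, ?_⟩ hu
      · rintro w ⟨hw1, hw2⟩
        have hr := hu1.symm.reachable.trans hw1
        refine ⟨hr, le_antisymm (dle u w hr) ?_⟩
        have := tri u v w hu1.symm.reachable hw1
        rw [adjdist hu1.symm] at this
        omega
      · intro hsub
        have : u ∈ D v := hsub ⟨SimpleGraph.Reachable.refl _, by simp⟩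
        have := this.2
        omega
    · rw [if_neg hu]
      have : (D v).ncard ≤ (Q u).sup fun w => (D w).ncard :=
        Finset.le_sup (f := fun w => (D w).ncard)
          ((hQ u v).2 ⟨⟨hu1.symm.reachable, by omega⟩, hv⟩)
      omega
  · have : ∃ u, G.Adj v u ∧ d u = d v + 1 ∧ ¬ (D u).Finite := by
      by_contra hcon
      push Not at hcon
      apply hv
      refine ((Set.finite_singleton v).union
        (((hfin v).subset (Set.inter_subset_left (t := {u | d u = d v + 1}))).biUnion
          (t := D) fun u hu => hcon u hu.1 hu.2)).subset ?_
      rintro w ⟨hw1, hw2⟩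
      by_cases hwv : v = w
      · left; exact hwv.symm
      · right
        obtain ⟨u, hu1, hu2, hu3⟩ := step v w hw1 hwv
        have h1 := dle u w hu2
        have h2 := dle v u hu1.reachable
        rw [adjdist hu1] at h2
        rw [Set.mem_iUnion₂]
        exact ⟨u, ⟨hu1, by simp only [Set.mem_ofPred_eq]; omega⟩, hu2, by omega⟩
    obtain ⟨u, hu1, hu2, hu3⟩ := this
    refine ⟨u, hu1, ?_⟩
    beta_reduce
    rw [if_neg hv, if_neg hu3]
    have : (Q v).sup (fun w => (D w).ncard) ≤ (Q u).sup fun w => (D w).ncard := by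
      refine Finset.sup_mono fun w hw => ?_
      rw [hQ] at hw ⊢
      exact ⟨⟨hu1.symm.reachable.trans hw.1.1, by omega⟩, hw.2⟩
    omega


/-! ### Filling spheres and boundaries of cubes when `π₂` vanishes. -/

open Set in
/-- A null-homotopic map on the unit sphere extends to the unit ball. -/
theorem exists_continuousMap_closedBall_of_nullhomotopic {V T : Type*} [NormedAddCommGroup V]
    [NormedSpace ℝ V] [ProperSpace V] [Nontrivial V] [TopologicalSpace T]
    (f : C(Metric.sphere (0 : V) 1, T)) (c : T) (hf : f.Homotopic (ContinuousMap.const _ c)) :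
    ∃ F : C(Metric.closedBall (0 : V) 1, T),
      ∀ x : Metric.sphere (0 : V) 1, F ⟨x, Metric.sphere_subset_closedBall x.2⟩ = f x := by
  obtain ⟨H⟩ := hf
  let q : unitInterval × Metric.sphere (0 : V) 1 → Metric.closedBall (0 : V) 1 := fun p =>
    ⟨(1 - (p.1 : ℝ)) • (p.2 : V), by
      have h1 := p.1.2.1; have h2 := p.1.2.2
      rw [mem_closedBall_zero_iff, norm_smul, mem_sphere_zero_iff_norm.1 p.2.2, mul_one,
        Real.norm_eq_abs, abs_le]
      constructor <;> linarith⟩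
  have hqn : ∀ p, ‖(q p : V)‖ = 1 - p.1 := fun p => by
    simp only [q]
    rw [norm_smul, mem_sphere_zero_iff_norm.1 p.2.2, mul_one, Real.norm_eq_abs,
      abs_of_nonneg (by linarith [p.1.2.2])]
  have hqc : Continuous q := Continuous.subtype_mk (by fun_prop) _
  have hsurj : Function.Surjective q := by
    rintro ⟨x, hx⟩
    rw [mem_closedBall_zero_iff] at hx
    by_cases h0 : x = 0
    · obtain ⟨y, hy⟩ := NormedSpace.sphere_nonempty (E := V) (x := 0) |>.2 zero_le_one
      exact ⟨(1, ⟨y, hy⟩), Subtype.ext (by simp [q, h0])⟩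
    · have hn : ‖x‖ ≠ 0 := norm_ne_zero_iff.2 h0
      refine ⟨(⟨1 - ‖x‖, by linarith, by linarith [norm_nonneg x]⟩,
        ⟨‖x‖⁻¹ • x, by simp [norm_smul, hn]⟩), Subtype.ext ?_⟩
      simp only [q]
      rw [smul_smul, sub_sub_cancel, mul_inv_cancel₀ hn, one_smul]
  have hq : IsQuotientMap q := hqc.isClosedMap.isQuotientMap hqc hsurj
  obtain ⟨F, hF⟩ := hq.exists_continuousMap_comp_eq H.toContinuousMap (by
    rintro ⟨s, x⟩ ⟨t, y⟩ hxy
    have h1 := hqn (s, x); have h2 := hqn (t, y)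
    rw [hxy, h2] at h1
    have hst : s = t := Subtype.ext (by simp only at h1; linarith)
    subst hst
    by_cases hs : (s : ℝ) = 1
    · have : s = 1 := Subtype.ext hs
      subst this
      exact (H.apply_one x).trans (H.apply_one y).symm
    · have h3 := congrArg Subtype.val hxy
      simp only [q] at h3
      rw [smul_right_inj (sub_ne_zero.2 (Ne.symm hs))] at h3
      rw [Subtype.ext h3])
  refine ⟨F, fun x => ?_⟩
  have : q (0, x) = ⟨x, Metric.sphere_subset_closedBall x.2⟩ := Subtype.ext (by simp [q])
  rw [← this, hF]
  exact H.apply_zero x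

section Sphere

open Set Metric

/-- The height function on the boundary of the cube `[-1,1]³`, equal to `1` outside the top face and
to the supremum norm of the horizontal part on the top face. -/
noncomputable def cubeHeight (x : ℝ × ℝ × ℝ) : ℝ :=
  max (max |x.1| |x.2.1|) ((1 - x.2.2) / 2)

theorem continuous_cubeHeight : Continuous cubeHeight := by
  unfold cubeHeight; fun_prop

theorem norm_triple (x : ℝ × ℝ × ℝ) : ‖x‖ = max |x.1| (max |x.2.1| |x.2.2|) := by
  rw [Prod.norm_def, Prod.norm_def]; rfl

theorem cubeHeight_lt_one_imp {x : ℝ × ℝ × ℝ} (hx : ‖x‖ = 1) (h : cubeHeight x < 1) :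
    x.2.2 = 1 := by
  rw [norm_triple] at hx
  simp only [cubeHeight, max_lt_iff] at h
  obtain ⟨⟨h1, h2⟩, h3⟩ := h
  have : |x.2.2| = 1 := by
    rcases max_choice |x.1| (max |x.2.1| |x.2.2|) with h4 | h4
    · rw [h4] at hx; linarith
    · rw [h4] at hx
      rcases max_choice |x.2.1| |x.2.2| with h5 | h5
      · rw [h5] at hx; linarith
      · rwa [h5] at hx
  rcases (abs_eq zero_le_one).1 this with h4 | h4
  · exact h4
  · rw [h4] at h3; norm_num at h3

/-- A self-map of the sphere homotopic to the identity which collapses the part of large height. -/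
theorem exists_homotopic_id_cubeHeight :
    ∃ (k : C(sphere (0 : ℝ × ℝ × ℝ) 1, sphere (0 : ℝ × ℝ × ℝ) 1)) (s : sphere (0 : ℝ × ℝ × ℝ) 1),
      (ContinuousMap.id _).Homotopic k ∧ ∀ x, 1 / 2 ≤ cubeHeight x.1 → k x = s := by
  let μ : ℝ × ℝ × ℝ → ℝ := fun x => min 1 (2 * cubeHeight x)
  have hμc : Continuous μ := by
    have := continuous_cubeHeight
    simp only [μ]; fun_prop
  -- `K` spreads the central part of the top face over the whole sphere and sends everything of
  -- height at least `1/2` to the south pole, where `μ = 1`. The segment from `x` to `K x` avoids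
  -- the origin. Its horizontal part is a nonnegative multiple of that of `x`, and it vanishes only
  -- at the poles, which `K` fixes, or at the end of a segment going to the south pole.
  let K : ℝ × ℝ × ℝ → ℝ × ℝ × ℝ := fun x =>
    ((1 - μ x) * x.1, (1 - μ x) * x.2.1, 1 - 2 * μ x)
  have hKc : Continuous K := by simp only [K]; fun_prop
  let L : unitInterval × sphere (0 : ℝ × ℝ × ℝ) 1 → ℝ × ℝ × ℝ := fun p =>
    (1 - (p.1 : ℝ)) • (p.2 : ℝ × ℝ × ℝ) + (p.1 : ℝ) • K p.2
  have hLc : Continuous L := by simp only [L]; fun_prop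
  have hL : ∀ p, L p ≠ 0 := by
    rintro ⟨⟨s, hs0, hs1⟩, ⟨⟨a, b, c⟩, hx⟩⟩ h
    rw [mem_sphere_zero_iff_norm] at hx
    have hx' := hx
    rw [norm_triple] at hx
    simp only [L, K, Prod.smul_mk, Prod.mk_add_mk, smul_eq_mul] at h
    have h1 : (1 - s) * a + s * ((1 - μ (a, b, c)) * a) = 0 := congrArg Prod.fst h
    have h2 : (1 - s) * b + s * ((1 - μ (a, b, c)) * b) = 0 := congrArg (fun z => z.2.1) h
    have h3 : (1 - s) * c + s * (1 - 2 * μ (a, b, c)) = 0 := congrArg (fun z => z.2.2) h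
    have hμ1 : μ (a, b, c) ≤ 1 := min_le_left _ _
    have hcase : a = 0 → b = 0 → False := by
      rintro rfl rfl
      simp only [abs_zero] at hx
      rw [max_eq_right (le_max_left _ _), max_eq_right (abs_nonneg _)] at hx
      rcases (abs_eq zero_le_one).1 hx with rfl | rfl
      · have : μ (0, 0, 1) = 0 := by simp [μ, cubeHeight]
        rw [this] at h3; linarith
      · have : μ (0, 0, -1) = 1 := by simp [μ, cubeHeight]
        rw [this] at h3; linarith
    have hfac : (1 - s) + s * (1 - μ (a, b, c)) = 0 ∨
        (1 - s) + s * (1 - μ (a, b, c)) ≠ 0 := em _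
    rcases hfac with hfac | hfac
    · have hs : s = 1 := by nlinarith
      subst hs
      have hμ : μ (a, b, c) = 1 := by linarith
      rw [hμ] at h3; linarith
    · exact hcase (by
        have : ((1 - s) + s * (1 - μ (a, b, c))) * a = 0 := by linarith
        exact (mul_eq_zero.1 this).resolve_left hfac) (by
        have : ((1 - s) + s * (1 - μ (a, b, c))) * b = 0 := by linarith
        exact (mul_eq_zero.1 this).resolve_left hfac)
  have hLs : ∀ p, ‖L p‖⁻¹ • L p ∈ sphere (0 : ℝ × ℝ × ℝ) 1 := fun p => by simp [norm_smul, hL p]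
  have hLi : Continuous fun p => ‖L p‖⁻¹ • L p :=
    (hLc.norm.inv₀ fun p => norm_ne_zero_iff.2 (hL p)).smul hLc
  let N : C(unitInterval × sphere (0 : ℝ × ℝ × ℝ) 1, sphere (0 : ℝ × ℝ × ℝ) 1) :=
    ⟨fun p => ⟨‖L p‖⁻¹ • L p, hLs p⟩, hLi.subtype_mk hLs⟩
  have hs : ((0, 0, -1) : ℝ × ℝ × ℝ) ∈ sphere (0 : ℝ × ℝ × ℝ) 1 := by
    rw [mem_sphere_zero_iff_norm, norm_triple]; norm_num
  have hkc : Continuous fun x => N (1, x) := by fun_prop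
  refine ⟨⟨fun x => N (1, x), hkc⟩, ⟨(0, 0, -1), hs⟩, ?_, ?_⟩
  · refine ⟨⟨N, fun x => ?_, fun x => rfl⟩⟩
    apply Subtype.ext
    have : L (0, x) = x.1 := by simp [L]
    simp only [N, this]
    simp
  · intro x hx
    apply Subtype.ext
    have h1 : μ x.1 = 1 := min_eq_left (by linarith)
    have : L (1, x) = (0, 0, -1) := by
      simp only [L, K, h1]
      ext <;> simp; norm_num
    have hn : ‖((0, 0, -1) : ℝ × ℝ × ℝ)‖ = 1 := mem_sphere_zero_iff_norm.1 hs
    change ‖L (1, x)‖⁻¹ • L (1, x) = ((0, 0, -1) : ℝ × ℝ × ℝ)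
    rw [this, hn, inv_one, one_smul]

/-- If `π₂(T, x₀) = 0`, then each map of the sphere to the path component of `x₀` is
null-homotopic. -/
theorem nullhomotopic_of_subsingleton_pi_two {T : Type*} [TopologicalSpace T] {x₀ : T}
    (hpi : Subsingleton (π_ 2 T x₀)) (f : C(sphere (0 : ℝ × ℝ × ℝ) 1, T))
    (hf : ∀ x, Joined (f x) x₀) : f.Homotopic (ContinuousMap.const _ x₀) := by
  obtain ⟨k, s, hk, hks⟩ := exists_homotopic_id_cubeHeight
  have hfk : f.Homotopic (f.comp k) := by
    have := (ContinuousMap.Homotopic.refl f).comp hk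
    rwa [ContinuousMap.comp_id] at this
  obtain ⟨δ⟩ := hf s
  have hMc : Continuous fun p : unitInterval × sphere (0 : ℝ × ℝ × ℝ) 1 => cubeHeight p.2.1 :=
    continuous_cubeHeight.comp (by fun_prop)
  -- move the value on the lower part to the base point
  let G : C(unitInterval × sphere (0 : ℝ × ℝ × ℝ) 1, T) :=
    ⟨fun p => if cubeHeight p.2.1 ≤ 1 / 2 then f (k p.2)
      else δ.extend (p.1 * (2 * cubeHeight p.2.1 - 1)), by
      refine Continuous.if_le (by fun_prop) ?_ hMc continuous_const ?_
      · exact δ.continuous_extend.comp (by fun_prop)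
      · intro p hp
        rw [hp, hks _ hp.ge]
        simp⟩
  let g : C(sphere (0 : ℝ × ℝ × ℝ) 1, T) := ⟨fun x => G (1, x), by fun_prop⟩
  have hg : (f.comp k).Homotopic g := by
    refine ⟨⟨G, fun x => ?_, fun x => rfl⟩⟩
    simp only [G]
    split_ifs with h
    · rfl
    · rw [ContinuousMap.comp_apply, hks x (by linarith)]
      simp
  have hg1 : ∀ x : sphere (0 : ℝ × ℝ × ℝ) 1, 1 ≤ cubeHeight x.1 → g x = x₀ := by
    intro x hx
    simp only [g, G, ContinuousMap.coe_mk]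
    rw [if_neg (by linarith)]
    exact δ.extend_of_one_le (by simp; linarith)
  -- the resulting generalized loop
  let top : (Fin 2 → unitInterval) → sphere (0 : ℝ × ℝ × ℝ) 1 := fun p =>
    ⟨(2 * (p 0 : ℝ) - 1, 2 * (p 1 : ℝ) - 1, 1), by
      have h1 : |2 * (p 0 : ℝ) - 1| ≤ 1 := abs_le.2 ⟨by linarith [(p 0).2.1], by linarith [(p 0).2.2]⟩
      have h2 : |2 * (p 1 : ℝ) - 1| ≤ 1 := abs_le.2 ⟨by linarith [(p 1).2.1], by linarith [(p 1).2.2]⟩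
      rw [mem_sphere_zero_iff_norm, norm_triple]
      simp only [abs_one]
      rw [max_eq_right h2, max_eq_right h1]⟩
  have htop : Continuous top := Continuous.subtype_mk (by fun_prop) _
  let w : GenLoop (Fin 2) T x₀ := ⟨g.comp ⟨top, htop⟩, by
    rintro y ⟨i, hi⟩
    refine hg1 _ ?_
    simp only [ContinuousMap.coe_mk, top, cubeHeight]
    refine le_max_of_le_left ?_
    have : |2 * (y i : ℝ) - 1| = 1 := by
      rcases hi with hi | hi <;> rw [hi] <;> norm_num
    fin_cases i
    · exact le_max_of_le_left this.ge
    · exact le_max_of_le_right this.ge⟩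
  have hw : GenLoop.Homotopic w GenLoop.const :=
    Quotient.exact (@Subsingleton.elim _ hpi (Quotient.mk _ w) (Quotient.mk _ GenLoop.const))
  obtain ⟨Θ⟩ := hw
  let π : sphere (0 : ℝ × ℝ × ℝ) 1 → (Fin 2 → unitInterval) := fun x =>
    ![projIcc 0 1 zero_le_one ((x.1.1 + 1) / 2), projIcc 0 1 zero_le_one ((x.1.2.1 + 1) / 2)]
  have hπ : Continuous π := by
    refine continuous_pi fun i => ?_
    fin_cases i
    · exact (continuous_projIcc (h := zero_le_one)).comp
        (f := fun x : sphere (0 : ℝ × ℝ × ℝ) 1 => (x.1.1 + 1) / 2) (by fun_prop)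
    · exact (continuous_projIcc (h := zero_le_one)).comp
        (f := fun x : sphere (0 : ℝ × ℝ × ℝ) 1 => (x.1.2.1 + 1) / 2) (by fun_prop)
  have hbd : ∀ x : sphere (0 : ℝ × ℝ × ℝ) 1, x.1.2.2 = 1 → 1 ≤ cubeHeight x.1 →
      π x ∈ Cube.boundary (Fin 2) := by
    intro x hx h1
    simp only [cubeHeight, hx, sub_self, zero_div] at h1
    rw [le_max_iff] at h1
    have h1 := h1.resolve_right (by norm_num)
    have key : ∀ a : ℝ, 1 ≤ |a| → projIcc 0 1 zero_le_one ((a + 1) / 2) = (0 : unitInterval) ∨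
        projIcc 0 1 zero_le_one ((a + 1) / 2) = (1 : unitInterval) := by
      intro a ha
      rcases le_abs.1 ha with h | h
      · right; exact projIcc_of_right_le _ (by linarith)
      · left; exact projIcc_of_le_left _ (by linarith)
    rcases le_max_iff.1 h1 with h | h
    · exact ⟨0, key _ h⟩
    · exact ⟨1, key _ h⟩
  have htopπ : ∀ x : sphere (0 : ℝ × ℝ × ℝ) 1, x.1.2.2 = 1 → top (π x) = x := by
    intro x hx
    have hn := mem_sphere_zero_iff_norm.1 x.2
    rw [norm_triple] at hn
    have h1 := abs_le.1 ((le_max_left _ _).trans hn.le)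
    have h2 := abs_le.1 ((le_max_left _ _).trans ((le_max_right _ _).trans hn.le))
    have e1 : ((π x 0 : unitInterval) : ℝ) = (x.1.1 + 1) / 2 := by
      simp only [π, Matrix.cons_val_zero]
      rw [projIcc_of_mem _ ⟨by linarith [h1.1], by linarith [h1.2]⟩]
    have e2 : ((π x 1 : unitInterval) : ℝ) = (x.1.2.1 + 1) / 2 := by
      simp only [π, Matrix.cons_val_one]
      rw [projIcc_of_mem _ ⟨by linarith [h2.1], by linarith [h2.2]⟩]
      rfl
    apply Subtype.ext
    simp only [top, e1, e2]
    ext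
    · simp only; ring
    · simp only; ring
    · exact hx.symm
  -- The null-homotopy of the loop lives on the top face and is continued by the constant `x₀`. Both
  -- prescriptions agree on the edges of the top face because `Θ` is relative to the boundary of the
  -- square.
  let N : unitInterval × sphere (0 : ℝ × ℝ × ℝ) 1 → T := fun p =>
    if 1 ≤ cubeHeight p.2.1 then x₀ else Θ (p.1, π p.2)
  have hN1 : ∀ p : unitInterval × sphere (0 : ℝ × ℝ × ℝ) 1, p.2.1.2.2 = 1 →
      N p = Θ (p.1, π p.2) := by
    intro p hp
    simp only [N]
    split_ifs with h
    · have := Θ.eq_fst p.1 (hbd _ hp h)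
      rw [this]
      exact (w.2 _ (hbd _ hp h)).symm
    · rfl
  have hNc : Continuous N := by
    have hA : IsClosed {p : unitInterval × sphere (0 : ℝ × ℝ × ℝ) 1 | p.2.1.2.2 = 1} :=
      isClosed_eq (by fun_prop) continuous_const
    have hB : IsClosed {p : unitInterval × sphere (0 : ℝ × ℝ × ℝ) 1 | 1 ≤ cubeHeight p.2.1} :=
      isClosed_le continuous_const hMc
    rw [← continuousOn_univ]
    have : (univ : Set (unitInterval × sphere (0 : ℝ × ℝ × ℝ) 1)) =
        {p | p.2.1.2.2 = 1} ∪ {p | 1 ≤ cubeHeight p.2.1} := by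
      refine (eq_univ_of_forall fun p => ?_).symm
      by_cases h : 1 ≤ cubeHeight p.2.1
      · exact Or.inr h
      · exact Or.inl (cubeHeight_lt_one_imp (mem_sphere_zero_iff_norm.1 p.2.2) (not_le.1 h))
    rw [this]
    refine ContinuousOn.union_of_isClosed ?_ ?_ hA hB
    · refine ContinuousOn.congr (f := fun p => Θ (p.1, π p.2)) ?_ fun p hp => hN1 p hp
      exact (Θ.continuous.comp (by fun_prop)).continuousOn
    · exact ContinuousOn.congr continuousOn_const fun p hp => if_pos hp
  refine hfk.trans (hg.trans ⟨⟨⟨N, hNc⟩, fun x => ?_, fun x => ?_⟩⟩)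
  · by_cases h : 1 ≤ cubeHeight x.1
    · simp only [N, if_pos h, hg1 x h]
    · have hx := cubeHeight_lt_one_imp (mem_sphere_zero_iff_norm.1 x.2) (not_le.1 h)
      simp only [ContinuousMap.coe_mk]
      rw [hN1 _ hx, Θ.apply_zero]
      simp only [w, ContinuousMap.comp_apply, ContinuousMap.coe_mk, htopπ x hx]
  · simp only [N]
    split_ifs with h
    · rfl
    · rw [Θ.apply_one]; rfl

open unitInterval

/-- The boundary of the cube `I³`. -/
def tripleBoundary : Set (I × I × I) :=
  {p | (p.1 = 0 ∨ p.1 = 1) ∨ (p.2.1 = 0 ∨ p.2.1 = 1) ∨ (p.2.2 = 0 ∨ p.2.2 = 1)}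

/-- If `π₂(T, x₀) = 0`, then each map of the boundary of a cube to the path component of `x₀`
extends to the cube. -/
theorem exists_extension_of_subsingleton_pi_two {T : Type*} [TopologicalSpace T] {x₀ : T}
    (hpi : Subsingleton (π_ 2 T x₀)) {u : I × I × I → T} (hu : ContinuousOn u tripleBoundary)
    (hj : ∀ p ∈ tripleBoundary, Joined (u p) x₀) :
    ∃ U : C(I × I × I, T), EqOn U u tripleBoundary := by
  -- In the maximum norm the unit ball of `ℝ × ℝ × ℝ` is the cube `[-1,1]³`, so filling the cube is
  -- an instance of the extension from sphere to ball.
  let c : ℝ → I := fun a => projIcc 0 1 zero_le_one ((a + 1) / 2)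
  have hc : Continuous c := continuous_projIcc.comp (by fun_prop)
  let φ : ℝ × ℝ × ℝ → I × I × I := fun x => (c x.1, c x.2.1, c x.2.2)
  have hφ : Continuous φ := by simp only [φ]; fun_prop
  have hcb : ∀ a : ℝ, |a| = 1 → c a = 0 ∨ c a = 1 := by
    intro a ha
    rcases (abs_eq zero_le_one).1 ha with rfl | rfl
    · right; exact projIcc_of_right_le _ (by norm_num)
    · left; exact projIcc_of_le_left _ (by norm_num)
  have hφb : ∀ x ∈ sphere (0 : ℝ × ℝ × ℝ) 1, φ x ∈ tripleBoundary := by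
    intro x hx
    rw [mem_sphere_zero_iff_norm, norm_triple] at hx
    rcases max_choice |x.1| (max |x.2.1| |x.2.2|) with h | h
    · exact Or.inl (hcb _ (h ▸ hx))
    · rw [h] at hx
      rcases max_choice |x.2.1| |x.2.2| with h | h
      · exact Or.inr (Or.inl (hcb _ (h ▸ hx)))
      · exact Or.inr (Or.inr (hcb _ (h ▸ hx)))
  let f : C(sphere (0 : ℝ × ℝ × ℝ) 1, T) :=
    ⟨fun x => u (φ x), hu.comp_continuous (hφ.comp continuous_subtype_val) fun x => hφb x x.2⟩
  obtain ⟨F, hF⟩ := exists_continuousMap_closedBall_of_nullhomotopic f x₀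
    (nullhomotopic_of_subsingleton_pi_two hpi f fun x => hj _ (hφb x x.2))
  have hle : ∀ s : I, |2 * (s : ℝ) - 1| ≤ 1 := fun s =>
    abs_le.2 ⟨by linarith [s.2.1], by linarith [s.2.2]⟩
  have hcs : ∀ s : I, c (2 * s - 1) = s := fun s => by
    simp only [c]
    have : (2 * (s : ℝ) - 1 + 1) / 2 = s := by ring
    rw [this, projIcc_val]
  let ψ : I × I × I → ℝ × ℝ × ℝ := fun p =>
    (2 * (p.1 : ℝ) - 1, 2 * (p.2.1 : ℝ) - 1, 2 * (p.2.2 : ℝ) - 1)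
  have hψ : ∀ p, ψ p ∈ closedBall (0 : ℝ × ℝ × ℝ) 1 := fun p => by
    rw [mem_closedBall_zero_iff, norm_triple]
    exact max_le (hle _) (max_le (hle _) (hle _))
  refine ⟨⟨fun p => F ⟨ψ p, hψ p⟩, F.continuous.comp (Continuous.subtype_mk
    (by simp only [ψ]; fun_prop) _)⟩, fun p hp => ?_⟩
  have hb : ∀ s : I, s = 0 ∨ s = 1 → |2 * (s : ℝ) - 1| = 1 := by
    rintro s (rfl | rfl) <;> norm_num
  have hs : ψ p ∈ sphere (0 : ℝ × ℝ × ℝ) 1 := by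
    rw [mem_sphere_zero_iff_norm]
    refine le_antisymm (mem_closedBall_zero_iff.1 (hψ p)) ?_
    rw [norm_triple]
    rcases hp with h | h | h
    · exact le_max_of_le_left (hb _ h).ge
    · exact le_max_of_le_right (le_max_of_le_left (hb _ h).ge)
    · exact le_max_of_le_right (le_max_of_le_right (hb _ h).ge)
  have := hF ⟨ψ p, hs⟩
  simp only [ContinuousMap.coe_mk]
  rw [this]
  simp only [f, ContinuousMap.coe_mk, φ, ψ, hcs]

end Sphere


/-! ### Retracting a prism onto its boundary with part of one side removed. -/

section Retraction

open Set Metric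

/-- A closed subset of the unit sphere which is a retract of the sphere without a point is a retract
of the unit ball. -/
theorem exists_retraction_closedBall {V : Type*} [NormedAddCommGroup V] [NormedSpace ℝ V]
    {D : Set V} (hD : IsClosed D) (hDS : D ⊆ sphere 0 1) {z : V} (hz : ‖z‖ = 1) (hzD : z ∉ D)
    {r : V → V} (hr : ContinuousOn r (sphere 0 1 \ {z})) (hrD : MapsTo r (sphere 0 1 \ {z}) D)
    (hrid : ∀ x ∈ D, r x = x) :
    ∃ ρ : V → V, ContinuousOn ρ (closedBall 0 1) ∧ MapsTo ρ (closedBall 0 1) D ∧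
      ∀ x ∈ D, ρ x = x := by
  have hseg : IsClosed (segment ℝ 0 z) := by
    rw [← convexHull_pair]
    exact ((Set.toFinite {(0 : V), z}).isCompact_convexHull (𝕜 := ℝ)).isClosed
  have hmem : ∀ s : ℝ, 0 ≤ s → s ≤ 1 → s • z ∈ segment ℝ 0 z := fun s h0 h1 =>
    ⟨1 - s, s, by linarith, h0, by ring, by simp⟩
  have hdisj : Disjoint D (segment ℝ 0 z) := by
    rw [Set.disjoint_left]
    rintro x hx ⟨a, b, ha, hb, hab, rfl⟩
    have h1 := mem_sphere_zero_iff_norm.1 (hDS hx)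
    rw [smul_zero, zero_add, norm_smul, hz, mul_one, Real.norm_eq_abs, abs_of_nonneg hb] at h1
    subst h1
    simp at hx
    exact hzD hx
  obtain ⟨ν, hν0, hν1, hν⟩ := exists_continuous_zero_one_of_isClosed hD hseg hdisj
  -- The ball is pushed away from `z` by `x ↦ x - μ x • z` and then projected to the sphere. If the
  -- pushed point were `l • z` with `l ≥ 0`, then `x` would lie on the segment from `0` to `z`,
  -- where `μ = 2`. This would give `‖x‖ ≥ 2`, which is impossible. Since `μ = 0` on `D`, points of
  -- `D` stay fixed.
  let μ : V → ℝ := fun x => 2 * ν x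
  have hμ0 : ∀ x, 0 ≤ μ x := fun x => by have := (hν x).1; simp only [μ]; linarith
  have hμs : ∀ x ∈ segment ℝ 0 z, μ x = 2 := fun x hx => by
    have := hν1 hx; simp only [Pi.one_apply] at this; simp only [μ, this]; norm_num
  have hkey : ∀ x ∈ closedBall (0 : V) 1, ∀ l : ℝ, 0 ≤ l → x - μ x • z ≠ l • z := by
    intro x hx l hl h
    have hx' : x = (μ x + l) • z := by rw [add_smul, ← h]; abel
    have hn : μ x + l ≤ 1 := by
      have := mem_closedBall_zero_iff.1 hx
      rw [hx', norm_smul, hz, mul_one, Real.norm_eq_abs] at this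
      exact (le_abs_self _).trans this
    have h0 : 0 ≤ μ x + l := add_nonneg (hμ0 x) hl
    have := hμs x (by rw [hx']; exact hmem _ h0 hn)
    linarith
  have hne : ∀ x ∈ closedBall (0 : V) 1, x - μ x • z ≠ 0 := fun x hx => by
    have := hkey x hx 0 le_rfl
    rwa [zero_smul] at this
  let N : V → V := fun x => ‖x - μ x • z‖⁻¹ • (x - μ x • z)
  have hNc : ContinuousOn N (closedBall 0 1) := by
    have h1 : Continuous fun x => x - μ x • z := by simp only [μ]; fun_prop
    exact (h1.norm.continuousOn.inv₀ fun x hx => norm_ne_zero_iff.2 (hne x hx)).smul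
      h1.continuousOn
  have hNm : MapsTo N (closedBall 0 1) (sphere 0 1 \ {z}) := by
    intro x hx
    refine ⟨by simp [N, norm_smul, hne x hx], fun h => ?_⟩
    have hn := norm_ne_zero_iff.2 (hne x hx)
    refine hkey x hx ‖x - μ x • z‖ (norm_nonneg _) ?_
    rw [mem_singleton_iff] at h
    have h2 : ‖x - μ x • z‖ • N x = ‖x - μ x • z‖ • z := by rw [h]
    rw [← h2]
    simp only [N, smul_smul, mul_inv_cancel₀ hn, one_smul]
  refine ⟨r ∘ N, hr.comp hNc hNm, hrD.comp hNm, fun x hx => ?_⟩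
  have h1 : μ x = 0 := by
    have := hν0 hx; simp only [Pi.zero_apply] at this; simp only [μ, this, mul_zero]
  have h2 : N x = x := by
    simp only [N, h1, zero_smul, sub_zero]
    rw [mem_sphere_zero_iff_norm.1 (hDS hx), inv_one, one_smul]
  rw [Function.comp_apply, h2, hrid x hx]

theorem pi_norm_eq_one_of_forall_lt {d : ℕ} {x : Fin d → ℝ} (hx : ‖x‖ = 1) {i : Fin d}
    (h : ∀ k ≠ i, |x k| < 1) : |x i| = 1 := by
  refine le_antisymm ((norm_le_pi_norm x i).trans hx.le) (not_lt.1 fun hlt => ?_)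
  have : ‖x‖ < 1 := (pi_norm_lt_iff zero_lt_one).2 fun k => by
    rw [Real.norm_eq_abs]
    by_cases hk : k = i
    · rw [hk]; exact hlt
    · exact h k hk
  linarith

/-- The prism over a cube retracts onto its boundary with the open prism over a smaller square in
a face of the cube removed (normalized form). -/
theorem exists_retraction_prism_zero {d : ℕ} {z : Fin d → ℝ} {i j : Fin d} (hij : j ≠ i) {h : ℝ}
    (hh : 0 < h) (hzi : |z i| = 1) (hz : ∀ k ≠ i, |z k| + h ≤ 1) :
    ∃ ρ : (Fin d → ℝ) × ℝ → (Fin d → ℝ) × ℝ, ContinuousOn ρ (closedBall 0 1) ∧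
      MapsTo ρ (closedBall 0 1) {v | ‖v‖ = 1 ∧ (h ≤ ‖v.1 - z‖ ∨ 1 ≤ |v.2|)} ∧
      ∀ v : (Fin d → ℝ) × ℝ, ‖v‖ = 1 → (h ≤ ‖v.1 - z‖ ∨ 1 ≤ |v.2|) → ρ v = v := by
  set D : Set ((Fin d → ℝ) × ℝ) := {v | ‖v‖ = 1 ∧ (h ≤ ‖v.1 - z‖ ∨ 1 ≤ |v.2|)} with hDdef
  have hh1 : h ≤ 1 := by have := hz j hij; linarith [abs_nonneg (z j)]
  have hnorm : ∀ v : (Fin d → ℝ) × ℝ, ‖v‖ = max ‖v.1‖ |v.2| := fun v => by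
    rw [Prod.norm_def]; rfl
  have hD : IsClosed D := by
    have h1 : IsClosed {v : (Fin d → ℝ) × ℝ | ‖v‖ = 1} := isClosed_eq (by fun_prop) (by fun_prop)
    have h2 : IsClosed {v : (Fin d → ℝ) × ℝ | h ≤ ‖v.1 - z‖} :=
      isClosed_le (by fun_prop) (by fun_prop)
    have h3 : IsClosed {v : (Fin d → ℝ) × ℝ | 1 ≤ |v.2|} :=
      isClosed_le (by fun_prop) (by fun_prop)
    exact h1.inter (h2.union h3)
  have hzn : ‖z‖ = 1 := by
    refine le_antisymm ((pi_norm_le_iff_of_nonneg zero_le_one).2 fun k => ?_)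
      (by rw [← hzi]; exact norm_le_pi_norm z i)
    by_cases hk : k = i
    · rw [hk]; exact hzi.le
    · have := hz k hk; rw [Real.norm_eq_abs]; linarith
  have hzz : ‖((z, 0) : (Fin d → ℝ) × ℝ)‖ = 1 := by
    rw [hnorm]; simp [hzn]
  have hzD : ((z, 0) : (Fin d → ℝ) × ℝ) ∉ D := by
    rintro ⟨-, h1 | h1⟩
    · simp only [sub_self, norm_zero] at h1; linarith
    · simp only [abs_zero] at h1; linarith
  set f : Set ((Fin d → ℝ) × ℝ) := {v | v.1 i = z i ∧ ‖v.1 - z‖ ≤ h ∧ |v.2| ≤ 1} with hfdef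
  have hf : IsClosed f := by
    have h1 : IsClosed {v : (Fin d → ℝ) × ℝ | v.1 i = z i} := isClosed_eq (by fun_prop) (by fun_prop)
    have h2 : IsClosed {v : (Fin d → ℝ) × ℝ | ‖v.1 - z‖ ≤ h} :=
      isClosed_le (by fun_prop) (by fun_prop)
    have h3 : IsClosed {v : (Fin d → ℝ) × ℝ | |v.2| ≤ 1} :=
      isClosed_le (by fun_prop) (by fun_prop)
    exact h1.inter (h2.inter h3)
  have hfD : ∀ v : (Fin d → ℝ) × ℝ, ‖v‖ = 1 → v ∉ D → v ∈ f := by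
    intro v hv hvD
    have hvD' : ‖v.1 - z‖ < h ∧ |v.2| < 1 := by
      by_contra hcon
      rw [not_and_or, not_lt, not_lt] at hcon
      exact hvD ⟨hv, hcon⟩
    have hk : ∀ k, |v.1 k - z k| < h := fun k => (norm_le_pi_norm (v.1 - z) k).trans_lt hvD'.1
    have hv1 : ‖v.1‖ = 1 := by
      rw [hnorm] at hv
      rcases max_choice ‖v.1‖ |v.2| with h1 | h1
      · rwa [h1] at hv
      · rw [h1] at hv; linarith [hvD'.2]
    have h1 := pi_norm_eq_one_of_forall_lt hv1 (i := i) fun k hki => by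
      have h2 := hk k; have h3 := hz k hki
      have := abs_add_le (v.1 k - z k) (z k)
      rw [sub_add_cancel] at this
      linarith
    refine ⟨?_, hvD'.1.le, hvD'.2.le⟩
    have h2 := abs_lt.1 (hk i)
    obtain ⟨h21, h22⟩ := h2
    rcases (abs_eq zero_le_one).1 h1 with h3 | h3 <;> rcases (abs_eq zero_le_one).1 hzi with h4 | h4
      <;> linarith
  -- `g` is the gauge of the closed removed side `f` with respect to its centre `(z, 0)`. Dividing
  -- by it projects the punctured side radially onto its rim, which lies in `D`.
  let g : (Fin d → ℝ) × ℝ → ℝ := fun v => max (‖v.1 - z‖ / h) |v.2|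
  have hgc : Continuous g := by simp only [g]; fun_prop
  have hg0 : ∀ v, v ≠ (z, 0) → 0 < g v := by
    intro v hv
    by_contra hcon
    have h1 := max_le_iff.1 (not_lt.1 hcon)
    have h2 : ‖v.1 - z‖ ≤ 0 := by
      have := h1.1; rwa [div_le_iff₀ hh, zero_mul] at this
    exact hv (Prod.ext (sub_eq_zero.1 (norm_le_zero_iff.1 h2)) (abs_nonpos_iff.1 h1.2))
  let r : (Fin d → ℝ) × ℝ → (Fin d → ℝ) × ℝ := fun v => (z, 0) + (g v)⁻¹ • (v - (z, 0))
  have hrD : ∀ v ∈ f, v ≠ (z, 0) → r v ∈ D := by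
    intro v hv hvz
    have hg := hg0 v hvz
    have e1 : (r v).1 - z = (g v)⁻¹ • (v.1 - z) := by simp [r]
    have e2 : (r v).2 = (g v)⁻¹ * v.2 := by simp [r]
    have e3 : (r v).1 i = z i := by
      have := congrFun e1 i
      simp only [Pi.sub_apply, Pi.smul_apply, hv.1, sub_self, smul_zero] at this
      linarith
    have n1 : ‖(r v).1 - z‖ = ‖v.1 - z‖ / g v := by
      rw [e1, norm_smul, Real.norm_eq_abs, abs_of_pos (inv_pos.2 hg)]; field_simp
    have n2 : |(r v).2| = |v.2| / g v := by
      rw [e2, abs_mul, abs_of_pos (inv_pos.2 hg)]; field_simp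
    have l1 : ‖(r v).1 - z‖ ≤ h := by
      rw [n1, div_le_iff₀ hg, mul_comm, ← div_le_iff₀ hh]; exact le_max_left _ _
    have l2 : |(r v).2| ≤ 1 := by
      rw [n2, div_le_iff₀ hg, one_mul]; exact le_max_right _ _
    refine ⟨?_, ?_⟩
    · rw [hnorm]
      refine le_antisymm (max_le ((pi_norm_le_iff_of_nonneg zero_le_one).2 fun k => ?_) l2)
        (le_max_of_le_left ?_)
      · by_cases hk : k = i
        · rw [hk, e3]; exact hzi.le
        · have h1 := norm_le_pi_norm ((r v).1 - z) k
          have h2 := hz k hk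
          have := abs_add_le ((r v).1 k - z k) (z k)
          rw [sub_add_cancel] at this
          rw [Pi.sub_apply, Real.norm_eq_abs] at h1
          rw [Real.norm_eq_abs]
          linarith
      · rw [← hzi, ← e3]; exact norm_le_pi_norm (r v).1 i
    · rcases max_choice (‖v.1 - z‖ / h) |v.2| with h1 | h1
      · left
        have : g v = ‖v.1 - z‖ / h := h1
        rw [n1, le_div_iff₀ hg, this]; field_simp; exact le_rfl
      · right
        have : g v = |v.2| := h1
        rw [n2, le_div_iff₀ hg, this, one_mul]
  have hrid : ∀ v ∈ f, v ∈ D → r v = v := by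
    rintro v ⟨-, hv2, hv3⟩ ⟨-, hvD⟩
    have : g v = 1 := by
      refine le_antisymm (max_le ((div_le_one hh).2 hv2) hv3) ?_
      rcases hvD with h1 | h1
      · exact le_max_of_le_left ((one_le_div hh).2 h1)
      · exact le_max_of_le_right h1
    simp [r, this]
  classical
  refine exists_retraction_closedBall hD (fun v hv => mem_sphere_zero_iff_norm.2 hv.1) hzz hzD
    (r := fun v => if v ∈ D then v else r v) ?_ ?_ (fun v hv => if_pos hv) |>.imp
    fun ρ hρ => ⟨hρ.1, hρ.2.1, fun v h1 h2 => hρ.2.2 v ⟨h1, h2⟩⟩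
  · have hsub : sphere (0 : (Fin d → ℝ) × ℝ) 1 \ {(z, 0)} ⊆
        (sphere 0 1 \ {(z, 0)}) ∩ D ∪ (sphere 0 1 \ {(z, 0)}) ∩ f := by
      intro v hv
      by_cases hvD : v ∈ D
      · exact Or.inl ⟨hv, hvD⟩
      · exact Or.inr ⟨hv, hfD v (mem_sphere_zero_iff_norm.1 hv.1) hvD⟩
    intro v hv
    have hcD : ContinuousOn (fun v => if v ∈ D then v else r v) D :=
      continuousOn_id.congr fun v hv => if_pos hv
    have hcf : ContinuousOn (fun v => if v ∈ D then v else r v) (f \ {(z, 0)}) := by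
      have : ContinuousOn r (f \ {(z, 0)}) := by
        have h1 : ContinuousOn (fun v => (g v)⁻¹) (f \ {(z, 0)}) :=
          hgc.continuousOn.inv₀ fun v hv => (hg0 v hv.2).ne'
        have h2 : ContinuousOn (fun v : (Fin d → ℝ) × ℝ => v - (z, 0)) (f \ {(z, 0)}) := by fun_prop
        exact continuousOn_const.add (h1.smul h2)
      refine this.congr fun v hv => ?_
      by_cases h1 : v ∈ D
      · simp only [if_pos h1]; exact (hrid v hv.1 h1).symm
      · exact if_neg h1
    have : ContinuousOn (fun v => if v ∈ D then v else r v) (D \ {(z, 0)} ∪ f \ {(z, 0)}) := by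
      rintro v (hv | hv)
      all_goals
        refine ContinuousWithinAt.union ?_ ?_
      · exact (hcD v hv.1).mono sdiff_subset
      · by_cases hvf : v ∈ f
        · exact hcf v ⟨hvf, hv.2⟩
        · refine continuousWithinAt_of_notMem_closure fun hcl => hvf ?_
          exact (closure_minimal sdiff_subset hf) hcl
      · by_cases hvD : v ∈ D
        · exact (hcD v hvD).mono sdiff_subset
        · refine continuousWithinAt_of_notMem_closure fun hcl => hvD ?_
          exact (closure_minimal sdiff_subset hD) hcl
      · exact hcf v hv
    refine (this v ?_).mono ?_
    · rcases hsub hv with h1 | h1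
      · exact Or.inl ⟨h1.2, h1.1.2⟩
      · exact Or.inr ⟨h1.2, h1.1.2⟩
    · intro v hv
      rcases hsub hv with h1 | h1
      · exact Or.inl ⟨h1.2, h1.1.2⟩
      · exact Or.inr ⟨h1.2, h1.1.2⟩
  · intro v hv
    by_cases h1 : v ∈ D
    · simp only [if_pos h1]; exact h1
    · simp only [if_neg h1]
      exact hrD v (hfD v (mem_sphere_zero_iff_norm.1 hv.1) h1) hv.2

/-- The prism over a cube retracts onto its boundary with the open prism over a smaller square in
a face of the cube removed. -/
theorem exists_retraction_prism {d : ℕ} {w z : Fin d → ℝ} {R h : ℝ} {i j : Fin d} (hij : j ≠ i)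
    (hR : 0 < R) (hh : 0 < h) (hzi : |z i - w i| = R) (hz : ∀ k ≠ i, |z k - w k| + h ≤ R) :
    ∃ ρ : (Fin d → ℝ) × unitInterval → (Fin d → ℝ) × unitInterval,
      ContinuousOn ρ (closedBall w R ×ˢ univ) ∧
      MapsTo ρ (closedBall w R ×ˢ univ) {v | ‖v.1 - w‖ ≤ R ∧
        ((v.2 = 0 ∨ v.2 = 1) ∨ (‖v.1 - w‖ = R ∧ h ≤ ‖v.1 - z‖))} ∧
      ∀ v, ‖v.1 - w‖ ≤ R → ((v.2 = 0 ∨ v.2 = 1) ∨ (‖v.1 - w‖ = R ∧ h ≤ ‖v.1 - z‖)) → ρ v = v := by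
  obtain ⟨ρ, hρc, hρm, hρid⟩ := exists_retraction_prism_zero (z := R⁻¹ • (z - w)) hij
    (h := h / R) (by positivity) (by
      simp only [Pi.smul_apply, Pi.sub_apply, smul_eq_mul, abs_mul, hzi, abs_of_pos (inv_pos.2 hR)]
      field_simp) (by
      intro k hk
      simp only [Pi.smul_apply, Pi.sub_apply, smul_eq_mul, abs_mul, abs_of_pos (inv_pos.2 hR)]
      have := hz k hk
      rw [inv_mul_eq_div, ← add_div, div_le_one hR]
      exact this)
  let a : (Fin d → ℝ) × unitInterval → (Fin d → ℝ) × ℝ := fun v => (R⁻¹ • (v.1 - w), 2 * (v.2 : ℝ) - 1)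
  let b : (Fin d → ℝ) × ℝ → (Fin d → ℝ) × unitInterval := fun v =>
    (w + R • v.1, projIcc 0 1 zero_le_one ((v.2 + 1) / 2))
  have hac : Continuous a := by simp only [a]; fun_prop
  have hbc : Continuous b := by
    refine Continuous.prodMk (by fun_prop) ?_
    exact (continuous_projIcc (h := zero_le_one)).comp (f := fun v : (Fin d → ℝ) × ℝ => (v.2 + 1) / 2)
      (by fun_prop)
  have hba : ∀ v, b (a v) = v := by
    intro v
    refine Prod.ext ?_ ?_
    · simp only [a, b]
      rw [smul_smul, mul_inv_cancel₀ hR.ne', one_smul]; abel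
    · simp only [a, b]
      have : (2 * (v.2 : ℝ) - 1 + 1) / 2 = v.2 := by ring
      rw [this, projIcc_val]
  have hle : ∀ s : unitInterval, |2 * (s : ℝ) - 1| ≤ 1 := fun s =>
    abs_le.2 ⟨by linarith [s.2.1], by linarith [s.2.2]⟩
  have hend : ∀ s : unitInterval, |2 * (s : ℝ) - 1| = 1 ↔ s = 0 ∨ s = 1 := by
    intro s
    constructor
    · intro h1
      rcases (abs_eq zero_le_one).1 h1 with h2 | h2
      · right; apply Subtype.ext; simp only [Icc.coe_one]; linarith
      · left; apply Subtype.ext; simp only [Icc.coe_zero]; linarith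
    · rintro (rfl | rfl) <;> norm_num
  have han : ∀ v, ‖a v‖ = max (‖v.1 - w‖ / R) |2 * (v.2 : ℝ) - 1| := by
    intro v
    rw [Prod.norm_def]
    simp only [a]
    rw [norm_smul, norm_inv, Real.norm_eq_abs, abs_of_pos hR, inv_mul_eq_div, Real.norm_eq_abs]
  have haz : ∀ v, ‖(a v).1 - R⁻¹ • (z - w)‖ = ‖v.1 - z‖ / R := by
    intro v
    simp only [a]
    rw [← smul_sub, sub_sub_sub_cancel_right, norm_smul, norm_inv, Real.norm_eq_abs, abs_of_pos hR,
      inv_mul_eq_div]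
  have ham : MapsTo a (closedBall w R ×ˢ univ) (closedBall 0 1) := by
    rintro v ⟨hv, -⟩
    rw [mem_closedBall_zero_iff, han]
    rw [mem_closedBall, dist_eq_norm] at hv
    exact max_le ((div_le_one hR).2 hv) (hle _)
  -- the two descriptions of the target
  have hchar : ∀ v, (‖v.1 - w‖ ≤ R ∧ ((v.2 = 0 ∨ v.2 = 1) ∨ (‖v.1 - w‖ = R ∧ h ≤ ‖v.1 - z‖))) ↔
      (‖a v‖ = 1 ∧ (h / R ≤ ‖(a v).1 - R⁻¹ • (z - w)‖ ∨ 1 ≤ |(a v).2|)) := by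
    intro v
    rw [han, haz, div_le_div_iff_of_pos_right hR]
    have h2 : |(a v).2| = |2 * (v.2 : ℝ) - 1| := rfl
    rw [h2]
    constructor
    · rintro ⟨h3, h4 | ⟨h4, h5⟩⟩
      · have := (hend _).2 h4
        refine ⟨?_, Or.inr this.ge⟩
        rw [this, max_eq_right ((div_le_one hR).2 h3)]
      · refine ⟨?_, Or.inl h5⟩
        rw [h4, div_self hR.ne', max_eq_left (hle _)]
    · rintro ⟨h3, h4⟩
      have h5 : ‖v.1 - w‖ ≤ R := (div_le_one hR).1 ((le_max_left _ _).trans h3.le)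
      refine ⟨h5, ?_⟩
      by_cases h6 : v.2 = 0 ∨ v.2 = 1
      · exact Or.inl h6
      · right
        have h7 : |2 * (v.2 : ℝ) - 1| < 1 := lt_of_le_of_ne (hle _) fun h => h6 ((hend _).1 h)
        refine ⟨?_, h4.resolve_right (not_le.2 h7)⟩
        rcases max_choice (‖v.1 - w‖ / R) |2 * (v.2 : ℝ) - 1| with h8 | h8
        · rw [h8, div_eq_one_iff_eq hR.ne'] at h3; exact h3
        · rw [h8] at h3; linarith
  have hab : ∀ v : (Fin d → ℝ) × ℝ, ‖v‖ ≤ 1 → a (b v) = v := by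
    intro v hv
    have h2 := abs_le.1 (((le_max_right ‖v.1‖ ‖v.2‖).trans_eq (Prod.norm_def v).symm).trans hv)
    refine Prod.ext ?_ ?_
    · simp only [a, b]
      rw [add_sub_cancel_left, smul_smul, inv_mul_cancel₀ hR.ne', one_smul]
    · simp only [a, b]
      rw [projIcc_of_mem _ ⟨by linarith [h2.1], by linarith [h2.2]⟩]
      ring
  refine ⟨fun v => b (ρ (a v)), hbc.comp_continuousOn (hρc.comp hac.continuousOn ham), ?_, ?_⟩
  · intro v hv
    have h1 := hρm (ham hv)
    refine (hchar _).2 ?_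
    rw [hab _ h1.1.le]
    exact h1
  · intro v h1 h2
    have h3 := (hchar v).1 ⟨h1, h2⟩
    simp only
    rw [hρid _ h3.1 h3.2, hba]

end Retraction


/-! ### The dyadic decomposition of an open subset of `ℝ³`. -/

namespace DyadicBox

open Set

/-- Grid points of the coarse level `k` are also grid points of level `n`. Hence the coarse grid
point below `x` is at most the fine one. -/
theorem floor_coarsen {k n : ℕ} (hkn : k ≤ n) {x y : ℝ} (h : (⌊(2 : ℝ) ^ n * x⌋ : ℝ) ≤ 2 ^ n * y) :
    (⌊(2 : ℝ) ^ k * x⌋ : ℝ) ≤ 2 ^ k * y := by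
  obtain ⟨d, rfl⟩ := Nat.exists_eq_add_of_le hkn
  have h2 : (0 : ℝ) < 2 ^ d := by positivity
  have h1 : ⌊(2 : ℝ) ^ k * x⌋ * 2 ^ d ≤ ⌊(2 : ℝ) ^ (k + d) * x⌋ := by
    rw [Int.le_floor]
    push_cast
    calc (⌊(2 : ℝ) ^ k * x⌋ : ℝ) * 2 ^ d ≤ (2 ^ k * x) * 2 ^ d :=
          mul_le_mul_of_nonneg_right (Int.floor_le _) h2.le
      _ = 2 ^ (k + d) * x := by ring
  have h3 : (⌊(2 : ℝ) ^ k * x⌋ : ℝ) * 2 ^ d ≤ (⌊(2 : ℝ) ^ (k + d) * x⌋ : ℝ) := by exact_mod_cast h1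
  have h4 := h3.trans h
  rw [show (2 : ℝ) ^ (k + d) * y = (2 ^ k * y) * 2 ^ d by ring] at h4
  exact le_of_mul_le_mul_right h4 h2

theorem ceil_coarsen {k n : ℕ} (hkn : k ≤ n) {x y : ℝ} (h : 2 ^ n * y ≤ (⌈(2 : ℝ) ^ n * x⌉ : ℝ)) :
    2 ^ k * y ≤ (⌈(2 : ℝ) ^ k * x⌉ : ℝ) := by
  have := floor_coarsen hkn (x := -x) (y := -y)
  simp only [mul_neg, Int.floor_neg] at this
  push_cast at this
  linarith [this (by linarith)]

theorem isInt_refine {k n : ℕ} (hkn : k ≤ n) {x : ℝ} (h : ∃ m : ℤ, (2 : ℝ) ^ k * x = m) :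
    ∃ m : ℤ, (2 : ℝ) ^ n * x = m := by
  obtain ⟨d, rfl⟩ := Nat.exists_eq_add_of_le hkn
  obtain ⟨m, hm⟩ := h
  exact ⟨2 ^ d * m, by push_cast; rw [← hm, pow_add]; ring⟩

theorem floor_ne_ceil_iff {s : ℝ} : ⌊s⌋ ≠ ⌈s⌉ ↔ ¬ ∃ m : ℤ, s = m := by
  rw [not_iff_not]
  constructor
  · intro h
    refine ⟨⌊s⌋, le_antisymm ?_ (Int.floor_le s)⟩
    rw [h]; exact Int.le_ceil s
  · rintro ⟨m, rfl⟩
    simp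

theorem ceil_eq_floor_add_one_of_ne {s : ℝ} (h : ⌊s⌋ ≠ ⌈s⌉) : ⌈s⌉ = ⌊s⌋ + 1 := by
  have h1 := Int.floor_le_ceil s
  have h2 := Int.ceil_le_floor_add_one s
  omega

/-- The union of the closed cubes of side `2⁻ⁿ` at distance at most `2⁻ⁿ` from those around `x`. -/
def thickStar (n : ℕ) (x : Fin 3 → ℝ) : Set (Fin 3 → ℝ) :=
  {y | ∀ i, (⌈(2 : ℝ) ^ n * x i⌉ : ℝ) - 2 ≤ 2 ^ n * y i ∧ 2 ^ n * y i ≤ ⌊(2 : ℝ) ^ n * x i⌋ + 2}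

theorem thickStar_subset {n : ℕ} {x y : Fin 3 → ℝ}
    (h1 : ∀ i, ⌈(2 : ℝ) ^ n * x i⌉ ≤ ⌈(2 : ℝ) ^ n * y i⌉)
    (h2 : ∀ i, ⌊(2 : ℝ) ^ n * y i⌋ ≤ ⌊(2 : ℝ) ^ n * x i⌋) : thickStar n y ⊆ thickStar n x := by
  intro z hz i
  have h3 : (⌈(2 : ℝ) ^ n * x i⌉ : ℝ) ≤ ⌈(2 : ℝ) ^ n * y i⌉ := by exact_mod_cast h1 i
  have h4 : (⌊(2 : ℝ) ^ n * y i⌋ : ℝ) ≤ ⌊(2 : ℝ) ^ n * x i⌋ := by exact_mod_cast h2 i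
  exact ⟨by linarith [(hz i).1], by linarith [(hz i).2]⟩

theorem exists_thickStar_subset {O : Set (Fin 3 → ℝ)} (hO : IsOpen O) {x : Fin 3 → ℝ} (hx : x ∈ O) :
    ∃ n, thickStar n x ⊆ O := by
  obtain ⟨ε, hε, hball⟩ := Metric.isOpen_iff.1 hO x hx
  obtain ⟨n, hn⟩ := pow_unbounded_of_one_lt (3 / ε) (one_lt_two)
  refine ⟨n, fun z hz => hball ?_⟩
  rw [Metric.mem_ball, dist_pi_lt_iff hε]
  intro i
  obtain ⟨h1, h2⟩ := hz i
  have h3 := Int.le_ceil ((2 : ℝ) ^ n * x i)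
  have h4 := Int.floor_le ((2 : ℝ) ^ n * x i)
  rw [div_lt_iff₀ hε] at hn
  have hp : (0 : ℝ) < 2 ^ n := by positivity
  rw [Real.dist_eq, abs_lt]
  constructor
  · by_contra hcon
    nlinarith
  · by_contra hcon
    nlinarith

/-- Indices of dyadic boxes: a level together with the lower and the upper corner, in units
of `2⁻ⁿ`. -/
abbrev Idx : Type := ℕ × (Fin 3 → ℤ) × (Fin 3 → ℤ)

/-- The directions in which a box has positive width. -/
def free (j : Idx) : Finset (Fin 3) := Finset.univ.filter fun i => j.2.1 i ≠ j.2.2 i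

theorem mem_free {j : Idx} {i : Fin 3} : i ∈ free j ↔ j.2.1 i ≠ j.2.2 i := by simp [free]

variable {O : Set (Fin 3 → ℝ)}

theorem continuous_scaled_coord (n : ℕ) (i : Fin 3) : Continuous fun y : O => (2 : ℝ) ^ n * y.1 i :=
  continuous_const.mul ((continuous_apply i).comp continuous_subtype_val)

/-- The points of a box lying in `O`. -/
def box (O : Set (Fin 3 → ℝ)) (j : Idx) : Set O :=
  {y | ∀ i, (j.2.1 i : ℝ) ≤ 2 ^ j.1 * y.1 i ∧ 2 ^ j.1 * y.1 i ≤ j.2.2 i}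

theorem isClosed_box (j : Idx) : IsClosed (box O j) := by
  have : box O j = ⋂ i, {y : O | (j.2.1 i : ℝ) ≤ 2 ^ j.1 * y.1 i} ∩ {y | 2 ^ j.1 * y.1 i ≤ j.2.2 i} := by
    ext y; simp [box]
  rw [this]
  exact isClosed_iInter fun i => (isClosed_le continuous_const (continuous_scaled_coord _ i)).inter
    (isClosed_le (continuous_scaled_coord _ i) continuous_const)

open Classical in
/-- The level of a point of `O`. -/
noncomputable def lev (x : O) : ℕ := sInf {n | thickStar n x.1 ⊆ O}

theorem thickStar_lev_subset (hO : IsOpen O) (x : O) : thickStar (lev x) x.1 ⊆ O :=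
  Nat.sInf_mem (s := {n | thickStar n x.1 ⊆ O}) (exists_thickStar_subset hO x.2)

theorem lev_le {x : O} {n : ℕ} (h : thickStar n x.1 ⊆ O) : lev x ≤ n :=
  Nat.sInf_le h

/-- The cell of the dyadic decomposition containing a point of `O` in its relative interior. -/
noncomputable def cell (x : O) : Idx :=
  (lev x, fun i => ⌊(2 : ℝ) ^ lev x * x.1 i⌋, fun i => ⌈(2 : ℝ) ^ lev x * x.1 i⌉)

/-- The cells of the dyadic decomposition of `O`. -/
def cells (O : Set (Fin 3 → ℝ)) : Set Idx := range (cell (O := O))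

theorem mem_box_cell (x : O) : x ∈ box O (cell x) :=
  fun _ => ⟨Int.floor_le _, Int.le_ceil _⟩

theorem mem_free_cell {x : O} {i : Fin 3} :
    i ∈ free (cell x) ↔ ¬ ∃ m : ℤ, (2 : ℝ) ^ lev x * x.1 i = m := by
  rw [mem_free]; exact floor_ne_ceil_iff

/-- Passing to a face never makes the level coarser, which is what makes cells of different sizes
fit together. If `y` had a smaller level, then on that coarser grid `y` would still lie in the
closed box around `x`. So the thick star of `x` would lie in that of `y`, hence in `O`, against the
minimality of `lev x`. -/
theorem lev_le_of_mem_box (hO : IsOpen O) {x y : O} (h : y ∈ box O (cell x)) : lev x ≤ lev y := by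
  by_contra hcon
  push Not at hcon
  refine absurd (lev_le (x := x) (n := lev y) ?_) (not_le.2 hcon)
  refine (thickStar_subset (x := y.1) (y := x.1) ?_ ?_).trans (thickStar_lev_subset hO y)
  · intro i
    exact Int.ceil_le.2 (ceil_coarsen hcon.le (h i).2)
  · intro i
    exact Int.le_floor.2 (floor_coarsen hcon.le (h i).1)

/-- A box is a subset of each box whose cell closure it meets. -/
theorem box_subset_box (hO : IsOpen O) {x y : O} (h : y ∈ box O (cell x)) :
    box O (cell y) ⊆ box O (cell x) := by
  intro z hz i
  have hl := lev_le_of_mem_box hO h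
  have h1 := floor_coarsen hl (hz i).1
  have h2 := ceil_coarsen hl (hz i).2
  have h3 : ⌊(2 : ℝ) ^ lev x * x.1 i⌋ ≤ ⌊(2 : ℝ) ^ lev x * y.1 i⌋ := Int.le_floor.2 (h i).1
  have h4 : ⌈(2 : ℝ) ^ lev x * y.1 i⌉ ≤ ⌈(2 : ℝ) ^ lev x * x.1 i⌉ := Int.ceil_le.2 (h i).2
  exact ⟨(Int.cast_le.2 h3).trans h1, h2.trans (Int.cast_le.2 h4)⟩

/-- In a degenerate direction of the large cell the coordinate of `y` lies on the grid of level `lev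
x`, and therefore on the finer grid of level `lev y`. -/
theorem free_subset_of_mem_box (hO : IsOpen O) {x y : O} (h : y ∈ box O (cell x)) :
    free (cell y) ⊆ free (cell x) := by
  intro i hi
  rw [mem_free_cell] at hi
  rw [mem_free]
  intro heq
  have := h i
  rw [← heq] at this
  exact hi (isInt_refine (lev_le_of_mem_box hO h) ⟨_, le_antisymm this.2 this.1⟩)

/-- Equal floors and ceilings give equal thick stars on that grid, so `lev y ≤ lev x`. They also put
`y` in the box of `cell x`, which gives the converse inequality. -/
theorem cell_eq_of_forall {x y : O}
    (hf : ∀ i, ⌊(2 : ℝ) ^ lev x * y.1 i⌋ = ⌊(2 : ℝ) ^ lev x * x.1 i⌋)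
    (hc : ∀ i, ⌈(2 : ℝ) ^ lev x * y.1 i⌉ = ⌈(2 : ℝ) ^ lev x * x.1 i⌉) (hO : IsOpen O) :
    cell y = cell x := by
  have h1 : lev y ≤ lev x := lev_le ((thickStar_subset (x := x.1) (y := y.1)
    (fun i => (hc i).ge) (fun i => (hf i).le)).trans (thickStar_lev_subset hO x))
  have h2 : lev x ≤ lev y := lev_le_of_mem_box hO (x := x) (y := y) fun i =>
    ⟨by simp only [cell]; rw [← hf i]; exact Int.floor_le _,
      by simp only [cell]; rw [← hc i]; exact Int.le_ceil _⟩
  have h3 : lev y = lev x := le_antisymm h1 h2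
  simp only [cell, h3]
  exact Prod.ext rfl (Prod.ext (funext hf) (funext hc))

/-- A point in the relative interior of a cell. -/
theorem cell_eq_of_mem_openBox (hO : IsOpen O) {j : Idx} (hj : j ∈ cells O) {x : O}
    (hx : x ∈ box O j)
    (h : ∀ i, i ∈ free j → (j.2.1 i : ℝ) < 2 ^ j.1 * x.1 i ∧ 2 ^ j.1 * x.1 i < j.2.2 i) :
    cell x = j := by
  obtain ⟨y, rfl⟩ := hj
  refine cell_eq_of_forall ?_ ?_ hO
  · intro i
    by_cases hi : i ∈ free (cell y)
    · rw [Int.floor_eq_iff]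
      have h1 := ceil_eq_floor_add_one_of_ne (mem_free.1 hi)
      have h2 : ((cell y).2.2 i : ℝ) = ⌊(2 : ℝ) ^ lev y * y.1 i⌋ + 1 := by
        rw [show (cell y).2.2 i = ⌊(2 : ℝ) ^ lev y * y.1 i⌋ + 1 from h1, Int.cast_add, Int.cast_one]
      exact ⟨(h i hi).1.le, by rw [← h2]; exact (h i hi).2⟩
    · have h1 : (cell y).2.1 i = (cell y).2.2 i := by
        by_contra hne; exact hi (mem_free.2 hne)
      have h2 := hx i
      rw [← h1] at h2
      have h3 : (2 : ℝ) ^ lev y * x.1 i = ⌊(2 : ℝ) ^ lev y * y.1 i⌋ := le_antisymm h2.2 h2.1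
      rw [h3, Int.floor_intCast]
  · intro i
    by_cases hi : i ∈ free (cell y)
    · rw [Int.ceil_eq_iff]
      have h1 := ceil_eq_floor_add_one_of_ne (mem_free.1 hi)
      have h2 : (⌈(2 : ℝ) ^ lev y * y.1 i⌉ : ℝ) = ⌊(2 : ℝ) ^ lev y * y.1 i⌋ + 1 := by
        rw [h1, Int.cast_add, Int.cast_one]
      exact ⟨by rw [h2, add_sub_cancel_right]; exact (h i hi).1, (h i hi).2.le⟩
    · have h1 : (cell y).2.1 i = (cell y).2.2 i := by
        by_contra hne; exact hi (mem_free.2 hne)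
      have h2 := hx i
      rw [h1] at h2
      have h3 : (2 : ℝ) ^ lev y * x.1 i = ⌈(2 : ℝ) ^ lev y * y.1 i⌉ := le_antisymm h2.2 h2.1
      rw [h3, Int.ceil_intCast]

/-- A coordinate off the fine grid of level `lev y` is off the coarser grid of level `lev x` as
well, so it cannot lie on a side of the larger box. -/
theorem lt_of_mem_free (hO : IsOpen O) {x y : O} (h : y ∈ box O (cell x)) {i : Fin 3}
    (hi : i ∈ free (cell y)) : ((cell x).2.1 i : ℝ) < 2 ^ lev x * y.1 i ∧
      2 ^ lev x * y.1 i < (cell x).2.2 i := by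
  rw [mem_free_cell] at hi
  have h1 : ∀ m : ℤ, (2 : ℝ) ^ lev x * y.1 i ≠ m := fun m hm =>
    hi (isInt_refine (lev_le_of_mem_box hO h) ⟨m, hm⟩)
  exact ⟨lt_of_le_of_ne (h i).1 (h1 _).symm, lt_of_le_of_ne (h i).2 (h1 _)⟩

theorem cell_eq_of_free_subset (hO : IsOpen O) {x y : O} (h : y ∈ box O (cell x))
    (hf : free (cell x) ⊆ free (cell y)) : cell y = cell x :=
  cell_eq_of_mem_openBox hO ⟨x, rfl⟩ h fun _ hi => lt_of_mem_free hO h (hf hi)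

theorem upper_eq_of_mem_free {j : Idx} (hj : j ∈ cells O) {i : Fin 3} (hi : i ∈ free j) :
    j.2.2 i = j.2.1 i + 1 := by
  obtain ⟨y, rfl⟩ := hj
  exact ceil_eq_floor_add_one_of_ne (mem_free.1 hi)

theorem upper_eq_of_notMem_free {j : Idx} {i : Fin 3} (hi : i ∉ free j) :
    j.2.2 i = j.2.1 i := by
  by_contra hne; exact hi (mem_free.2 fun h => hne h.symm)

theorem upper_le {j : Idx} (hj : j ∈ cells O) (i : Fin 3) : j.2.2 i ≤ j.2.1 i + 1 := by
  by_cases hi : i ∈ free j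
  · exact (upper_eq_of_mem_free hj hi).le
  · rw [upper_eq_of_notMem_free hi]; omega

theorem lower_le_upper {j : Idx} (hj : j ∈ cells O) (i : Fin 3) : j.2.1 i ≤ j.2.2 i := by
  by_cases hi : i ∈ free j
  · rw [upper_eq_of_mem_free hj hi]; omega
  · rw [upper_eq_of_notMem_free hi]

/-- All points of a box of the decomposition lie in `O`. -/
theorem mem_of_mem_box (hO : IsOpen O) {j : Idx} (hj : j ∈ cells O) {y : Fin 3 → ℝ}
    (h : ∀ i, (j.2.1 i : ℝ) ≤ 2 ^ j.1 * y i ∧ 2 ^ j.1 * y i ≤ j.2.2 i) : y ∈ O := by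
  obtain ⟨x, rfl⟩ := hj
  refine thickStar_lev_subset hO x fun i => ?_
  have h1 : (⌈(2 : ℝ) ^ lev x * x.1 i⌉ : ℝ) ≤ ⌊(2 : ℝ) ^ lev x * x.1 i⌋ + 1 := by
    exact_mod_cast Int.ceil_le_floor_add_one _
  obtain ⟨h2, h3⟩ := h i
  simp only [cell] at h2 h3
  constructor <;> linarith

/-- On the open star `U` of `y` at a level `n` admissible for `y`, all levels are at most `n`. A
cell meeting `U` then has level at most `n` and bounded integral corners, which leaves finitely many
possibilities. -/
theorem locallyFinite_box (hO : IsOpen O) :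
    LocallyFinite fun j : cells O => box O j.1 := by
  intro y
  obtain ⟨n, hn⟩ := exists_thickStar_subset hO y.2
  let U : Set O := {z | ∀ i, (⌈(2 : ℝ) ^ n * y.1 i⌉ : ℝ) - 1 < 2 ^ n * z.1 i ∧
    2 ^ n * z.1 i < ⌊(2 : ℝ) ^ n * y.1 i⌋ + 1}
  have hU : IsOpen U := by
    have : U = ⋂ i, {z : O | (⌈(2 : ℝ) ^ n * y.1 i⌉ : ℝ) - 1 < 2 ^ n * z.1 i} ∩
        {z | 2 ^ n * z.1 i < ⌊(2 : ℝ) ^ n * y.1 i⌋ + 1} := by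
      ext z; simp [U]
    rw [this]
    exact isOpen_iInter_of_finite fun i => (isOpen_lt continuous_const (continuous_scaled_coord _ i)).inter
      (isOpen_lt (continuous_scaled_coord _ i) continuous_const)
  have hyU : y ∈ U := fun i => by
    have h1 := Int.ceil_lt_add_one ((2 : ℝ) ^ n * y.1 i)
    have h2 := Int.lt_floor_add_one ((2 : ℝ) ^ n * y.1 i)
    exact ⟨by linarith, h2⟩
  have hlev : ∀ z ∈ U, lev z ≤ n := by
    intro z hz
    refine lev_le ((thickStar_subset (x := y.1) (y := z.1) ?_ ?_).trans hn)
    · intro i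
      have := (hz i).1
      rw [← Int.sub_one_lt_iff, Int.lt_ceil]
      push_cast; exact this
    · intro i
      have := (hz i).2
      rw [← Int.lt_add_one_iff, Int.floor_lt]
      push_cast; exact this
  -- A point of `U` has coordinates bounded by `‖y‖ + 2`. The extra `1` accounts for the width of a
  -- box in its own units.
  let N : ℤ := ⌈(2 : ℝ) ^ n * (‖y.1‖ + 2)⌉ + 1
  have hbound : ∀ z ∈ U, ∀ k ≤ n, ∀ i, |(2 : ℝ) ^ k * z.1 i| ≤ 2 ^ n * (‖y.1‖ + 2) := by
    intro z hz k hk i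
    have hp : (1 : ℝ) ≤ 2 ^ n := one_le_pow₀ one_le_two
    have hpk : (0 : ℝ) < 2 ^ k := by positivity
    have hkn : (2 : ℝ) ^ k ≤ 2 ^ n := pow_le_pow_right₀ one_le_two hk
    have hyi := norm_le_pi_norm y.1 i
    rw [Real.norm_eq_abs, abs_le] at hyi
    have h1 := (hz i).1; have h2 := (hz i).2
    have h3 := Int.le_ceil ((2 : ℝ) ^ n * y.1 i)
    have h4 := Int.floor_le ((2 : ℝ) ^ n * y.1 i)
    have h5 : |z.1 i| ≤ ‖y.1‖ + 2 := by
      rw [abs_le]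
      constructor
      · by_contra hcon; nlinarith [hyi.1]
      · by_contra hcon; nlinarith [hyi.2]
    rw [abs_mul, abs_of_pos hpk]
    exact mul_le_mul hkn h5 (abs_nonneg _) (by positivity)
  refine ⟨U, hU.mem_nhds hyU, ?_⟩
  have hfin : (((Finset.range (n + 1)) ×ˢ (Fintype.piFinset fun _ : Fin 3 => Finset.Icc (-N) N) ×ˢ
      (Fintype.piFinset fun _ : Fin 3 => Finset.Icc (-N) N) : Finset Idx) : Set Idx).Finite :=
    Finset.finite_toSet _
  refine (hfin.preimage (f := Subtype.val) Subtype.val_injective.injOn).subset ?_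
  rintro ⟨j, x, rfl⟩ ⟨z, hz, hzU⟩
  have hl : lev x ≤ n := (lev_le_of_mem_box hO hz).trans (hlev z hzU)
  have hA : ∀ i, -N ≤ (cell x).2.1 i ∧ (cell x).2.1 i ≤ N ∧ -N ≤ (cell x).2.2 i ∧
      (cell x).2.2 i ≤ N := by
    intro i
    have h1 := abs_le.1 (hbound z hzU (lev x) hl i)
    have h2 := hz i
    have h3 : ((cell x).2.2 i : ℝ) ≤ (cell x).2.1 i + 1 := by exact_mod_cast upper_le ⟨x, rfl⟩ i
    have h4 := Int.le_ceil ((2 : ℝ) ^ n * (‖y.1‖ + 2))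
    have h5 : (N : ℝ) = ⌈(2 : ℝ) ^ n * (‖y.1‖ + 2)⌉ + 1 := by simp [N]
    have h6 : (cell x).1 = lev x := rfl
    rw [h6] at h2
    refine ⟨?_, ?_, ?_, ?_⟩
    all_goals
      have : ((cell x).2.1 i : ℝ) ≤ N := by linarith [h1.2, h2.1]
      have h8 : (-N : ℝ) ≤ (cell x).2.1 i := by linarith [h1.1, h2.2]
      have h9 : ((cell x).2.2 i : ℝ) ≤ N := by linarith [h1.2, h2.1]
      have h10 : (-N : ℝ) ≤ (cell x).2.2 i := by linarith [h1.1, h2.2]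
    · exact_mod_cast h8
    · exact_mod_cast this
    · exact_mod_cast h10
    · exact_mod_cast h9
  simp only [Finset.coe_product, mem_preimage, mem_prod, Finset.mem_coe, Finset.mem_range,
    Fintype.mem_piFinset, Finset.mem_Icc]
  exact ⟨Nat.lt_succ_of_le hl, fun i => ⟨(hA i).1, (hA i).2.1⟩, fun i => ⟨(hA i).2.2.1, (hA i).2.2.2⟩⟩

end DyadicBox


/-! ### Adjacency of cubes and the matching of cubes with squares. -/

namespace DyadicBox

open Set Filter

variable {O : Set (Fin 3 → ℝ)}

/-- The top-dimensional cells. -/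
def cubes (O : Set (Fin 3 → ℝ)) : Set Idx := {j | j ∈ cells O ∧ free j = Finset.univ}

/-- The two-dimensional cells. -/
def squares (O : Set (Fin 3 → ℝ)) : Set Idx := {j | j ∈ cells O ∧ (free j).card = 2}

theorem exists_forall_mem_iff_ne (s : Finset (Fin 3)) (h : s.card = 2) : ∃ i, ∀ k, k ∈ s ↔ k ≠ i := by
  revert s; decide

theorem isCompact_box (hO : IsOpen O) {j : Idx} (hj : j ∈ cells O) : IsCompact (box O j) := by
  rw [Topology.IsEmbedding.subtypeVal.isCompact_iff]
  have hp : (0 : ℝ) < 2 ^ j.1 := by positivity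
  have : Subtype.val '' box O j =
      univ.pi fun i => Icc ((j.2.1 i : ℝ) / 2 ^ j.1) ((j.2.2 i : ℝ) / 2 ^ j.1) := by
    ext y
    simp only [Set.mem_pi, mem_univ, true_imp_iff, mem_Icc, div_le_iff₀ hp, le_div_iff₀ hp,
      mul_comm _ ((2 : ℝ) ^ j.1)]
    constructor
    · rintro ⟨z, hz, rfl⟩; exact hz
    · intro h; exact ⟨⟨y, mem_of_mem_box hO hj h⟩, h, rfl⟩
  rw [this]
  exact isCompact_univ_pi fun i => isCompact_Icc

/-- A dyadic number shifted by a dyadic multiple of `√2` lies on no dyadic grid. Such a coordinate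
is free whatever the level of the point turns out to be. -/
theorem irrational_zpow_mul_sqrt_add (a : ℤ) (m n k : ℕ) :
    ¬ ∃ l : ℤ, (2 : ℝ) ^ m * (a / 2 ^ n + √2 / 2 ^ k) = l := by
  rintro ⟨l, hl⟩
  refine irrational_sqrt_two ⟨(2 : ℚ) ^ k * (l / 2 ^ m - a / 2 ^ n), ?_⟩
  push_cast
  rw [← hl]
  field_simp
  ring

/-- The two free coordinates of `y` are strictly inside the cube. If the remaining one were too,
then `y` would be interior to the cube and all three directions would be free. -/
theorem mul_coord_eq_of_mem_box (hO : IsOpen O) {c : Idx} (hc : c ∈ cubes O) {y : O} (hy : y ∈ box O c)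
    {i : Fin 3} (hi : ∀ k, k ∈ free (cell y) ↔ k ≠ i) :
    (2 : ℝ) ^ c.1 * y.1 i = c.2.1 i ∨ (2 : ℝ) ^ c.1 * y.1 i = c.2.2 i := by
  by_contra hcon
  push Not at hcon
  obtain ⟨⟨x, rfl⟩, hfree⟩ := hc
  have : cell y = cell x := cell_eq_of_mem_openBox hO ⟨x, rfl⟩ hy fun k _ => by
    by_cases hk : k = i
    · subst hk
      exact ⟨lt_of_le_of_ne (hy k).1 (Ne.symm hcon.1), lt_of_le_of_ne (hy k).2 hcon.2⟩
    · exact lt_of_mem_free hO hy ((hi k).2 hk)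
  have h2 := (hi i).1 (by rw [this, hfree]; exact Finset.mem_univ i)
  exact h2 rfl

theorem cell_eq_of_add_single (hO : IsOpen O) {c : Idx} (hc : c ∈ cubes O) {y : O} (hy : y ∈ box O c)
    {i : Fin 3} (hi : ∀ k, k ∈ free (cell y) ↔ k ≠ i) {t : ℝ}
    (h : (c.2.1 i : ℝ) < 2 ^ c.1 * (y.1 i + t) ∧ 2 ^ c.1 * (y.1 i + t) < c.2.2 i) :
    ∃ hz : (fun k => if k = i then y.1 k + t else y.1 k) ∈ O, cell ⟨_, hz⟩ = c := by
  obtain ⟨⟨x, rfl⟩, hfree⟩ := hc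
  have hlt : ∀ k, ((cell x).2.1 k : ℝ) < 2 ^ (cell x).1 * (if k = i then y.1 k + t else y.1 k) ∧
      2 ^ (cell x).1 * (if k = i then y.1 k + t else y.1 k) < (cell x).2.2 k := by
    intro k
    by_cases hk : k = i
    · subst hk; simpa using h
    · rw [if_neg hk]; exact lt_of_mem_free hO hy ((hi k).2 hk)
  have hz := mem_of_mem_box hO ⟨x, rfl⟩ fun k => ⟨(hlt k).1.le, (hlt k).2.le⟩
  exact ⟨hz, cell_eq_of_mem_openBox hO ⟨x, rfl⟩ (fun k => ⟨(hlt k).1.le, (hlt k).2.le⟩)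
    fun k _ => hlt k⟩

/-- A point in the interior of a square is contained in at most two cubes. -/
theorem eq_of_mem_three_cubes (hO : IsOpen O) {y : O} (hy : (free (cell y)).card = 2) {c₁ c₂ c₃ : Idx}
    (h₁ : c₁ ∈ cubes O) (h₂ : c₂ ∈ cubes O) (h₃ : c₃ ∈ cubes O) (hy₁ : y ∈ box O c₁)
    (hy₂ : y ∈ box O c₂) (hy₃ : y ∈ box O c₃) (h12 : c₁ ≠ c₂) (h13 : c₁ ≠ c₃) : c₂ = c₃ := by
  obtain ⟨i, hi⟩ := exists_forall_mem_iff_ne _ hy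
  have hsame : ∀ c c', c ∈ cubes O → c' ∈ cubes O → y ∈ box O c → y ∈ box O c' →
      ((2 : ℝ) ^ c.1 * y.1 i = c.2.1 i ∧ (2 : ℝ) ^ c'.1 * y.1 i = c'.2.1 i ∨
        (2 : ℝ) ^ c.1 * y.1 i = c.2.2 i ∧ (2 : ℝ) ^ c'.1 * y.1 i = c'.2.2 i) → c = c' := by
    intro c c' hc hc' hyc hyc' h
    have hu := upper_eq_of_mem_free hc.1 (i := i) (by rw [hc.2]; exact Finset.mem_univ i)
    have hu' := upper_eq_of_mem_free hc'.1 (i := i) (by rw [hc'.2]; exact Finset.mem_univ i)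
    have hur : (c.2.2 i : ℝ) = c.2.1 i + 1 := by exact_mod_cast hu
    have hur' : (c'.2.2 i : ℝ) = c'.2.1 i + 1 := by exact_mod_cast hu'
    -- A displacement smaller than the sides of both cubes. If `y` lies on the same side of both,
    -- moving it inwards by `t` produces a point in the interior of both, so the cubes coincide.
    let t : ℝ := 1 / (2 * (2 ^ c.1 * 2 ^ c'.1))
    have hp : (1 : ℝ) ≤ 2 ^ c.1 := one_le_pow₀ one_le_two
    have hp' : (1 : ℝ) ≤ 2 ^ c'.1 := one_le_pow₀ one_le_two
    have ht : 0 < 2 ^ c.1 * t ∧ 2 ^ c.1 * t < 1 := by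
      have : 2 ^ c.1 * t = 1 / (2 * 2 ^ c'.1) := by simp only [t]; field_simp
      rw [this]
      exact ⟨by positivity, by rw [div_lt_one (by positivity)]; linarith⟩
    have ht' : 0 < 2 ^ c'.1 * t ∧ 2 ^ c'.1 * t < 1 := by
      have : 2 ^ c'.1 * t = 1 / (2 * 2 ^ c.1) := by simp only [t]; field_simp
      rw [this]
      exact ⟨by positivity, by rw [div_lt_one (by positivity)]; linarith⟩
    rcases h with ⟨h, h'⟩ | ⟨h, h'⟩
    · obtain ⟨hz, e1⟩ := cell_eq_of_add_single hO hc hyc hi (t := t)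
        (by rw [mul_add, h, hur]; constructor <;> linarith)
      obtain ⟨hz', e2⟩ := cell_eq_of_add_single hO hc' hyc' hi (t := t)
        (by rw [mul_add, h', hur']; constructor <;> linarith)
      rw [← e1, ← e2]
    · obtain ⟨hz, e1⟩ := cell_eq_of_add_single hO hc hyc hi (t := -t)
        (by rw [mul_add, h, hur, mul_neg]; constructor <;> linarith)
      obtain ⟨hz', e2⟩ := cell_eq_of_add_single hO hc' hyc' hi (t := -t)
        (by rw [mul_add, h', hur', mul_neg]; constructor <;> linarith)
      rw [← e1, ← e2]
  have a₁ := mul_coord_eq_of_mem_box hO h₁ hy₁ hi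
  have a₂ := mul_coord_eq_of_mem_box hO h₂ hy₂ hi
  have a₃ := mul_coord_eq_of_mem_box hO h₃ hy₃ hi
  have b12 := fun h => h12 (hsame _ _ h₁ h₂ hy₁ hy₂ h)
  have b13 := fun h => h13 (hsame _ _ h₁ h₃ hy₁ hy₃ h)
  -- Pigeonhole: each cube has `y` on its lower or on its upper side, and both `c₂` and `c₃` have it
  -- on the side opposite to that of `c₁`.
  refine hsame _ _ h₂ h₃ hy₂ hy₃ ?_
  tauto

/-- The height of the upper side of a cell. -/
noncomputable def top (j : Idx) : ℝ := j.2.2 2 / 2 ^ j.1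

/-- Each cube shares a square with a cube whose upper side is higher. -/
theorem exists_adjacent_cube (hO : IsOpen O) {c : Idx} (hc : c ∈ cubes O) :
    ∃ q ∈ squares O, ∃ c' ∈ cubes O, box O q ⊆ box O c ∧ box O q ⊆ box O c' ∧ top c < top c' := by
  obtain ⟨⟨x, rfl⟩, hfree⟩ := hc
  have hu : ∀ i, ((cell x).2.2 i : ℝ) = (cell x).2.1 i + 1 := fun i => by
    exact_mod_cast upper_eq_of_mem_free ⟨x, rfl⟩ (i := i) (by rw [hfree]; exact Finset.mem_univ i)
  set n := (cell x).1 with hn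
  have hp : (0 : ℝ) < 2 ^ n := by positivity
  have hs1 : (1 : ℝ) < √2 := by rw [Real.lt_sqrt] <;> norm_num
  have hs2 : √2 < 2 := by rw [Real.sqrt_lt'] <;> norm_num
  -- A generic point of the top face: the horizontal offsets `√2 / 2`, in units of the cube, are
  -- irrational and strictly between `0` and `1`. So `y'` is interior to a square at whatever level.
  let y' : Fin 3 → ℝ := fun i => if i = 2 then (cell x).2.2 i / 2 ^ n
    else (cell x).2.1 i / 2 ^ n + √2 / 2 ^ (n + 1)
  have hy' : ∀ i, ((cell x).2.1 i : ℝ) ≤ 2 ^ n * y' i ∧ 2 ^ n * y' i ≤ (cell x).2.2 i := by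
    intro i
    by_cases hi : i = 2
    · simp only [y', hi, if_true]
      rw [mul_div_cancel₀ _ hp.ne', hu]
      constructor <;> linarith
    · simp only [y', hi, if_false]
      have : (2 : ℝ) ^ n * ((cell x).2.1 i / 2 ^ n + √2 / 2 ^ (n + 1)) = (cell x).2.1 i + √2 / 2 := by
        rw [pow_succ]; field_simp
      rw [this, hu]
      constructor <;> linarith
  have hyO := mem_of_mem_box hO ⟨x, rfl⟩ hy'
  set y : O := ⟨y', hyO⟩
  have hyx : y ∈ box O (cell x) := hy'
  have hyfree : ∀ i, i ∈ free (cell y) ↔ i ≠ 2 := by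
    intro i
    rw [mem_free_cell]
    by_cases hi : i = 2
    · refine ⟨fun h => absurd (isInt_refine (lev_le_of_mem_box hO hyx) ⟨(cell x).2.2 i, ?_⟩) h,
        fun h => absurd hi h⟩
      simp only [y, y', hi, if_true]
      exact mul_div_cancel₀ _ hp.ne'
    · refine ⟨fun _ => hi, fun _ => ?_⟩
      simp only [y, y', hi, if_false]
      exact irrational_zpow_mul_sqrt_add _ _ _ _
  have hysq : cell y ∈ squares O := by
    refine ⟨⟨y, rfl⟩, ?_⟩
    have : free (cell y) = {0, 1} := by
      ext i; rw [hyfree]; fin_cases i <;> simp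
    rw [this]; rfl
  -- Near `y`, every box containing a point also contains `y`. Raising `y` by the irrational amount
  -- `√2 / 2 ^ k` therefore reaches the interior of a cube that has `y`, and hence the whole square
  -- of `y`, in its closure.
  have hev := (locallyFinite_box hO).eventually_subset (fun j => isClosed_box j.1) y
  rw [nhds_subtype_eq_comap] at hev
  obtain ⟨V, hV, hVy⟩ := mem_comap.1 hev
  let z : ℕ → Fin 3 → ℝ := fun k i => if i = 2 then y' i + √2 / 2 ^ k else y' i
  have hz : Tendsto z atTop (𝓝 y') := by
    rw [tendsto_pi_nhds]
    intro i
    by_cases hi : i = 2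
    · simp only [z, hi, if_true]
      have : Tendsto (fun k : ℕ => √2 / (2 : ℝ) ^ k) atTop (𝓝 0) :=
        Tendsto.div_atTop tendsto_const_nhds (tendsto_pow_atTop_atTop_of_one_lt one_lt_two)
      simpa using tendsto_const_nhds.add this
    · simp only [z, hi, if_false]; exact tendsto_const_nhds
  obtain ⟨k, hkV, hkO⟩ := ((hz.eventually hV).and (hz.eventually (hO.mem_nhds hyO))).exists
  have hkV' : z k ∈ V := hkV
  let w : O := ⟨z k, hkO⟩
  have hyw : y ∈ box O (cell w) := by
    have : {j : cells O | w ∈ box O j.1} ⊆ {j | y ∈ box O j.1} :=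
      hVy (show w ∈ Subtype.val ⁻¹' V from hkV')
    exact this (a := ⟨cell w, ⟨w, rfl⟩⟩) (mem_box_cell w)
  have hwfree : free (cell w) = Finset.univ := by
    ext i
    simp only [Finset.mem_univ, iff_true]
    rw [mem_free_cell]
    by_cases hi : i = 2
    · simp only [w, z, hi, if_true, y']
      exact irrational_zpow_mul_sqrt_add _ _ _ _
    · simp only [w, z, hi, if_false, y']
      exact irrational_zpow_mul_sqrt_add _ _ _ _
  refine ⟨cell y, hysq, cell w, ⟨⟨w, rfl⟩, hwfree⟩, box_subset_box hO hyx, box_subset_box hO hyw, ?_⟩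
  have h1 := (mem_box_cell w 2).2
  have h2 : top (cell x) = y' 2 := by simp [top, y', n]
  have h3 : w.1 2 = y' 2 + √2 / 2 ^ k := by simp [w, z]
  have h4 : (0 : ℝ) < √2 / 2 ^ k := by positivity
  rw [h2, top, lt_div_iff₀ (by positivity)]
  refine lt_of_lt_of_le ?_ h1
  rw [mul_comm, h3]
  exact mul_lt_mul_of_pos_left (by linarith) (by positivity)

/-- Each cube can be matched with one of its squares such that, with respect to a suitable rank,
each square belongs to the cube of smaller rank. -/
theorem exists_matching (hO : IsOpen O) : ∃ (fm : Idx → Idx) (rank : Idx → ℕ), ∀ c ∈ cubes O,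
    fm c ∈ squares O ∧ box O (fm c) ⊆ box O c ∧
      ∀ c' ∈ cubes O, box O (fm c) ⊆ box O c' → c' ≠ c → rank c < rank c' := by
  classical
  let G : SimpleGraph (cubes O) :=
    { Adj := fun c c' => c ≠ c' ∧ ∃ q ∈ squares O, box O q ⊆ box O c.1 ∧ box O q ⊆ box O c'.1
      symm := ⟨fun c c' ⟨h, q, hq, h1, h2⟩ => ⟨h.symm, q, hq, h2, h1⟩⟩
      loopless := ⟨fun c h => h.1 rfl⟩ }
  have hfin : ∀ c, (G.neighborSet c).Finite := by
    intro c
    have h1 := (locallyFinite_box hO).finite_nonempty_inter_compact (isCompact_box hO c.2.1)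
    refine Set.Finite.of_finite_image ((h1.image Subtype.val).subset ?_)
      (f := Subtype.val) Subtype.val_injective.injOn
    rintro _ ⟨c', ⟨-, q, ⟨⟨x, rfl⟩, -⟩, h3, h4⟩, rfl⟩
    exact ⟨⟨c'.1, c'.2.1⟩, ⟨x, h4 (mem_box_cell x), h3 (mem_box_cell x)⟩, rfl⟩
  have hadj : ∀ c, ∃ c', G.Adj c c' ∧ top c.1 < top c'.1 := by
    intro c
    obtain ⟨q, hq, c', hc', h1, h2, h3⟩ := exists_adjacent_cube hO c.2
    exact ⟨⟨c', hc'⟩, ⟨fun h => by rw [h] at h3; exact lt_irrefl _ h3, q, hq, h1, h2⟩, h3⟩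
  -- A finite component would contain a highest cube, but every cube has a higher neighbour.
  have hinf : ∀ c, {w | G.Reachable c w}.Infinite := by
    intro c hf
    obtain ⟨w, hw, hmax⟩ := Set.exists_max_image _ (fun w : cubes O => top w.1) hf
      ⟨c, SimpleGraph.Reachable.refl c⟩
    obtain ⟨w', ha, hlt⟩ := hadj w
    exact absurd (hmax w' (SimpleGraph.Reachable.trans hw ha.reachable)) (not_le.2 hlt)
  obtain ⟨r, hr⟩ := SimpleGraph.exists_rank_lt_of_infinite G hfin hinf
  choose w hw hrw using hr
  choose hne q hq hqc hqw using hw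
  refine ⟨fun c => if h : c ∈ cubes O then q ⟨c, h⟩ else c,
    fun c => if h : c ∈ cubes O then r ⟨c, h⟩ else 0, fun c hc => ?_⟩
  beta_reduce
  rw [dif_pos hc, dif_pos hc]
  refine ⟨hq _, hqc _, fun c' hc' hsub hcc' => ?_⟩
  rw [dif_pos hc']
  -- The matched square lies in `c` and in its higher-ranked neighbour. A point interior to a square
  -- lies in at most two cubes, so there is no further competitor.
  obtain ⟨⟨x, hx⟩, hcard⟩ := hq ⟨c, hc⟩
  have hxq : x ∈ box O (q ⟨c, hc⟩) := by rw [← hx]; exact mem_box_cell x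
  have := eq_of_mem_three_cubes hO (y := x) (by rw [hx]; exact hcard) hc (w ⟨c, hc⟩).2 hc'
    (hqc _ hxq) (hqw _ hxq) (hsub hxq) (fun h => hne ⟨c, hc⟩ (Subtype.ext h)) hcc'.symm
  have h2 := hrw ⟨c, hc⟩
  rwa [show w ⟨c, hc⟩ = ⟨c', hc'⟩ from Subtype.ext this] at h2

end DyadicBox


/-! ### Coordinates in a box, and extension of maps over prisms. -/

namespace DyadicBox

open Set Filter

variable {O : Set (Fin 3 → ℝ)}

local notation "I" => unitInterval

/-- The point of a box with given coordinates relative to the box. -/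
noncomputable def point (hO : IsOpen O) {j : Idx} (hj : j ∈ cells O) (s : Fin 3 → I) : O :=
  ⟨fun k => (j.2.1 k + ((j.2.2 k : ℝ) - j.2.1 k) * s k) / 2 ^ j.1, mem_of_mem_box hO hj fun k => by
    have h1 : (j.2.1 k : ℝ) ≤ j.2.2 k := by exact_mod_cast lower_le_upper hj k
    rw [mul_div_cancel₀ _ (by positivity)]
    constructor <;> nlinarith [(s k).2.1, (s k).2.2]⟩

theorem mul_point_apply (hO : IsOpen O) {j : Idx} (hj : j ∈ cells O) (s : Fin 3 → I) (k : Fin 3) :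
    2 ^ j.1 * (point hO hj s).1 k = j.2.1 k + ((j.2.2 k : ℝ) - j.2.1 k) * s k :=
  mul_div_cancel₀ _ (by positivity)

theorem point_mem_box (hO : IsOpen O) {j : Idx} (hj : j ∈ cells O) (s : Fin 3 → I) :
    point hO hj s ∈ box O j := fun k => by
  have h1 : (j.2.1 k : ℝ) ≤ j.2.2 k := by exact_mod_cast lower_le_upper hj k
  rw [mul_point_apply]
  constructor <;> nlinarith [(s k).2.1, (s k).2.2]

theorem continuous_point (hO : IsOpen O) {j : Idx} (hj : j ∈ cells O) : Continuous (point hO hj) := by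
  refine Continuous.subtype_mk (continuous_pi fun k => ?_) _
  exact (continuous_const.add (continuous_const.mul
    (continuous_subtype_val.comp (continuous_apply k)))).div_const _

/-- The coordinates relative to a box. -/
noncomputable def coord (j : Idx) (k : Fin 3) (y : O) : I :=
  projIcc 0 1 zero_le_one (2 ^ j.1 * y.1 k - j.2.1 k)

theorem continuous_coord (j : Idx) (k : Fin 3) : Continuous (coord (O := O) j k) :=
  continuous_projIcc.comp ((continuous_scaled_coord _ k).sub continuous_const)

theorem coe_coord {j : Idx} (hj : j ∈ cells O) {y : O} (hy : y ∈ box O j) (k : Fin 3) :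
    (coord j k y : ℝ) = 2 ^ j.1 * y.1 k - j.2.1 k := by
  have h1 : (j.2.2 k : ℝ) ≤ j.2.1 k + 1 := by exact_mod_cast upper_le hj k
  rw [coord, projIcc_of_mem _ (⟨by linarith [(hy k).1], by linarith [(hy k).2]⟩ : _ ∈ Icc (0 : ℝ) 1)]

theorem point_coord (hO : IsOpen O) {j : Idx} (hj : j ∈ cells O) {y : O} (hy : y ∈ box O j)
    {s : Fin 3 → I} (hs : ∀ k ∈ free j, s k = coord j k y) : point hO hj s = y := by
  refine Subtype.ext (funext fun k => ?_)
  have hp : (0 : ℝ) < 2 ^ j.1 := by positivity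
  refine mul_left_cancel₀ hp.ne' ?_
  rw [mul_point_apply]
  by_cases hk : k ∈ free j
  · have h1 : (j.2.2 k : ℝ) = j.2.1 k + 1 := by exact_mod_cast upper_eq_of_mem_free hj hk
    rw [hs k hk, coe_coord hj hy, h1]; ring
  · have h1 := upper_eq_of_notMem_free hk
    have := hy k
    rw [h1] at this ⊢
    rw [sub_self, zero_mul, add_zero]
    exact le_antisymm this.1 this.2

theorem cell_eq_of_coord (hO : IsOpen O) {j : Idx} (hj : j ∈ cells O) {y : O} (hy : y ∈ box O j)
    (h : ∀ k ∈ free j, coord j k y ≠ 0 ∧ coord j k y ≠ 1) : cell y = j := by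
  refine cell_eq_of_mem_openBox hO hj hy fun k hk => ?_
  obtain ⟨h0, h1⟩ := h k hk
  have hu : (j.2.2 k : ℝ) = j.2.1 k + 1 := by exact_mod_cast upper_eq_of_mem_free hj hk
  have e := coe_coord hj hy k
  have h0' := unitInterval.pos_iff_ne_zero.2 h0
  have h1' := unitInterval.lt_one_iff_ne_one.2 h1
  rw [← Subtype.coe_lt_coe, e] at h0' h1'
  rw [hu]
  constructor
  · simpa using h0'
  · have : 2 ^ j.1 * y.1 k - (j.2.1 k : ℝ) < 1 := by simpa using h1'
    linarith

theorem card_free_lt (hO : IsOpen O) {j : Idx} (hj : j ∈ cells O) {y : O} (hy : y ∈ box O j)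
    (h : cell y ≠ j) : (free (cell y)).card < (free j).card := by
  obtain ⟨x, rfl⟩ := hj
  refine Finset.card_lt_card ((free_subset_of_mem_box hO hy).ssubset_of_not_subset fun hcon => ?_)
  exact h (cell_eq_of_free_subset hO hy hcon)

theorem cell_point_ne (hO : IsOpen O) {j : Idx} (hj : j ∈ cells O) {s : Fin 3 → I} {k : Fin 3}
    (hk : k ∈ free j) (h : s k = 0 ∨ s k = 1) : cell (point hO hj s) ≠ j := by
  intro heq
  have h1 := upper_eq_of_mem_free hj hk
  have hmem := point_mem_box hO hj s
  have h2 := mul_point_apply hO hj s k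
  have hur : (j.2.2 k : ℝ) = j.2.1 k + 1 := by exact_mod_cast h1
  have h3 : k ∈ free (cell (point hO hj s)) := by rw [heq]; exact hk
  obtain ⟨x, rfl⟩ := hj
  obtain ⟨h4, h5⟩ := lt_of_mem_free hO hmem h3
  simp only [show lev x = (cell x).1 from rfl] at h4 h5
  rw [h2] at h4 h5
  rcases h with h | h <;> rw [h] at h4 h5 <;> simp at h4 h5

theorem locallyFinite_box_of_subset (hO : IsOpen O) {Q : Set Idx} (hQ : Q ⊆ cells O) :
    LocallyFinite fun j : Q => box O j.1 :=
  (locallyFinite_box hO).comp_injective (g := inclusion hQ) (inclusion_injective hQ)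

theorem locallyFinite_preimage_box (hO : IsOpen O) {Q : Set Idx} (hQ : Q ⊆ cells O) :
    LocallyFinite fun j : Q => (Prod.fst ⁻¹' box O j.1 : Set (O × I)) :=
  (locallyFinite_box_of_subset hO hQ).preimage_continuous continuous_fst

/-- The part of `O × I` consisting of the two ends and of the prisms over the cells in `Q`. -/
def prism (O : Set (Fin 3 → ℝ)) (Q : Set Idx) : Set (O × I) :=
  {p | (p.2 = 0 ∨ p.2 = 1) ∨ cell p.1 ∈ Q}

theorem isClosed_prism (hO : IsOpen O) {Q : Set Idx} (hQc : Q ⊆ cells O)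
    (hQ : ∀ j ∈ Q, ∀ y ∈ box O j, cell y ∈ Q) : IsClosed (prism O Q) := by
  have h1 : prism O Q = ({p | p.2 = 0} ∪ {p | p.2 = 1}) ∪
      Prod.fst ⁻¹' (⋃ j : Q, box O j.1) := by
    ext p
    simp only [prism, mem_union, mem_preimage, mem_iUnion, Subtype.exists, exists_prop]
    refine or_congr Iff.rfl ⟨fun h => ⟨_, h, mem_box_cell _⟩, fun ⟨j, hj, hy⟩ => hQ j hj _ hy⟩
  rw [h1]
  refine ((isClosed_eq continuous_snd continuous_const).union
    (isClosed_eq continuous_snd continuous_const)).union (IsClosed.preimage continuous_fst ?_)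
  refine LocallyFinite.isClosed_iUnion ?_ fun j => isClosed_box _
  exact locallyFinite_box_of_subset hO hQc

/-- The prisms over `J` form a locally finite family of closed sets which meet one another only over
`Q`. Extensions over the single prisms which agree with `F` on the old part therefore glue, with no
compatibility to be checked among them. -/
theorem exists_extension_prism (hO : IsOpen O) {X : Type*} [TopologicalSpace X] {Q Q' J : Set Idx}
    (hJ : J ⊆ cells O) (hQc : Q ⊆ cells O) (hQ : ∀ j ∈ Q, ∀ y ∈ box O j, cell y ∈ Q)
    (hint : ∀ j ∈ J, ∀ j' ∈ J, j ≠ j' → ∀ y, y ∈ box O j → y ∈ box O j' → cell y ∈ Q)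
    (hcov : ∀ y : O, cell y ∈ Q' → cell y ∈ Q ∨ ∃ j ∈ J, y ∈ box O j) {F : O × I → X}
    (hF : ContinuousOn F (prism O Q))
    (hg : ∀ j ∈ J, ∃ g : O × I → X, ContinuousOn g (Prod.fst ⁻¹' box O j) ∧
      ∀ p, p.1 ∈ box O j → p ∈ prism O Q → g p = F p) :
    ∃ F' : O × I → X, ContinuousOn F' (prism O Q') ∧ EqOn F' F (prism O Q) := by
  obtain ⟨F', hF', hF'e⟩ := exists_continuousOn_extension_of_locallyFinite (ι := J)
    (e := fun j => Prod.fst ⁻¹' box O j.1) (isClosed_prism hO hQc hQ)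
    (fun j => (isClosed_box _).preimage continuous_fst)
    (locallyFinite_preimage_box hO hJ)
    (fun j j' hjj p hp => Or.inr (hint j j.2 j' j'.2 (fun h => hjj (Subtype.ext h)) p.1 hp.1 hp.2))
    hF (fun j => by
      obtain ⟨g, hg1, hg2⟩ := hg j j.2
      exact ⟨g, hg1, fun p hp => hg2 p hp.1 hp.2⟩)
  refine ⟨F', hF'.mono ?_, hF'e⟩
  rintro p (hp | hp)
  · exact Or.inl (Or.inl hp)
  · rcases hcov p.1 hp with h | ⟨j, hj, hy⟩
    · exact Or.inl (Or.inr h)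
    · exact Or.inr (mem_iUnion.2 ⟨⟨j, hj⟩, hy⟩)

/-- The cells of dimension at most `d`. -/
def skel (O : Set (Fin 3 → ℝ)) (d : ℕ) : Set Idx := {j | j ∈ cells O ∧ (free j).card ≤ d}

theorem skel_closed (hO : IsOpen O) (d : ℕ) : ∀ j ∈ skel O d, ∀ y ∈ box O j, cell y ∈ skel O d := by
  rintro j ⟨⟨x, rfl⟩, hj⟩ y hy
  exact ⟨⟨y, rfl⟩, (Finset.card_le_card (free_subset_of_mem_box hO hy)).trans hj⟩

/-- Two different cells of the same dimension meet in lower-dimensional cells. -/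
theorem card_free_lt_of_mem_of_mem (hO : IsOpen O) {j j' : Idx} (hj : j ∈ cells O) (hj' : j' ∈ cells O)
    (hd : (free j).card = (free j').card) (hne : j ≠ j') {y : O} (hy : y ∈ box O j)
    (hy' : y ∈ box O j') : (free (cell y)).card < (free j).card := by
  by_cases h : cell y = j
  · have h2 : cell y ≠ j' := fun h' => hne (h.symm.trans h')
    have := card_free_lt hO hj' hy' h2
    omega
  · exact card_free_lt hO hj hy h

/-- The extension step over the cells of dimension `d + 1` contained in a set `J`. -/
theorem exists_extension_prism_skel (hO : IsOpen O) {X : Type*} [TopologicalSpace X] {d : ℕ} {J : Set Idx}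
    (hJ : ∀ j ∈ J, j ∈ cells O ∧ (free j).card = d + 1) {F : O × I → X}
    (hF : ContinuousOn F (prism O (skel O d)))
    (hg : ∀ j ∈ J, ∃ g : O × I → X, Continuous g ∧ ∀ p, p.1 ∈ box O j → cell p.1 ≠ j ∨
      (p.2 = 0 ∨ p.2 = 1) → g p = F p) :
    ∃ F' : O × I → X, ContinuousOn F' (prism O (skel O d ∪ J)) ∧ EqOn F' F (prism O (skel O d)) := by
  refine exists_extension_prism hO (J := J) (fun j hj => (hJ j hj).1) (fun j hj => hj.1)
    (skel_closed hO d) ?_ ?_ hF ?_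
  · intro j hj j' hj' hne y hy hy'
    have := card_free_lt_of_mem_of_mem hO (hJ j hj).1 (hJ j' hj').1
      ((hJ j hj).2.trans (hJ j' hj').2.symm) hne hy hy'
    exact ⟨⟨y, rfl⟩, by have := (hJ j hj).2; omega⟩
  · rintro y (h | h)
    · exact Or.inl h
    · exact Or.inr ⟨_, h, mem_box_cell y⟩
  · intro j hj
    obtain ⟨g, hg1, hg2⟩ := hg j hj
    refine ⟨g, hg1.continuousOn, fun p hp hpQ => hg2 p hp ?_⟩
    rcases hpQ with h | h
    · exact Or.inr h
    · left
      intro heq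
      have := h.2
      rw [heq, (hJ j hj).2] at this
      omega

end DyadicBox


/-! ### Homotopies over vertices, edges and squares. -/

/-- The square of paths relating two maps along a path and its translates. -/
theorem homotopic_trans_of_conj {Y X : Type*} [TopologicalSpace Y] [TopologicalSpace X] {p v w : Y}
    (f g : C(Y, X)) (δ : Path (f p) (g p))
    (hδ : ∀ ω : Path p p, ((ω.map f.continuous).trans δ).Homotopic (δ.trans (ω.map g.continuous)))
    (a : Path p v) (b : Path p w) (s : Path v w) :
    ((s.map f.continuous).trans (((b.map f.continuous).symm.trans δ).trans (b.map g.continuous))).Homotopic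
      ((((a.map f.continuous).symm.trans δ).trans (a.map g.continuous)).trans (s.map g.continuous)) := by
  have h := Path.Homotopic.Quotient.eq.2 (hδ ((a.trans s).trans b.symm))
  refine Path.Homotopic.Quotient.exact ?_
  simp only [Path.map_trans, ← Path.map_symm, Path.Homotopic.Quotient.mk_trans,
    Path.Homotopic.Quotient.mk_symm] at h ⊢
  generalize Path.Homotopic.Quotient.mk (a.map f.continuous) = fa at *
  generalize Path.Homotopic.Quotient.mk (a.map g.continuous) = ga at *
  generalize Path.Homotopic.Quotient.mk (b.map f.continuous) = fb at *
  generalize Path.Homotopic.Quotient.mk (b.map g.continuous) = gb at *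
  generalize Path.Homotopic.Quotient.mk (s.map f.continuous) = fs at *
  generalize Path.Homotopic.Quotient.mk (s.map g.continuous) = gs at *
  generalize Path.Homotopic.Quotient.mk δ = d at *
  have h2 := congrArg (fun q => (fa.symm.trans q).trans gb) h
  simp only [Path.Homotopic.Quotient.trans_assoc] at h2 ⊢
  rw [← Path.Homotopic.Quotient.trans_assoc fa.symm fa, Path.Homotopic.Quotient.symm_trans,
    Path.Homotopic.Quotient.refl_trans, Path.Homotopic.Quotient.symm_trans,
    Path.Homotopic.Quotient.trans_refl] at h2
  exact h2

/-- This allows the transported path at the base point to be replaced by `δ` itself, whichever loop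
was used for the transport. -/
theorem Path.Homotopic.trans_trans_of_comm {X : Type*} [TopologicalSpace X] {p q : X} {l : Path p p} {δ : Path p q}
    {r : Path q q} (h : (l.trans δ).Homotopic (δ.trans r)) : δ.Homotopic ((l.symm.trans δ).trans r) := by
  have h := Path.Homotopic.Quotient.eq.2 h
  refine Path.Homotopic.Quotient.exact ?_
  simp only [Path.Homotopic.Quotient.mk_trans, Path.Homotopic.Quotient.mk_symm] at h ⊢
  rw [Path.Homotopic.Quotient.trans_assoc, ← h, ← Path.Homotopic.Quotient.trans_assoc,
    Path.Homotopic.Quotient.symm_trans, Path.Homotopic.Quotient.refl_trans]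

namespace DyadicBox

open Set Filter

variable {O : Set (Fin 3 → ℝ)}

local notation "I" => unitInterval

variable {X : Type*} [TopologicalSpace X]

theorem mem_prism_zero (Q : Set Idx) (y : O) : ((y, 0) : O × I) ∈ prism O Q := Or.inl (Or.inl rfl)

theorem mem_prism_one (Q : Set Idx) (y : O) : ((y, 1) : O × I) ∈ prism O Q := Or.inl (Or.inr rfl)

theorem mem_prism_of_cell {Q : Set Idx} {y : O} (h : cell y ∈ Q) (t : I) :
    ((y, t) : O × I) ∈ prism O Q := Or.inr h

/-- A homotopy on the vertices. -/
theorem exists_homotopy_vertices (hO : IsOpen O) {f g : C(O, X)} (η : ∀ v, Path (f v) (g v)) :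
    ∃ F : O × I → X, ContinuousOn F (prism O (skel O 0)) ∧ (∀ y, F (y, 0) = f y) ∧
      (∀ y, F (y, 1) = g y) ∧ ∀ y t, cell y ∈ skel O 0 → F (y, t) = η y t := by
  classical
  let F : O × I → X := fun p => if cell p.1 ∈ skel O 0 then η p.1 p.2 else
    if p.2 = 0 then f p.1 else g p.1
  have hF0 : ∀ y, F (y, 0) = f y := fun y => by by_cases h : cell y ∈ skel O 0 <;> simp [F, h]
  have hF1 : ∀ y, F (y, 1) = g y := fun y => by by_cases h : cell y ∈ skel O 0 <;> simp [F, h]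
  have hFη : ∀ y t, cell y ∈ skel O 0 → F (y, t) = η y t := fun y t h => by simp [F, h]
  refine ⟨F, ?_, hF0, hF1, hFη⟩
  have h1 : prism O (skel O 0) = ({p | p.2 = 0} ∪ {p | p.2 = 1}) ∪
      ⋃ j : skel O 0, Prod.fst ⁻¹' box O j.1 := by
    ext p
    simp only [prism, mem_union, mem_preimage, mem_iUnion, Subtype.exists, exists_prop]
    exact or_congr Iff.rfl ⟨fun h => ⟨_, h, mem_box_cell _⟩, fun ⟨j, hj, hy⟩ =>
      skel_closed hO 0 j hj _ hy⟩
  have hlf : LocallyFinite fun j : skel O 0 => (Prod.fst ⁻¹' box O j.1 : Set (O × I)) :=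
    locallyFinite_preimage_box hO fun j hj => hj.1
  have hcl : ∀ j : skel O 0, IsClosed (Prod.fst ⁻¹' box O j.1 : Set (O × I)) := fun j =>
    (isClosed_box _).preimage continuous_fst
  have hc0 : IsClosed {p : O × I | p.2 = 0} := isClosed_eq continuous_snd continuous_const
  have hc1 : IsClosed {p : O × I | p.2 = 1} := isClosed_eq continuous_snd continuous_const
  rw [h1]
  refine ContinuousOn.union_of_isClosed (ContinuousOn.union_of_isClosed ?_ ?_ hc0 hc1)
    (hlf.continuousOn_iUnion hcl ?_) (hc0.union hc1) (hlf.isClosed_iUnion hcl)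
  · refine (f.continuous.comp continuous_fst).continuousOn.congr ?_
    rintro ⟨y, t⟩ (rfl : t = 0)
    exact hF0 y
  · refine (g.continuous.comp continuous_fst).continuousOn.congr ?_
    rintro ⟨y, t⟩ (rfl : t = 1)
    exact hF1 y
  · rintro ⟨j, ⟨x, rfl⟩, hj⟩
    refine ((η x).continuous.comp continuous_snd).continuousOn.congr ?_
    rintro ⟨y, t⟩ (hy : y ∈ box O (cell x))
    have h0 : free (cell x) = ∅ := Finset.card_eq_zero.1 (Nat.le_zero.1 hj)
    have hyx : y = x := by
      rw [← point_coord hO ⟨x, rfl⟩ hy (s := fun _ => 0) (by simp [h0])]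
      exact point_coord hO ⟨x, rfl⟩ (mem_box_cell x) (by simp [h0])
    subst hyx
    exact hFη y t ⟨⟨y, rfl⟩, hj⟩

/-- The straight path along a box in a given direction. -/
noncomputable def edgePath (hO : IsOpen O) {j : Idx} (hj : j ∈ cells O) :
    Path (point hO hj fun _ => 0) (point hO hj fun _ => 1) where
  toFun s := point hO hj fun _ => s
  continuous_toFun := (continuous_point hO hj).comp (continuous_pi fun _ => continuous_id)
  source' := rfl
  target' := rfl

/-- The prism over an edge is a square. Its boundary is given by `f`, `g` and the two vertex tracks,
and naturality `hη` along the edge is exactly the condition for filling it. -/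
theorem exists_homotopy_edge (hO : IsOpen O) {f g : C(O, X)} (η : ∀ v, Path (f v) (g v))
    (hη : ∀ v w (s : Path v w), ((s.map f.continuous).trans (η w)).Homotopic
      ((η v).trans (s.map g.continuous))) {F₀ : O × I → X} (h0 : ∀ y, F₀ (y, 0) = f y)
    (h1 : ∀ y, F₀ (y, 1) = g y) (h2 : ∀ y t, cell y ∈ skel O 0 → F₀ (y, t) = η y t) {j : Idx}
    (hj : j ∈ cells O) (hcard : (free j).card = 1) :
    ∃ G : O × I → X, Continuous G ∧ ∀ p, p.1 ∈ box O j → cell p.1 ≠ j ∨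
      (p.2 = 0 ∨ p.2 = 1) → G p = F₀ p := by
  obtain ⟨i, hi⟩ := Finset.card_eq_one.1 hcard
  obtain ⟨K, hK0, hK1, hKl, hKr⟩ := exists_square_of_homotopic
    ((edgePath hO hj).map f.continuous) ((edgePath hO hj).map g.continuous)
    (η (point hO hj fun _ => 0)) (η (point hO hj fun _ => 1)) (hη _ _ (edgePath hO hj))
  refine ⟨fun p => K (coord j i p.1, p.2), K.continuous.comp
    (((continuous_coord j i).comp continuous_fst).prodMk continuous_snd), ?_⟩
  rintro ⟨y, t⟩ (hy : y ∈ box O j) (hp : cell y ≠ j ∨ (t = 0 ∨ t = 1))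
  change K (coord j i y, t) = F₀ (y, t)
  have hpt : ∀ s, coord j i y = s → point hO hj (fun _ => s) = y := fun s hs =>
    point_coord hO hj hy (by simp [hi, hs])
  by_cases ht : t = 0 ∨ t = 1
  · rcases ht with rfl | rfl
    · rw [hK0, h0]
      exact congrArg f (hpt (coord j i y) rfl)
    · rw [hK1, h1]
      exact congrArg g (hpt (coord j i y) rfl)
  · have hc : cell y ≠ j := hp.resolve_right ht
    have hsk : cell y ∈ skel O 0 := ⟨⟨y, rfl⟩, by have := card_free_lt hO hj hy hc; omega⟩
    have h3 : coord j i y = 0 ∨ coord j i y = 1 := by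
      by_contra hcon
      push Not at hcon
      exact hc (cell_eq_of_coord hO hj hy (by simpa [hi] using hcon))
    rw [h2 y t hsk]
    rcases h3 with h3 | h3
    · have := hpt _ h3
      rw [h3, hKl, this]
    · have := hpt _ h3
      rw [h3, hKr, this]

/-- A homotopy on the edges. -/
theorem exists_homotopy_edges (hO : IsOpen O) {f g : C(O, X)} (η : ∀ v, Path (f v) (g v))
    (hη : ∀ v w (s : Path v w), ((s.map f.continuous).trans (η w)).Homotopic
      ((η v).trans (s.map g.continuous))) :
    ∃ F : O × I → X, ContinuousOn F (prism O (skel O 1)) ∧ (∀ y, F (y, 0) = f y) ∧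
      (∀ y, F (y, 1) = g y) ∧ ∀ y t, cell y ∈ skel O 0 → F (y, t) = η y t := by
  obtain ⟨F₀, hF₀, h0, h1, h2⟩ := exists_homotopy_vertices hO η
  obtain ⟨F, hF, hFe⟩ := exists_extension_prism_skel hO (d := 0)
    (J := {j | j ∈ cells O ∧ (free j).card = 1}) (fun j hj => hj) hF₀ (by
      exact fun j hj => exists_homotopy_edge hO η hη h0 h1 h2 hj.1 hj.2)
  refine ⟨F, hF.mono ?_, fun y => (hFe (mem_prism_zero _ y)).trans (h0 y),
    fun y => (hFe (mem_prism_one _ y)).trans (h1 y),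
    fun y t hy => (hFe (mem_prism_of_cell hy t)).trans (h2 y t hy)⟩
  rintro p (hp | hp)
  · exact Or.inl hp
  · refine Or.inr ?_
    rcases Nat.le_one_iff_eq_zero_or_eq_one.1 hp.2 with h | h
    · exact Or.inl ⟨hp.1, h.le⟩
    · exact Or.inr ⟨hp.1, h⟩

/-- Extension of a homotopy over squares. -/
theorem exists_homotopy_squares (hO : IsOpen O) {x₀ : X} (hpi : Subsingleton (π_ 2 X x₀))
    {F : O × I → X} (hF : ContinuousOn F (prism O (skel O 1)))
    (hjoin : ∀ p ∈ prism O (skel O 1), Joined (F p) x₀) {J : Set Idx} (hJ : J ⊆ squares O) :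
    ∃ F' : O × I → X, ContinuousOn F' (prism O (skel O 1 ∪ J)) ∧
      EqOn F' F (prism O (skel O 1)) := by
  refine exists_extension_prism_skel hO (d := 1) hJ hF fun j hjJ => ?_
  obtain ⟨hj, hcard⟩ := hJ hjJ
  obtain ⟨i₁, i₂, hne, hi⟩ := Finset.card_eq_two.1 hcard
  -- The prism over a square is a 3-cube whose boundary consists of the two ends and the prisms over
  -- edges and vertices, where `F` is already defined.
  let ch : I × I × I → O × I := fun q => (point hO hj fun k => if k = i₁ then q.1 else q.2.1, q.2.2)
  have hch : Continuous ch := by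
    refine ((continuous_point hO hj).comp (continuous_pi fun k => ?_)).prodMk
      (continuous_snd.comp continuous_snd)
    by_cases hk : k = i₁
    · simp only [hk, if_true]; exact continuous_fst
    · simp only [hk, if_false]; exact continuous_fst.comp continuous_snd
  have hmaps : MapsTo ch tripleBoundary (prism O (skel O 1)) := by
    rintro q (hq | hq | hq)
    · have h1 := cell_point_ne hO hj (s := fun k => if k = i₁ then q.1 else q.2.1) (k := i₁)
        (by simp [hi]) (by simpa using hq)
      exact Or.inr ⟨⟨_, rfl⟩, by
        have := card_free_lt hO hj (point_mem_box hO hj _) h1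
        simp only [ch]; omega⟩
    · have h1 := cell_point_ne hO hj (s := fun k => if k = i₁ then q.1 else q.2.1) (k := i₂)
        (by simp [hi]) (by simpa [hne.symm] using hq)
      exact Or.inr ⟨⟨_, rfl⟩, by
        have := card_free_lt hO hj (point_mem_box hO hj _) h1
        simp only [ch]; omega⟩
    · exact Or.inl hq
  obtain ⟨U, hU⟩ := exists_extension_of_subsingleton_pi_two hpi
    (hF.comp hch.continuousOn hmaps) fun q hq => hjoin _ (hmaps hq)
  refine ⟨fun p => U (coord j i₁ p.1, coord j i₂ p.1, p.2), U.continuous.comp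
    (((continuous_coord j i₁).comp continuous_fst).prodMk
      (((continuous_coord j i₂).comp continuous_fst).prodMk continuous_snd)), ?_⟩
  rintro ⟨y, t⟩ (hy : y ∈ box O j) (hp : cell y ≠ j ∨ (t = 0 ∨ t = 1))
  have hpt : ch (coord j i₁ y, coord j i₂ y, t) = (y, t) :=
    Prod.ext (point_coord hO hj hy (by simp [hi, hne.symm])) rfl
  have hmem : (coord j i₁ y, coord j i₂ y, t) ∈ tripleBoundary := by
    rcases hp with hc | ht
    · by_contra hcon
      simp only [tripleBoundary, Set.mem_ofPred_eq, not_or] at hcon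
      exact hc (cell_eq_of_coord hO hj hy (by simpa [hi] using ⟨hcon.1, hcon.2.1⟩))
    · exact Or.inr (Or.inr ht)
  exact (hU hmem).trans (congrArg F hpt)

end DyadicBox


/-! ### The filtration by rank, and the retraction of the prism over a cube. -/

namespace DyadicBox

open Set Filter

variable {O : Set (Fin 3 → ℝ)}

local notation "I" => unitInterval

variable {X : Type*} [TopologicalSpace X]

/-- `fm` assigns to each cube one of its squares, in such a way that any other cube containing this
square has bigger rank. -/
def IsMatching (O : Set (Fin 3 → ℝ)) (fm : Idx → Idx) (rank : Idx → ℕ) : Prop :=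
  ∀ c ∈ cubes O, fm c ∈ squares O ∧ box O (fm c) ⊆ box O c ∧
      ∀ c' ∈ cubes O, box O (fm c) ⊆ box O c' → c' ≠ c → rank c < rank c'

/-- The cells of dimension at most one, the squares which are not matched with a cube of rank at
least `r`, and the cubes of rank less than `r`. -/
def stage (O : Set (Fin 3 → ℝ)) (fm : Idx → Idx) (rank : Idx → ℕ) (r : ℕ) : Set Idx :=
  {j | j ∈ cells O ∧ ((free j).card ≤ 1 ∨
    ((free j).card = 2 ∧ ∀ c ∈ cubes O, fm c = j → rank c < r) ∨ (j ∈ cubes O ∧ rank j < r))}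

variable {fm : Idx → Idx} {rank : Idx → ℕ}

theorem stage_mono {r s : ℕ} (h : r ≤ s) : stage O fm rank r ⊆ stage O fm rank s := by
  rintro j ⟨hj, h1 | h1 | h1⟩
  · exact ⟨hj, Or.inl h1⟩
  · exact ⟨hj, Or.inr (Or.inl ⟨h1.1, fun c hc he => (h1.2 c hc he).trans_le h⟩)⟩
  · exact ⟨hj, Or.inr (Or.inr ⟨h1.1, h1.2.trans_le h⟩)⟩

theorem card_free_of_mem_cubes {c : Idx} (hc : c ∈ cubes O) : (free c).card = 3 := by
  rw [hc.2]; rfl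

/-- The rest of the boundary of `c` has been treated before `c`. A square of `c` matched with
another cube `c'` also belongs to `c`, so the matching forces `rank c' < rank c`. -/
theorem mem_stage_of_mem_box (hO : IsOpen O) (hM : IsMatching O fm rank) {c : Idx} (hc : c ∈ cubes O)
    {y : O} (hy : y ∈ box O c) (h1 : cell y ≠ c) (h2 : cell y ≠ fm c) :
    cell y ∈ stage O fm rank (rank c) := by
  have h3 := card_free_lt hO hc.1 hy h1
  rw [card_free_of_mem_cubes hc] at h3
  refine ⟨⟨y, rfl⟩, ?_⟩
  by_cases h4 : (free (cell y)).card ≤ 1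
  · exact Or.inl h4
  · refine Or.inr (Or.inl ⟨by omega, fun c' hc' he => ?_⟩)
    have hne : c' ≠ c := by rintro rfl; exact h2 he.symm
    refine (hM c' hc').2.2 c hc ?_ hne.symm
    rw [he]
    obtain ⟨⟨x, rfl⟩, -⟩ := hc
    exact box_subset_box hO hy

theorem notMem_stage_of_cube {c : Idx} (hc : c ∈ cubes O) :
    c ∉ stage O fm rank (rank c) := by
  have h3 := card_free_of_mem_cubes hc
  rintro ⟨-, h | h | h⟩
  · omega
  · omega
  · exact lt_irrefl _ h.2

theorem notMem_stage_of_matched (hM : IsMatching O fm rank) {c : Idx} (hc : c ∈ cubes O) :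
    fm c ∉ stage O fm rank (rank c) := by
  have h2 := (hM c hc).1.2
  rintro ⟨-, h | h | h⟩
  · omega
  · exact lt_irrefl _ (h.2 c hc rfl)
  · have := card_free_of_mem_cubes h.1
    omega

theorem mem_stage_succ (hM : IsMatching O fm rank) {c : Idx} (hc : c ∈ cubes O) :
    c ∈ stage O fm rank (rank c + 1) ∧ fm c ∈ stage O fm rank (rank c + 1) := by
  refine ⟨⟨hc.1, Or.inr (Or.inr ⟨hc, Nat.lt_succ_self _⟩)⟩, (hM c hc).1.1,
    Or.inr (Or.inl ⟨(hM c hc).1.2, fun c' hc' he => ?_⟩)⟩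
  by_cases h : c' = c
  · rw [h]; exact Nat.lt_succ_self _
  · exact ((hM c' hc').2.2 c hc (by rw [he]; exact (hM c hc).2.1) (Ne.symm h)).trans
      (Nat.lt_succ_self _)

theorem stage_closed (hO : IsOpen O) (hM : IsMatching O fm rank) (r : ℕ) :
    ∀ j ∈ stage O fm rank r, ∀ y ∈ box O j, cell y ∈ stage O fm rank r := by
  intro j hj y hy
  by_cases hje : cell y = j
  · rw [hje]; exact hj
  obtain ⟨hjc, h | h | h⟩ := hj
  · exact ⟨⟨y, rfl⟩, Or.inl ((card_free_lt hO hjc hy hje).le.trans h)⟩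
  · exact ⟨⟨y, rfl⟩, Or.inl (by have := card_free_lt hO hjc hy hje; omega)⟩
  · by_cases hjm : cell y = fm j
    · rw [hjm]; exact stage_mono h.2 (mem_stage_succ hM h.1).2
    · exact stage_mono h.2.le (mem_stage_of_mem_box hO hM h.1 hy hje hjm)

theorem abs_sub_half_le_iff {P y a : ℝ} (hP : 0 < P) :
    |y - (a + 1 / 2) / P| ≤ 1 / (2 * P) ↔ a ≤ P * y ∧ P * y ≤ a + 1 := by
  have h1 : y - (a + 1 / 2) / P = (P * y - (a + 1 / 2)) / P := by field_simp
  have h2 : 1 / (2 * P) = (1 / 2) / P := by field_simp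
  rw [h1, abs_div, abs_of_pos hP, h2, div_le_div_iff_of_pos_right hP, abs_le]
  constructor <;> rintro ⟨h, h'⟩ <;> constructor <;> linarith

theorem abs_sub_half_lt_iff {P y a : ℝ} (hP : 0 < P) :
    |y - (a + 1 / 2) / P| < 1 / (2 * P) ↔ a < P * y ∧ P * y < a + 1 := by
  have h1 : y - (a + 1 / 2) / P = (P * y - (a + 1 / 2)) / P := by field_simp
  have h2 : 1 / (2 * P) = (1 / 2) / P := by field_simp
  rw [h1, abs_div, abs_of_pos hP, h2, div_lt_div_iff_of_pos_right hP, abs_lt]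
  constructor <;> rintro ⟨h, h'⟩ <;> constructor <;> linarith

/-- A cube as a ball in the maximum norm. -/
theorem exists_center_of_cube (hO : IsOpen O) {c : Idx} (hc : c ∈ cubes O) :
    ∃ (w : Fin 3 → ℝ) (R : ℝ), 0 < R ∧
      (∀ y : O, ∀ k, ((c.2.1 k : ℝ) ≤ 2 ^ c.1 * y.1 k ∧ 2 ^ c.1 * y.1 k ≤ c.2.2 k) ↔
        |y.1 k - w k| ≤ R) ∧
      (∀ y : O, y ∈ box O c ↔ ‖y.1 - w‖ ≤ R) ∧
      (∀ v : Fin 3 → ℝ, ‖v - w‖ ≤ R → v ∈ O) ∧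
      (∀ y : O, y ∈ box O c → (cell y = c ↔ ‖y.1 - w‖ < R)) ∧
      ∀ s : ℝ, ∀ k, (2 ^ c.1 * s = c.2.1 k ∨ 2 ^ c.1 * s = c.2.2 k) → |s - w k| = R := by
  have hp : (0 : ℝ) < 2 ^ c.1 := by positivity
  have hu : ∀ k, (c.2.2 k : ℝ) = c.2.1 k + 1 := fun k => by
    exact_mod_cast upper_eq_of_mem_free hc.1 (i := k) (by rw [hc.2]; exact Finset.mem_univ k)
  have hR : (0 : ℝ) < 1 / (2 * 2 ^ c.1) := by positivity
  have h1 : ∀ (v : Fin 3 → ℝ) (k), ((c.2.1 k : ℝ) ≤ 2 ^ c.1 * v k ∧ 2 ^ c.1 * v k ≤ c.2.2 k) ↔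
      |v k - (c.2.1 k + 1 / 2) / 2 ^ c.1| ≤ 1 / (2 * 2 ^ c.1) := fun v k => by
    rw [abs_sub_half_le_iff hp, hu]
  have h2 : ∀ y : O, y ∈ box O c ↔
      ‖y.1 - fun k => ((c.2.1 k : ℝ) + 1 / 2) / 2 ^ c.1‖ ≤ 1 / (2 * 2 ^ c.1) := fun y => by
    rw [pi_norm_le_iff_of_nonneg hR.le]
    exact forall_congr' fun k => h1 y.1 k
  refine ⟨fun k => (c.2.1 k + 1 / 2) / 2 ^ c.1, 1 / (2 * 2 ^ c.1), hR, fun y k => h1 y.1 k, h2,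
    ?_, ?_, ?_⟩
  · intro v hv
    rw [pi_norm_le_iff_of_nonneg hR.le] at hv
    exact mem_of_mem_box hO hc.1 fun k => (h1 v k).2 (hv k)
  · intro y hy
    rw [pi_norm_lt_iff hR]
    have h3 : ∀ k, ‖(y.1 - fun k => ((c.2.1 k : ℝ) + 1 / 2) / 2 ^ c.1) k‖ < 1 / (2 * 2 ^ c.1) ↔
      ((c.2.1 k : ℝ) < 2 ^ c.1 * y.1 k ∧ 2 ^ c.1 * y.1 k < c.2.2 k) := fun k => by
      rw [hu]; exact abs_sub_half_lt_iff hp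
    constructor
    · intro he k
      rw [h3]
      have hk : k ∈ free (cell y) := by rw [he, hc.2]; exact Finset.mem_univ k
      obtain ⟨⟨x, rfl⟩, -⟩ := hc
      exact lt_of_mem_free hO hy hk
    · intro h
      exact cell_eq_of_mem_openBox hO hc.1 hy fun k _ => (h3 k).1 (h k)
  · intro s k hs
    have h3 : s - ((c.2.1 k : ℝ) + 1 / 2) / 2 ^ c.1 = (2 ^ c.1 * s - (c.2.1 k + 1 / 2)) / 2 ^ c.1 := by
      field_simp
    have h4 : |2 ^ c.1 * s - ((c.2.1 k : ℝ) + 1 / 2)| = 1 / 2 := by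
      rcases hs with hs | hs
      · rw [hs, show (c.2.1 k : ℝ) - (c.2.1 k + 1 / 2) = -(1 / 2) by ring, abs_neg, abs_of_pos] <;>
          norm_num
      · rw [hs, hu, show (c.2.1 k : ℝ) + 1 - (c.2.1 k + 1 / 2) = 1 / 2 by ring, abs_of_pos] <;>
          norm_num
    rw [h3, abs_div, abs_of_pos hp, h4]
    field_simp

/-- The prism over a cube retracts onto its boundary without the open prism over a square. -/
theorem exists_retraction_cube (hO : IsOpen O) {c q : Idx} (hc : c ∈ cubes O) (hq : q ∈ squares O)
    (hqc : box O q ⊆ box O c) :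
    ∃ ρ : O × I → O × I, ContinuousOn ρ (Prod.fst ⁻¹' box O c) ∧
      (∀ p, p.1 ∈ box O c → (ρ p).1 ∈ box O c ∧
        (((ρ p).2 = 0 ∨ (ρ p).2 = 1) ∨ (cell (ρ p).1 ≠ c ∧ cell (ρ p).1 ≠ q))) ∧
      ∀ p, p.1 ∈ box O c → ((p.2 = 0 ∨ p.2 = 1) ∨ (cell p.1 ≠ c ∧ cell p.1 ≠ q)) → ρ p = p := by
  classical
  have hne : ∀ i : Fin 3, i + 1 ≠ i := by decide
  obtain ⟨w, R, hR, hk, hbox, hmemO, hint, hcorner⟩ := exists_center_of_cube hO hc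
  obtain ⟨i, hi⟩ := exists_forall_mem_iff_ne _ hq.2
  have hpq : (0 : ℝ) < 2 ^ q.1 := by positivity
  have huq : ∀ k ≠ i, (q.2.2 k : ℝ) = q.2.1 k + 1 := fun k hki => by
    exact_mod_cast upper_eq_of_mem_free hq.1 ((hi k).2 hki)
  have hiq : q.2.2 i = q.2.1 i := upper_eq_of_notMem_free fun h => (hi i).1 h rfl
  -- Half the side of `q`. The square may be smaller than the face of the cube carrying it, so it is
  -- described as the points of the cube's boundary at distance less than `h` from its centre `z`.
  set h : ℝ := 1 / (2 * 2 ^ q.1)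
  have hh : 0 < h := by positivity
  let s0 : I := ⟨1 / 2, by norm_num, by norm_num⟩
  set z : O := point hO hq.1 fun _ => s0
  have hz : ∀ k, 2 ^ q.1 * z.1 k = q.2.1 k + ((q.2.2 k : ℝ) - q.2.1 k) * (1 / 2) := fun k =>
    mul_point_apply hO hq.1 _ k
  have hzk : ∀ k ≠ i, z.1 k = (q.2.1 k + 1 / 2) / 2 ^ q.1 := fun k hki => by
    rw [eq_div_iff hpq.ne', mul_comm, hz, huq k hki]; ring
  have hzi : 2 ^ q.1 * z.1 i = q.2.1 i := by rw [hz, hiq]; ring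
  have hzbox : z ∈ box O q := point_mem_box hO hq.1 _
  have hzcell : cell z = q := by
    refine cell_eq_of_mem_openBox hO hq.1 hzbox fun k hkq => ?_
    rw [hz, huq k ((hi k).1 hkq)]
    constructor <;> linarith
  have hzw : |z.1 i - w i| = R :=
    hcorner _ _ (mul_coord_eq_of_mem_box hO hc (hqc hzbox) (by rw [hzcell]; exact hi))
  have hzside : ∀ k ≠ i, |z.1 k - w k| + h ≤ R := by
    intro k hki
    have h0 := (hk _ k).1 (hqc (point_mem_box hO hq.1 fun _ => 0) k)
    have h1 := (hk _ k).1 (hqc (point_mem_box hO hq.1 fun _ => 1) k)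
    have e0 : (point hO hq.1 fun _ => 0).1 k = z.1 k - h := by
      refine mul_left_cancel₀ hpq.ne' ?_
      rw [mul_point_apply, mul_sub, hz, huq k hki]
      simp only [h, Set.Icc.coe_zero]
      field_simp
      ring
    have e1 : (point hO hq.1 fun _ => 1).1 k = z.1 k + h := by
      refine mul_left_cancel₀ hpq.ne' ?_
      rw [mul_point_apply, mul_add, hz, huq k hki]
      simp only [h, Set.Icc.coe_one]
      field_simp
      ring
    rw [e0, abs_le] at h0
    rw [e1, abs_le] at h1
    rcases abs_cases (z.1 k - w k) with ⟨h2, -⟩ | ⟨h2, -⟩ <;> rw [h2] <;> linarith [h0.1, h1.2]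
  have hcellq : ∀ y : O, y ∈ box O c → ‖y.1 - w‖ = R → (cell y = q ↔ ‖y.1 - z.1‖ < h) := by
    intro y hy hyR
    rw [pi_norm_lt_iff hh]
    constructor
    · intro he k
      have hyq : y ∈ box O q := by rw [← he]; exact mem_box_cell y
      by_cases hki : k = i
      · subst hki
        have h1 := hyq k
        rw [hiq] at h1
        have h2 : y.1 k = z.1 k := by
          refine mul_left_cancel₀ hpq.ne' ?_
          rw [hzi]; exact le_antisymm h1.2 h1.1
        rw [Pi.sub_apply, h2, sub_self, norm_zero]; exact hh
      · rw [Pi.sub_apply, Real.norm_eq_abs, hzk k hki, abs_sub_half_lt_iff hpq, ← huq k hki]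
        have hkq : k ∈ free (cell y) := by rw [he]; exact (hi k).2 hki
        obtain ⟨⟨x, rfl⟩, -⟩ := hq
        exact lt_of_mem_free hO hyq hkq
    · intro hlt
      have hlt' : ∀ k ≠ i, (q.2.1 k : ℝ) < 2 ^ q.1 * y.1 k ∧ 2 ^ q.1 * y.1 k < q.2.2 k := by
        intro k hki
        have := hlt k
        rwa [Pi.sub_apply, Real.norm_eq_abs, hzk k hki, abs_sub_half_lt_iff hpq, ← huq k hki] at this
      have hyw : ∀ k ≠ i, |y.1 k - w k| < R := by
        intro k hki
        have h1 := hlt k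
        have h2 := hzside k hki
        rw [Pi.sub_apply, Real.norm_eq_abs] at h1
        have h3 := abs_add_le (y.1 k - z.1 k) (z.1 k - w k)
        rw [sub_add_sub_cancel] at h3
        linarith
      have hyi : |y.1 i - w i| = R := by
        refine le_antisymm (hyR ▸ norm_le_pi_norm (y.1 - w) i) (not_lt.1 fun hcon => ?_)
        refine absurd hyR (ne_of_lt ((pi_norm_lt_iff hR).2 fun k => ?_))
        by_cases hki : k = i
        · rw [hki]; exact hcon
        · exact hyw k hki
      have hhR : h ≤ R := by
        linarith [hzside (i + 1) (hne i), abs_nonneg (z.1 (i + 1) - w (i + 1))]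
      have hyz : y.1 i = z.1 i := by
        have h1 := hlt i
        rw [Pi.sub_apply, Real.norm_eq_abs, abs_lt] at h1
        rcases abs_cases (y.1 i - w i) with ⟨h2, -⟩ | ⟨h2, -⟩ <;>
          rcases abs_cases (z.1 i - w i) with ⟨h3, -⟩ | ⟨h3, -⟩ <;> linarith
      refine cell_eq_of_mem_openBox hO hq.1 (fun k => ?_) fun k hkq => hlt' k ((hi k).1 hkq)
      by_cases hki : k = i
      · subst hki
        rw [hyz, hzi, hiq]; exact ⟨le_rfl, le_rfl⟩
      · exact ⟨(hlt' k hki).1.le, (hlt' k hki).2.le⟩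
  have hiff : ∀ y : O, y ∈ box O c →
      ((‖y.1 - w‖ = R ∧ h ≤ ‖y.1 - z.1‖) ↔ (cell y ≠ c ∧ cell y ≠ q)) := by
    intro y hy
    have hle := (hbox y).1 hy
    constructor
    · rintro ⟨h1, h2⟩
      exact ⟨fun he => absurd ((hint y hy).1 he) (not_lt.2 h1.ge),
        fun he => absurd ((hcellq y hy h1).1 he) (not_lt.2 h2)⟩
    · rintro ⟨h1, h2⟩
      have h3 : ‖y.1 - w‖ = R := le_antisymm hle (not_lt.1 fun hcon => h1 ((hint y hy).2 hcon))
      exact ⟨h3, not_lt.1 fun hcon => h2 ((hcellq y hy h3).2 hcon)⟩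
  obtain ⟨ρ, hρc, hρm, hρid⟩ := exists_retraction_prism (w := w) (z := z.1) (R := R) (h := h)
    (i := i) (j := i + 1) (hne i) hR hh hzw hzside
  let e : O × I → (Fin 3 → ℝ) × I := fun p => (p.1.1, p.2)
  have he : IsInducing e := Topology.IsInducing.subtypeVal.prodMap Topology.IsInducing.id
  let ρ' : O × I → O × I := fun p => if hp : (ρ (e p)).1 ∈ O then (⟨_, hp⟩, (ρ (e p)).2) else p
  have hmaps : MapsTo e (Prod.fst ⁻¹' box O c) (Metric.closedBall w R ×ˢ univ) := fun p hp =>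
    ⟨by rw [Metric.mem_closedBall, dist_eq_norm]; exact (hbox p.1).1 hp, trivial⟩
  have hval : ∀ p, p.1 ∈ box O c → e (ρ' p) = ρ (e p) := by
    intro p hp
    have h1 := hmemO _ (hρm (hmaps hp)).1
    simp only [ρ', dif_pos h1, e]
  refine ⟨ρ', ?_, ?_, ?_⟩
  · rw [he.continuousOn_iff]
    exact (hρc.comp he.continuous.continuousOn hmaps).congr fun p hp => hval p hp
  · intro p hp
    have h1 := hρm (hmaps hp)
    rw [← hval p hp] at h1
    have h2 : (ρ' p).1 ∈ box O c := (hbox _).2 h1.1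
    exact ⟨h2, h1.2.imp_right (hiff _ h2).1⟩
  · intro p hp h1
    have h2 := hρid (e p) ((hbox _).1 hp) (h1.imp_right (hiff p.1 hp).2)
    have h3 : e (ρ' p) = e p := (hval p hp).trans h2
    simp only [e, Prod.mk.injEq] at h3
    exact Prod.ext (Subtype.ext h3.1) h3.2

end DyadicBox


/-! ### Extending the homotopy over the cubes in order of rank. -/

namespace DyadicBox

open Set Filter

variable {O : Set (Fin 3 → ℝ)}

local notation "I" => unitInterval

variable {X : Type*} [TopologicalSpace X] {fm : Idx → Idx} {rank : Idx → ℕ}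

/-- Extension of a homotopy over the cubes of rank `r`. -/
theorem exists_homotopy_stage_succ (hO : IsOpen O) (hM : IsMatching O fm rank) (r : ℕ)
    {F : O × I → X} (hF : ContinuousOn F (prism O (stage O fm rank r))) :
    ∃ F' : O × I → X, ContinuousOn F' (prism O (stage O fm rank (r + 1))) ∧
      EqOn F' F (prism O (stage O fm rank r)) := by
  refine exists_extension_prism hO (J := {c | c ∈ cubes O ∧ rank c = r}) (fun c hc => hc.1.1)
    (fun j hj => hj.1) (stage_closed hO hM r) ?_ ?_ hF ?_
  · rintro c ⟨hc, rfl⟩ c' ⟨hc', hr⟩ hne y hy hy'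
    -- Two cubes of equal rank meet only where the homotopy is already defined: a common point is
    -- interior to neither cube, and it is not interior to the matched square of `c`, since another
    -- cube containing that square has larger rank.
    refine mem_stage_of_mem_box hO hM hc hy (fun he => ?_) fun he => ?_
    · have := card_free_lt_of_mem_of_mem hO hc.1 hc'.1 (by
        rw [card_free_of_mem_cubes hc, card_free_of_mem_cubes hc']) hne hy hy'
      rw [he] at this
      exact lt_irrefl _ this
    · have h1 : box O (fm c) ⊆ box O c' := by
        rw [← he]
        obtain ⟨⟨x, rfl⟩, -⟩ := hc'
        exact box_subset_box hO hy'
      have := (hM c hc).2.2 c' hc' h1 hne.symm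
      omega
  · rintro y ⟨hy, h | h | h⟩
    · exact Or.inl ⟨hy, Or.inl h⟩
    -- A square that becomes available only now is matched with a cube of rank exactly `r`, and it
    -- is filled together with that cube.
    · by_cases h2 : ∀ c ∈ cubes O, fm c = cell y → rank c < r
      · exact Or.inl ⟨hy, Or.inr (Or.inl ⟨h.1, h2⟩)⟩
      · push Not at h2
        obtain ⟨c, hc, he, hr⟩ := h2
        have := h.2 c hc he
        exact Or.inr ⟨c, ⟨hc, by omega⟩, (hM c hc).2.1 (by rw [he]; exact mem_box_cell y)⟩
    · by_cases h2 : rank (cell y) < r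
      · exact Or.inl ⟨hy, Or.inr (Or.inr ⟨h.1, h2⟩)⟩
      · exact Or.inr ⟨_, ⟨h.1, by have := h.2; omega⟩, mem_box_cell y⟩
  · rintro c ⟨hc, rfl⟩
    -- Precomposing with this retraction extends `F` over the cube and its matched square at once,
    -- so no condition on `π₃` arises.
    obtain ⟨ρ, hρc, hρm, hρid⟩ := exists_retraction_cube hO hc (hM c hc).1 (hM c hc).2.1
    refine ⟨fun p => F (ρ p), hF.comp hρc fun p hp => ?_, fun p hp hps => ?_⟩
    · obtain ⟨h1, h2⟩ := hρm p hp
      exact h2.imp_right fun h => mem_stage_of_mem_box hO hM hc h1 h.1 h.2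
    · refine congrArg F (hρid p hp (hps.imp_right fun h => ⟨fun he => ?_, fun he => ?_⟩))
      · exact notMem_stage_of_cube hc (he ▸ h)
      · exact notMem_stage_of_matched hM hc (he ▸ h)

/-- Finitely many boxes contain `y`, and nearby points lie in no others. The ranks of the cubes
involved are therefore bounded near `y`. -/
theorem exists_eventually_mem_stage (hO : IsOpen O) (hM : IsMatching O fm rank) (y : O) :
    ∃ r, ∀ᶠ z in 𝓝 y, cell z ∈ stage O fm rank r := by
  have hfin := (locallyFinite_box hO).point_finite y
  obtain ⟨r, hr⟩ := (hfin.image fun j => rank j.1).bddAbove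
  refine ⟨r + 1, ?_⟩
  filter_upwards [(locallyFinite_box hO).eventually_subset (fun j => isClosed_box j.1) y] with z hz
  have key : ∀ c ∈ cubes O, z ∈ box O c → rank c < r + 1 := fun c hc hzc =>
    Nat.lt_succ_of_le (hr ⟨⟨c, hc.1⟩, hz (a := ⟨c, hc.1⟩) hzc, rfl⟩)
  refine ⟨⟨z, rfl⟩, ?_⟩
  have h3 : (free (cell z)).card ≤ 3 := by simpa using Finset.card_le_univ (free (cell z))
  by_cases h1 : (free (cell z)).card ≤ 1
  · exact Or.inl h1
  · by_cases h2 : (free (cell z)).card = 2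
    · exact Or.inr (Or.inl ⟨h2, fun c hc he => key c hc
        ((hM c hc).2.1 (by rw [he]; exact mem_box_cell z))⟩)
    · have hc : cell z ∈ cubes O := ⟨⟨z, rfl⟩, by
        rw [← Finset.card_eq_iff_eq_univ, Fintype.card_fin]; omega⟩
      exact Or.inr (Or.inr ⟨hc, key _ hc (mem_box_cell z)⟩)

/-- The successive extensions are stationary near each point, so their limit is continuous. -/
theorem exists_homotopy_of_stage_zero (hO : IsOpen O) (hM : IsMatching O fm rank) {F : O × I → X}
    (hF : ContinuousOn F (prism O (stage O fm rank 0))) :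
    ∃ H : C(O × I, X), EqOn H F (prism O (stage O fm rank 0)) := by
  classical
  choose next hnext using fun (r : ℕ) (F : {F : O × I → X // ContinuousOn F (prism O (stage O fm rank r))}) =>
    exists_homotopy_stage_succ hO hM r F.2
  let seq : ∀ r, {F : O × I → X // ContinuousOn F (prism O (stage O fm rank r))} := fun r =>
    Nat.rec ⟨F, hF⟩ (fun r F => ⟨next r F, (hnext r F).1⟩) r
  have hsucc : ∀ r, EqOn (seq (r + 1)).1 (seq r).1 (prism O (stage O fm rank r)) := fun r =>
    (hnext r (seq r)).2
  have hpm : ∀ {r s : ℕ}, r ≤ s → prism O (stage O fm rank r) ⊆ prism O (stage O fm rank s) :=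
    fun h p hp => hp.imp_right fun h' => stage_mono h h'
  have hmono : ∀ r s, r ≤ s → EqOn (seq s).1 (seq r).1 (prism O (stage O fm rank r)) := by
    intro r s h
    induction s, h using Nat.le_induction with
    | base => exact fun _ _ => rfl
    | succ s h ih => exact fun p hp => (hsucc s (hpm h hp)).trans (ih hp)
  choose N hN using exists_eventually_mem_stage (fm := fm) (rank := rank) hO hM
  let H : O × I → X := fun p => (seq (N p.1)).1 p
  have hH : ∀ r, EqOn H (seq r).1 (prism O (stage O fm rank r)) := by
    intro r p hp
    have hp' : p ∈ prism O (stage O fm rank (N p.1)) := Or.inr (hN p.1).self_of_nhds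
    rcases le_total r (N p.1) with h | h
    · exact hmono _ _ h hp
    · exact (hmono _ _ h hp').symm
  refine ⟨⟨H, continuous_iff_continuousAt.2 fun p => ?_⟩, fun p hp => hH 0 hp⟩
  have hnhds : prism O (stage O fm rank (N p.1)) ∈ 𝓝 p := by
    filter_upwards [continuous_fst.continuousAt.eventually (hN p.1)] with q hq
    exact Or.inr hq
  exact ((seq (N p.1)).2.continuousAt hnhds).congr
    (Filter.eventuallyEq_of_mem hnhds (hH _)).symm

/-- Two maps from a connected open subset of `ℝ³` to a space with vanishing second homotopy group
are homotopic if they are conjugate on loops. -/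
theorem exists_homotopy (hO : IsOpen O) (hconn : PathConnectedSpace O) {x₀ : X}
    (hpi : Subsingleton (π_ 2 X x₀)) {f g : C(O, X)} {p : O} (hp : free (cell p) = ∅)
    (hfp : Joined (f p) x₀) (δ : Path (f p) (g p))
    (hδ : ∀ ω : Path p p, ((ω.map f.continuous).trans δ).Homotopic (δ.trans (ω.map g.continuous))) :
    ∃ H : C(O × I, X), (∀ y, H (y, 0) = f y) ∧ (∀ y, H (y, 1) = g y) ∧ ∀ t, H (p, t) = δ t := by
  classical
  let γ : ∀ v, Path p v := fun v => (hconn.joined p v).somePath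
  let η₀ : ∀ v, Path (f v) (g v) := fun v =>
    (((γ v).map f.continuous).symm.trans δ).trans ((γ v).map g.continuous)
  have hη₀ : ∀ v w (s : Path v w), ((s.map f.continuous).trans (η₀ w)).Homotopic
      ((η₀ v).trans (s.map g.continuous)) := fun v w s => homotopic_trans_of_conj f g δ hδ (γ v) (γ w) s
  -- The transported path `η₀ p` is only homotopic to `δ`. It is replaced by `δ` so that the final
  -- homotopy moves `p` exactly along `δ`.
  have hex : ∀ v, ∃ η : Path (f v) (g v), η.Homotopic (η₀ v) ∧ ∀ h : v = p, ∀ t, η t = δ t := by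
    intro v
    by_cases h : v = p
    · subst h
      exact ⟨δ, Path.Homotopic.trans_trans_of_comm (hδ (γ v)), fun _ _ => rfl⟩
    · exact ⟨η₀ v, Path.Homotopic.refl _, fun h' => absurd h' h⟩
  choose η hη hηp using hex
  obtain ⟨F₁, hF₁, h0, h1, hv⟩ := exists_homotopy_edges hO η fun v w s =>
    ((Path.Homotopic.refl _).hcomp (hη w)).trans
      ((hη₀ v w s).trans ((hη v).symm.hcomp (Path.Homotopic.refl _)))
  have hf : ∀ y, Joined (f y) x₀ := fun y =>
    (Joined.symm ⟨(γ y).map f.continuous⟩).trans hfp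
  have hjoin : ∀ q ∈ prism O (skel O 1), Joined (F₁ q) x₀ := by
    rintro ⟨y, t⟩ (((rfl : t = 0) | (rfl : t = 1)) | hy)
    · rw [h0]; exact hf y
    · rw [h1]; exact (Joined.symm ⟨η y⟩).trans (hf y)
    · have hc : Continuous fun s : I => F₁ (y, s) :=
        hF₁.comp_continuous (by fun_prop) fun s => mem_prism_of_cell hy s
      refine Joined.trans (Joined.symm ?_) (hf y)
      rw [← h0 y]
      exact ⟨{ toFun := fun s => F₁ (y, s * t)
               continuous_toFun := hc.comp (continuous_mul_const t)
               source' := by simp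
               target' := by simp }⟩
  obtain ⟨fm, rank, hM⟩ := exists_matching hO
  -- Only unmatched squares are filled here. Matched ones must stay free until their cube is
  -- treated.
  obtain ⟨F₂, hF₂, hF₂e⟩ := exists_homotopy_squares hO hpi hF₁ hjoin
    (J := {j | j ∈ squares O ∧ ∀ c ∈ cubes O, fm c ≠ j}) fun j hj => hj.1
  have hst : stage O fm rank 0 ⊆ skel O 1 ∪ {j | j ∈ squares O ∧ ∀ c ∈ cubes O, fm c ≠ j} := by
    rintro j ⟨hj, h | h | h⟩
    · exact Or.inl ⟨hj, h⟩
    · exact Or.inr ⟨⟨hj, h.1⟩, fun c hc he => Nat.not_lt_zero _ (h.2 c hc he)⟩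
    · exact absurd h.2 (Nat.not_lt_zero _)
  obtain ⟨H, hH⟩ := exists_homotopy_of_stage_zero hO hM
    (hF₂.mono fun q hq => hq.imp_right fun h => hst h)
  have hpc : cell p ∈ skel O 0 := ⟨⟨p, rfl⟩, by rw [hp]; exact le_rfl⟩
  have hpc1 : cell p ∈ skel O 1 := ⟨hpc.1, hpc.2.trans zero_le_one⟩
  have hst0 : cell p ∈ stage O fm rank 0 := ⟨hpc.1, Or.inl hpc1.2⟩
  refine ⟨H, fun y => ?_, fun y => ?_, fun t => ?_⟩
  · exact (hH (mem_prism_zero _ y)).trans ((hF₂e (mem_prism_zero _ y)).trans (h0 y))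
  · exact (hH (mem_prism_one _ y)).trans ((hF₂e (mem_prism_one _ y)).trans (h1 y))
  · refine (hH (mem_prism_of_cell hst0 t)).trans
      ((hF₂e (mem_prism_of_cell hpc1 t)).trans ((hv p t hpc).trans (hηp p rfl t)))

end DyadicBox


/-! ### Paths whose image is prescribed by a homomorphism. -/

section Compat

open Path

variable {Y X Z : Type*} [TopologicalSpace Y] [TopologicalSpace X] [TopologicalSpace Z] {p : Y} {x₀ : X}

/-- The map `F` acts on the path `ω` as prescribed by `φ`, where loops are formed by means of the
chosen connections of the end points with the base points. -/
def Compat (φ : Homotopic.Quotient p p → Homotopic.Quotient x₀ x₀) (ι : C(Z, Y)) (F : C(Z, X)) {x y : Z}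
    (τx : Homotopic.Quotient x₀ (F x)) (gx : Homotopic.Quotient p (ι x)) (τy : Homotopic.Quotient x₀ (F y)) (gy : Homotopic.Quotient p (ι y))
    (ω : Path x y) : Prop :=
  τx.trans (Homotopic.Quotient.mk (ω.map F.continuous)) =
    (φ ((gx.trans (Homotopic.Quotient.mk (ω.map ι.continuous))).trans gy.symm)).trans τy

variable {φ : Homotopic.Quotient p p → Homotopic.Quotient x₀ x₀} {ι : C(Z, Y)} {F : C(Z, X)}

theorem Path.Homotopic.Quotient.map_refl_of_map_trans
    (hφ : ∀ a b, φ (a.trans b) = (φ a).trans (φ b)) : φ (Homotopic.Quotient.refl p) = Homotopic.Quotient.refl x₀ := by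
  have h := hφ (Homotopic.Quotient.refl p) (Homotopic.Quotient.refl p)
  rw [Homotopic.Quotient.refl_trans] at h
  have h2 := congrArg (fun q => q.trans (φ (Homotopic.Quotient.refl p)).symm) h
  simp only [Homotopic.Quotient.trans_symm, Homotopic.Quotient.trans_assoc, Homotopic.Quotient.trans_refl] at h2
  exact h2.symm

theorem Compat.of_homotopic {x y : Z} {τx : Homotopic.Quotient x₀ (F x)} {gx : Homotopic.Quotient p (ι x)}
    {τy : Homotopic.Quotient x₀ (F y)} {gy : Homotopic.Quotient p (ι y)} {ω ω' : Path x y} (h : ω.Homotopic ω')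
    (hω : Compat φ ι F τx gx τy gy ω) : Compat φ ι F τx gx τy gy ω' := by
  have h1 : Homotopic.Quotient.mk (ω.map F.continuous) = Homotopic.Quotient.mk (ω'.map F.continuous) :=
    Homotopic.Quotient.eq.2 (h.map F)
  have h2 : Homotopic.Quotient.mk (ω.map ι.continuous) = Homotopic.Quotient.mk (ω'.map ι.continuous) :=
    Homotopic.Quotient.eq.2 (h.map ι)
  rw [Compat, h1, h2] at hω
  exact hω

theorem Compat.refl (hφ : ∀ a b, φ (a.trans b) = (φ a).trans (φ b)) {x : Z} (τx : Homotopic.Quotient x₀ (F x))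
    (gx : Homotopic.Quotient p (ι x)) : Compat φ ι F τx gx τx gx (Path.refl x) := by
  have h1 : Homotopic.Quotient.mk ((Path.refl x).map F.continuous) = Homotopic.Quotient.refl (F x) := rfl
  have h2 : Homotopic.Quotient.mk ((Path.refl x).map ι.continuous) = Homotopic.Quotient.refl (ι x) := rfl
  rw [Compat, h1, h2, Homotopic.Quotient.trans_refl, Homotopic.Quotient.trans_refl, Homotopic.Quotient.trans_symm,
    Homotopic.Quotient.map_refl_of_map_trans hφ, Homotopic.Quotient.refl_trans]

theorem Compat.trans (hφ : ∀ a b, φ (a.trans b) = (φ a).trans (φ b)) {x y z : Z}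
    {τx : Homotopic.Quotient x₀ (F x)} {gx : Homotopic.Quotient p (ι x)} {τy : Homotopic.Quotient x₀ (F y)}
    {gy : Homotopic.Quotient p (ι y)} {τz : Homotopic.Quotient x₀ (F z)} {gz : Homotopic.Quotient p (ι z)} {ω : Path x y}
    {ω' : Path y z} (h : Compat φ ι F τx gx τy gy ω) (h' : Compat φ ι F τy gy τz gz ω') :
    Compat φ ι F τx gx τz gz (ω.trans ω') := by
  rw [Compat] at h h' ⊢
  rw [Path.map_trans, Path.map_trans, Homotopic.Quotient.mk_trans, Homotopic.Quotient.mk_trans,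
    ← Homotopic.Quotient.trans_assoc, h, Homotopic.Quotient.trans_assoc, h', ← Homotopic.Quotient.trans_assoc, ← hφ]
  congr 2
  simp only [Homotopic.Quotient.trans_assoc]
  rw [← Homotopic.Quotient.trans_assoc gy.symm gy, Homotopic.Quotient.symm_trans, Homotopic.Quotient.refl_trans]

theorem Compat.symm (hφ : ∀ a b, φ (a.trans b) = (φ a).trans (φ b)) {x y : Z}
    {τx : Homotopic.Quotient x₀ (F x)} {gx : Homotopic.Quotient p (ι x)} {τy : Homotopic.Quotient x₀ (F y)}
    {gy : Homotopic.Quotient p (ι y)} {ω : Path x y} (h : Compat φ ι F τx gx τy gy ω) :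
    Compat φ ι F τy gy τx gx ω.symm := by
  rw [Compat] at h ⊢
  have h1 : Homotopic.Quotient.mk (ω.symm.map F.continuous) = (Homotopic.Quotient.mk (ω.map F.continuous)).symm := rfl
  have h2 : Homotopic.Quotient.mk (ω.symm.map ι.continuous) = (Homotopic.Quotient.mk (ω.map ι.continuous)).symm := rfl
  rw [h1, h2]
  have h3 := congrArg (fun q => ((φ ((gy.trans (Homotopic.Quotient.mk (ω.map ι.continuous)).symm).trans
    gx.symm)).trans q).trans (Homotopic.Quotient.mk (ω.map F.continuous)).symm) h
  rw [← Homotopic.Quotient.trans_assoc _ _ τy, ← hφ] at h3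
  have h4 : ((gy.trans (Homotopic.Quotient.mk (ω.map ι.continuous)).symm).trans gx.symm).trans
      ((gx.trans (Homotopic.Quotient.mk (ω.map ι.continuous))).trans gy.symm) = Homotopic.Quotient.refl p := by
    simp only [Homotopic.Quotient.trans_assoc]
    rw [← Homotopic.Quotient.trans_assoc gx.symm gx, Homotopic.Quotient.symm_trans, Homotopic.Quotient.refl_trans,
      ← Homotopic.Quotient.trans_assoc (Homotopic.Quotient.mk (ω.map ι.continuous)).symm, Homotopic.Quotient.symm_trans,
      Homotopic.Quotient.refl_trans, Homotopic.Quotient.trans_symm]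
  rw [h4, Homotopic.Quotient.map_refl_of_map_trans hφ, Homotopic.Quotient.refl_trans] at h3
  rw [← h3]
  simp only [Homotopic.Quotient.trans_assoc, Homotopic.Quotient.trans_symm, Homotopic.Quotient.trans_refl]

/-- When the connections at `x` and `y` are transported from `b` and `b'` along `κ` and `κ'`,
compatibility of `ω` is that of the conjugated path between `b` and `b'`. -/
theorem Compat.of_conj {b b' x y : Z}
    {τx : Homotopic.Quotient x₀ (F b)} {gx : Homotopic.Quotient p (ι b)} {τy : Homotopic.Quotient x₀ (F b')}
    {gy : Homotopic.Quotient p (ι b')} {κ : Path b x} {κ' : Path b' y} {ω : Path x y}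
    (h : Compat φ ι F τx gx τy gy ((κ.trans ω).trans κ'.symm)) :
    Compat φ ι F (τx.trans (Homotopic.Quotient.mk (κ.map F.continuous)))
      (gx.trans (Homotopic.Quotient.mk (κ.map ι.continuous))) (τy.trans (Homotopic.Quotient.mk (κ'.map F.continuous)))
      (gy.trans (Homotopic.Quotient.mk (κ'.map ι.continuous))) ω := by
  rw [Compat] at h ⊢
  rw [Path.map_trans, Path.map_trans, Path.map_trans, Path.map_trans, ← Path.map_symm,
    ← Path.map_symm] at h
  simp only [Homotopic.Quotient.mk_trans, Homotopic.Quotient.mk_symm] at h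
  have h2 := congrArg (fun q => q.trans (Homotopic.Quotient.mk (κ'.map F.continuous))) h
  simp only [Homotopic.Quotient.trans_assoc, Homotopic.Quotient.symm_trans, Homotopic.Quotient.trans_refl] at h2
  have h3 : (gy.trans (Homotopic.Quotient.mk (κ'.map ι.continuous))).symm =
      (Homotopic.Quotient.mk (κ'.map ι.continuous)).symm.trans gy.symm := by
    induction gy using Path.Homotopic.Quotient.ind with | _ gy =>
    rw [← Homotopic.Quotient.mk_trans, ← Homotopic.Quotient.mk_symm, Path.trans_symm, Homotopic.Quotient.mk_trans,
      Homotopic.Quotient.mk_symm, Homotopic.Quotient.mk_symm]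
  rw [h3]
  simp only [Homotopic.Quotient.trans_assoc]
  exact h2

/-- Compatible paths with homotopic images in the source have homotopic images in the target. -/
theorem Compat.homotopic_map {x y : Z} {τx : Homotopic.Quotient x₀ (F x)} {gx : Homotopic.Quotient p (ι x)}
    {τy : Homotopic.Quotient x₀ (F y)} {gy : Homotopic.Quotient p (ι y)} {ω ω' : Path x y}
    (h : Compat φ ι F τx gx τy gy ω) (h' : Compat φ ι F τx gx τy gy ω')
    (hω : (ω.map ι.continuous).Homotopic (ω'.map ι.continuous)) :
    (ω.map F.continuous).Homotopic (ω'.map F.continuous) := by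
  rw [Compat] at h h'
  rw [← Homotopic.Quotient.eq.2 hω] at h'
  have h2 := congrArg (fun q => τx.symm.trans q) (h.trans h'.symm)
  simp only [← Homotopic.Quotient.trans_assoc, Homotopic.Quotient.symm_trans, Homotopic.Quotient.refl_trans] at h2
  exact Homotopic.Quotient.exact h2

end Compat

section StarConvex

variable {E : Type*} [AddCommGroup E] [Module ℝ E] [TopologicalSpace E] [ContinuousAdd E]
  [ContinuousSMul ℝ E] {Z : Type*} [TopologicalSpace Z] {e : Z → E}

/-- A star-convex set is contractible, so paths in it with equal ends are homotopic, and the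
homotopy lifts to `Z` through the inverse of `e`. It is used for skeleta, whose closed cells are
convex subsets of `ℝ³`. -/
theorem Path.homotopic_of_starConvex (he : IsInducing e) {K : Set E} {c : E} (hK : StarConvex ℝ c K)
    (hKZ : ∀ v ∈ K, ∃ z, e z = v) (hinj : Function.Injective e) {x y : Z} {α β : Path x y}
    (hα : ∀ t, e (α t) ∈ K) (hβ : ∀ t, e (β t) ∈ K) : α.Homotopic β := by
  choose s hs using hKZ
  have hsc : Continuous fun v : K => s v.1 v.2 := by
    rw [he.continuous_iff]
    exact continuous_subtype_val.congr fun v => (hs v.1 v.2).symm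
  have : ContractibleSpace K := hK.contractibleSpace ⟨_, hα 0⟩
  have hse : ∀ z (hz : e z ∈ K), s (e z) hz = z := fun z hz => hinj (hs _ hz)
  have hx : e x ∈ K := by have := hα 0; rwa [α.source] at this
  have hy : e y ∈ K := by have := hα 1; rwa [α.target] at this
  let lift : ∀ (γ : Path x y), (∀ t, e (γ t) ∈ K) → Path (⟨e x, hx⟩ : K) ⟨e y, hy⟩ := fun γ hγ =>
    { toFun := fun t => ⟨e (γ t), hγ t⟩
      continuous_toFun := (he.continuous.comp γ.continuous).subtype_mk _
      source' := by simp
      target' := by simp }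
  have h := (SimplyConnectedSpace.paths_homotopic (lift α hα) (lift β hβ)).map ⟨_, hsc⟩
  have hback : ∀ (γ : Path x y) (hγ : ∀ t, e (γ t) ∈ K),
      γ = ((lift γ hγ).map hsc).cast (hse x hx).symm (hse y hy).symm := fun γ hγ => by
    ext t
    exact (hse _ (hγ t)).symm
  rw [hback α hα, hback β hβ]
  obtain ⟨H⟩ := h
  exact ⟨H.cast rfl rfl⟩

theorem exists_path_of_starConvex (he : IsInducing e) {K : Set E} {c : E} (hK : StarConvex ℝ c K)
    (hKZ : ∀ v ∈ K, ∃ z, e z = v) (hinj : Function.Injective e) {x y : Z} (hx : e x ∈ K)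
    (hy : e y ∈ K) : ∃ γ : Path x y, ∀ t, e (γ t) ∈ K := by
  choose s hs using hKZ
  have hsc : Continuous fun v : K => s v.1 v.2 := by
    rw [he.continuous_iff]
    exact continuous_subtype_val.congr fun v => (hs v.1 v.2).symm
  have : ContractibleSpace K := hK.contractibleSpace ⟨_, hx⟩
  have hse : ∀ z (hz : e z ∈ K), s (e z) hz = z := fun z hz => hinj (hs _ hz)
  obtain ⟨γ⟩ : Joined (⟨e x, hx⟩ : K) ⟨e y, hy⟩ := PathConnectedSpace.joined _ _
  refine ⟨(γ.map hsc).cast (hse x hx).symm (hse y hy).symm, fun t => ?_⟩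
  have : e (s (γ t).1 (γ t).2) = (γ t).1 := hs _ _
  change e (s (γ t).1 (γ t).2) ∈ K
  rw [this]
  exact (γ t).2

end StarConvex


theorem Path.forall_mem_trans {Z : Type*} [TopologicalSpace Z] {x y z : Z} {α : Path x y} {β : Path y z}
    {P : Z → Prop} (h : ∀ t, P (α t)) (h' : ∀ t, P (β t)) (t : unitInterval) : P ((α.trans β) t) := by
  have h1 : (α.trans β) t ∈ Set.range α ∪ Set.range β := by
    rw [← Path.trans_range]; exact ⟨t, rfl⟩
  rcases h1 with ⟨s, hs⟩ | ⟨s, hs⟩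
  · rw [← hs]; exact h s
  · rw [← hs]; exact h' s

/-! ### Compatibility on the skeleta of the decomposition. -/

namespace DyadicBox

open Set Filter Path

variable {O : Set (Fin 3 → ℝ)}

local notation "I" => unitInterval

variable {X : Type*} [TopologicalSpace X] {d : ℕ} {p : O} {x₀ : X}

/-- The union of the cells of dimension at most `d`. -/
abbrev Skel (O : Set (Fin 3 → ℝ)) (d : ℕ) : Type := {y : O // cell y ∈ skel O d}

/-- The inclusion of the `d`-skeleton. -/
def Skel.incl (O : Set (Fin 3 → ℝ)) (d : ℕ) : C(Skel O d, O) := ⟨Subtype.val, continuous_subtype_val⟩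

theorem skel_mono {d d' : ℕ} (h : d ≤ d') : skel O d ⊆ skel O d' := fun _ hj => ⟨hj.1, hj.2.trans h⟩

/-- The inclusion of the `d`-skeleton in the next one. -/
def Skel.succ (O : Set (Fin 3 → ℝ)) (d : ℕ) : C(Skel O d, Skel O (d + 1)) :=
  ⟨fun y => ⟨y.1, skel_mono (Nat.le_succ d) y.2⟩, continuous_subtype_val.subtype_mk _⟩

/-- The points of `ℝ³` in a closed box. -/
def boxSet (j : Idx) : Set (Fin 3 → ℝ) :=
  {v | ∀ i, (j.2.1 i : ℝ) ≤ 2 ^ j.1 * v i ∧ 2 ^ j.1 * v i ≤ j.2.2 i}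

theorem convex_boxSet (j : Idx) : Convex ℝ (boxSet j) := by
  intro u hu v hv a b ha hb hab i
  obtain ⟨h1, h2⟩ := hu i
  obtain ⟨h3, h4⟩ := hv i
  simp only [Pi.add_apply, Pi.smul_apply, smul_eq_mul]
  constructor
  · calc (j.2.1 i : ℝ) = a * j.2.1 i + b * j.2.1 i := by rw [← add_mul, hab, one_mul]
      _ ≤ a * (2 ^ j.1 * u i) + b * (2 ^ j.1 * v i) := by gcongr
      _ = _ := by ring
  · calc 2 ^ j.1 * (a * u i + b * v i) = a * (2 ^ j.1 * u i) + b * (2 ^ j.1 * v i) := by ring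
      _ ≤ a * j.2.2 i + b * j.2.2 i := by gcongr
      _ = _ := by rw [← add_mul, hab, one_mul]

theorem exists_skel_of_mem_boxSet (hO : IsOpen O) {j : Idx} (hj : j ∈ skel O d) {v : Fin 3 → ℝ}
    (hv : v ∈ boxSet j) : ∃ z : Skel O d, z.1.1 = v :=
  ⟨⟨⟨v, mem_of_mem_box hO hj.1 hv⟩, skel_closed hO d j hj _ hv⟩, rfl⟩

theorem isInducing_skel : IsInducing fun z : Skel O d => z.1.1 :=
  Topology.IsInducing.subtypeVal.comp Topology.IsInducing.subtypeVal

theorem injective_skel : Function.Injective fun z : Skel O d => z.1.1 :=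
  Subtype.val_injective.comp Subtype.val_injective

theorem homotopic_of_mem_box (hO : IsOpen O) {j : Idx} (hj : j ∈ skel O d) {x y : Skel O d}
    {α β : Path x y} (hα : ∀ t, (α t).1 ∈ box O j) (hβ : ∀ t, (β t).1 ∈ box O j) : α.Homotopic β :=
  Path.homotopic_of_starConvex isInducing_skel ((convex_boxSet j).starConvex (hα 0))
    (fun _ hv => exists_skel_of_mem_boxSet hO hj hv) injective_skel hα hβ

theorem exists_path_in_box (hO : IsOpen O) {j : Idx} (hj : j ∈ skel O d) {x y : Skel O d}
    (hx : x.1 ∈ box O j) (hy : y.1 ∈ box O j) : ∃ γ : Path x y, ∀ t, (γ t).1 ∈ box O j :=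
  exists_path_of_starConvex isInducing_skel ((convex_boxSet j).starConvex hx)
    (fun _ hv => exists_skel_of_mem_boxSet hO hj hv) injective_skel hx hy

/-- All paths in the `d`-skeleton are mapped as prescribed by `φ`. -/
def Realizes (φ : Homotopic.Quotient p p → Homotopic.Quotient x₀ x₀) (F : C(Skel O d, X))
    (τ : ∀ y, Homotopic.Quotient x₀ (F y)) (g : ∀ y : Skel O d, Homotopic.Quotient p y.1) : Prop :=
  ∀ (x y : Skel O d) (ω : Path x y), Compat φ (Skel.incl O d) F (τ x) (g x) (τ y) (g y) ω

variable {φ : Homotopic.Quotient p p → Homotopic.Quotient x₀ x₀}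

/-- In a neighbourhood of a point, paths are homotopic to paths through the point. -/
theorem exists_nhds_homotopic (hO : IsOpen O) (x : Skel O d) : ∃ N ∈ 𝓝 x, ∀ (y z : Skel O d)
    (ω : Path y z), range ω ⊆ N → ∃ (s : Path y x) (s' : Path z x),
      (∀ t, (s t).1 ∈ box O (cell y.1)) ∧ (∀ t, (s' t).1 ∈ box O (cell z.1)) ∧
      ω.Homotopic (s.trans s'.symm) := by
  have hev := (locallyFinite_box hO).eventually_subset (fun j => isClosed_box j.1) x.1
  rw [nhds_subtype_eq_comap] at hev
  obtain ⟨V, hV, hVx⟩ := mem_comap.1 hev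
  obtain ⟨ε, hε, hball⟩ := Metric.mem_nhds_iff.1 hV
  have hmem : ∀ y : O, y.1 ∈ Metric.ball x.1.1 ε → x.1 ∈ box O (cell y) := fun y hy => by
    have : {j : cells O | y ∈ box O j.1} ⊆ {j | x.1 ∈ box O j.1} :=
      hVx (show y ∈ Subtype.val ⁻¹' V from hball hy)
    exact this (a := ⟨cell y, ⟨y, rfl⟩⟩) (mem_box_cell y)
  -- In this ball every cell closure containing a point also contains `x`, so the segment from the
  -- point to `x` stays in one cell closure. The skeleton is therefore locally star-shaped about
  -- `x`.
  let K : Set (Fin 3 → ℝ) := {v | v ∈ Metric.ball x.1.1 ε ∧ ∃ z : Skel O d, z.1.1 = v}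
  have hKs : StarConvex ℝ x.1.1 K := by
    rw [starConvex_iff_segment_subset]
    rintro _ ⟨hv, z, rfl⟩ w hw
    refine ⟨(convex_ball _ _).segment_subset (Metric.mem_ball_self hε) hv hw, ?_⟩
    exact exists_skel_of_mem_boxSet hO z.2
      ((convex_boxSet _).segment_subset (hmem z.1 hv) (mem_box_cell z.1) hw)
  have hpath : ∀ y : Skel O d, y.1.1 ∈ Metric.ball x.1.1 ε → ∃ s : Path y x,
      ∀ t, (s t).1.1 ∈ boxSet (cell y.1) ∩ Metric.ball x.1.1 ε := fun y hy =>
    exists_path_of_starConvex (x := y) (y := x) isInducing_skel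
      (((convex_boxSet (cell y.1)).inter (convex_ball x.1.1 ε)).starConvex
        ⟨hmem y.1 hy, Metric.mem_ball_self hε⟩)
      (fun v hv => exists_skel_of_mem_boxSet hO y.2 hv.1) injective_skel ⟨mem_box_cell y.1, hy⟩
      ⟨hmem y.1 hy, Metric.mem_ball_self hε⟩
  have hN : {z : Skel O d | z.1.1 ∈ Metric.ball x.1.1 ε} ∈ 𝓝 x :=
    (isInducing_skel.continuous).continuousAt (Metric.ball_mem_nhds _ hε)
  refine ⟨_, hN, fun y z ω hω => ?_⟩
  have hω' : ∀ t, (ω t).1.1 ∈ Metric.ball x.1.1 ε := fun t => hω (mem_range_self t)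
  obtain ⟨s, hs⟩ := hpath y (by simpa using hω' 0)
  obtain ⟨s', hs'⟩ := hpath z (by simpa using hω' 1)
  refine ⟨s, s', fun t => (hs t).1, fun t => (hs' t).1, ?_⟩
  have h2 : ∀ t, ((s.trans s'.symm) t).1.1 ∈ Metric.ball x.1.1 ε :=
    Path.forall_mem_trans (P := fun z : Skel O d => z.1.1 ∈ Metric.ball x.1.1 ε)
      (fun t => (hs t).2) (fun t => (hs' (unitInterval.symm t)).2)
  exact Path.homotopic_of_starConvex isInducing_skel hKs (fun v hv => hv.2) injective_skel
    (fun t => ⟨hω' t, ⟨ω t, rfl⟩⟩) fun t => ⟨h2 t, ⟨_, rfl⟩⟩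

/-- If each path from a point to a point in the closure of its cell is compatible, then all
paths are. -/
theorem realizes_of_box (hO : IsOpen O) (hφ : ∀ a b, φ (a.trans b) = (φ a).trans (φ b))
    {F : C(Skel O d, X)} {τ : ∀ y, Homotopic.Quotient x₀ (F y)}
    {g : ∀ y : Skel O d, Homotopic.Quotient p y.1}
    (h : ∀ (x y : Skel O d) (s : Path y x), (∀ t, (s t).1 ∈ box O (cell y.1)) →
      Compat φ (Skel.incl O d) F (τ y) (g y) (τ x) (g x) s) : Realizes φ F τ g := by
  intro x y ω
  refine Path.forall_of_local (fun {x y} ω => Compat φ (Skel.incl O d) F (τ x) (g x) (τ y) (g y) ω)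
    (fun _ _ h h' => h.trans hφ h') (fun _ _ hh h => h.of_homotopic hh) (fun x => ?_) ω
  obtain ⟨N, hN, hNx⟩ := exists_nhds_homotopic hO x
  refine ⟨N, hN, fun {y z} ω hω => ?_⟩
  obtain ⟨s, s', hs, hs', hh⟩ := hNx y z ω hω
  exact ((h _ _ s hs).trans hφ ((h _ _ s' hs').symm hφ)).of_homotopic hh.symm

/-- The connections with the base points extend over the next skeleton. -/
theorem Realizes.succ (hO : IsOpen O) (hφ : ∀ a b, φ (a.trans b) = (φ a).trans (φ b))
    {F : C(Skel O (d + 1), X)} {τ : ∀ y : Skel O d, Homotopic.Quotient x₀ (F (Skel.succ O d y))}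
    {g : ∀ y : Skel O d, Homotopic.Quotient p y.1}
    (h : Realizes φ (F.comp (Skel.succ O d)) τ g)
    (hC : ∀ j ∈ cells O, (free j).card = d + 1 → ∀ b b' : Skel O d, b.1 ∈ box O j → b'.1 ∈ box O j →
      ∃ β : Path (Skel.succ O d b) (Skel.succ O d b'), (∀ t, (β t).1 ∈ box O j) ∧
        Compat φ (Skel.incl O (d + 1)) F (τ b) (g b) (τ b') (g b') β) :
    ∃ (τ' : ∀ y, Homotopic.Quotient x₀ (F y)) (g' : ∀ y : Skel O (d + 1), Homotopic.Quotient p y.1),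
      Realizes φ F τ' g' ∧ ∀ y : Skel O d, τ' (Skel.succ O d y) = τ y ∧ g' (Skel.succ O d y) = g y := by
  have hex : ∀ y : Skel O (d + 1), ∃ (τy : Homotopic.Quotient x₀ (F y)) (gy : Homotopic.Quotient p y.1),
      (∃ (b : Skel O d) (κ : Path (Skel.succ O d b) y), (∀ t, (κ t).1 ∈ box O (cell y.1)) ∧
        τy = (τ b).trans (Homotopic.Quotient.mk (κ.map F.continuous)) ∧
        gy = (g b).trans (Homotopic.Quotient.mk (κ.map (Skel.incl O (d + 1)).continuous))) ∧
      ∀ hy : cell y.1 ∈ skel O d, τy = τ ⟨y.1, hy⟩ ∧ gy = g ⟨y.1, hy⟩ := by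
    intro y
    by_cases hy : cell y.1 ∈ skel O d
    · refine ⟨τ ⟨y.1, hy⟩, g ⟨y.1, hy⟩, ⟨⟨y.1, hy⟩, Path.refl y, fun _ => mem_box_cell y.1, ?_, ?_⟩,
        fun _ => ⟨rfl, rfl⟩⟩
      · exact (Homotopic.Quotient.trans_refl _).symm
      · exact (Homotopic.Quotient.trans_refl _).symm
    · have hcard : (free (cell y.1)).card = d + 1 := by
        have h1 := y.2.2
        have h2 : ¬ (free (cell y.1)).card ≤ d := fun h2 => hy ⟨y.2.1, h2⟩
        omega
      obtain ⟨i, hi⟩ := Finset.card_pos.1 (by omega : 0 < (free (cell y.1)).card)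
      have hb := cell_point_ne hO y.2.1 (s := fun _ => 0) hi (Or.inl rfl)
      have hb2 := point_mem_box hO y.2.1 fun _ => 0
      have hb3 := card_free_lt hO y.2.1 hb2 hb
      -- A new point inherits its connections from a corner of its cell, along a path inside the
      -- closed cell.
      let b : Skel O d := ⟨point hO y.2.1 fun _ => 0, ⟨_, rfl⟩, by omega⟩
      obtain ⟨κ, hκ⟩ := exists_path_in_box hO y.2 (x := Skel.succ O d b) (y := y) hb2 (mem_box_cell y.1)
      exact ⟨_, _, ⟨b, κ, hκ, rfl, rfl⟩, fun hy' => absurd hy' hy⟩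
  choose τ' g' hb hold using hex
  refine ⟨τ', g', realizes_of_box hO hφ fun x y s hs => ?_, fun y => hold (Skel.succ O d y) y.2⟩
  obtain ⟨b, κ, hκ, hτ, hg⟩ := hb y
  obtain ⟨b', κ', hκ', hτ', hg'⟩ := hb x
  rw [hτ, hτ', hg, hg']
  refine Compat.of_conj ?_
  have hx : x.1 ∈ box O (cell y.1) := by simpa using hs 1
  have hκ'' : ∀ t, (κ' t).1 ∈ box O (cell y.1) := fun t => box_subset_box hO hx (hκ' t)
  have hin : ∀ t, (((κ.trans s).trans κ'.symm) t).1 ∈ box O (cell y.1) := fun t =>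
    Path.forall_mem_trans (P := fun z : Skel O (d + 1) => z.1 ∈ box O (cell y.1))
      (Path.forall_mem_trans (P := fun z : Skel O (d + 1) => z.1 ∈ box O (cell y.1)) hκ hs)
      (fun t => hκ'' (unitInterval.symm t)) t
  have hbj : b.1 ∈ box O (cell y.1) := by have := hκ 0; rw [κ.source] at this; exact this
  have hbj' : b'.1 ∈ box O (cell y.1) := by have := hκ'' 0; rw [κ'.source] at this; exact this
  by_cases hy : cell y.1 ∈ skel O d
  · obtain ⟨β, hβ⟩ := exists_path_in_box hO hy hbj hbj'
    have h1 : Compat φ (Skel.incl O (d + 1)) F (τ b) (g b) (τ b') (g b')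
      (β.map (Skel.succ O d).continuous) := h b b' β
    -- Closed cells are convex, so the conjugated path may be exchanged for any other path in the
    -- closed cell with the same ends. Here it is one in the old skeleton, and below it is the one
    -- supplied by `hC`.
    exact h1.of_homotopic (homotopic_of_mem_box hO y.2 (fun t => hβ t) hin)
  · have hcard : (free (cell y.1)).card = d + 1 := by
      have h1 := y.2.2
      have h2 : ¬ (free (cell y.1)).card ≤ d := fun h2 => hy ⟨y.2.1, h2⟩
      omega
    obtain ⟨β, hβ, hβc⟩ := hC _ y.2.1 hcard b b' hbj hbj'
    exact hβc.of_homotopic (homotopic_of_mem_box hO y.2 hβ hin)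

end DyadicBox


/-! ### Extending maps and their compatibility over the next skeleton. -/

namespace DyadicBox

open Set Filter Path

variable {O : Set (Fin 3 → ℝ)}

local notation "I" => unitInterval

variable {X : Type*} [TopologicalSpace X] {d : ℕ} {p : O} {x₀ : X}
  {φ : Homotopic.Quotient p p → Homotopic.Quotient x₀ x₀}

/-- Extension of a map over the cells of dimension `d + 1`. -/
theorem exists_extension_skel (hO : IsOpen O) (F : C(Skel O d, X)) {G : Idx → O → X}
    (hG : ∀ j ∈ cells O, (free j).card = d + 1 → Continuous (G j))
    (hGF : ∀ j ∈ cells O, (free j).card = d + 1 → ∀ y : Skel O d, y.1 ∈ box O j → G j y.1 = F y) :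
    ∃ F' : C(Skel O (d + 1), X), F'.comp (Skel.succ O d) = F ∧
      ∀ y : Skel O (d + 1), (free (cell y.1)).card = d + 1 → F' y = G (cell y.1) y.1 := by
  classical
  let F' : Skel O (d + 1) → X := fun y =>
    if h : cell y.1 ∈ skel O d then F ⟨y.1, h⟩ else G (cell y.1) y.1
  have hF'1 : ∀ (y : Skel O (d + 1)) (h : cell y.1 ∈ skel O d), F' y = F ⟨y.1, h⟩ := fun y h => dif_pos h
  have hF'2 : ∀ (y : Skel O (d + 1)) (_ : cell y.1 ∉ skel O d), F' y = G (cell y.1) y.1 :=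
    fun y h => dif_neg h
  have hcard : ∀ y : Skel O (d + 1), cell y.1 ∉ skel O d ↔ (free (cell y.1)).card = d + 1 := by
    intro y
    have h1 := y.2.2
    constructor
    · intro hy
      have h2 : ¬ (free (cell y.1)).card ≤ d := fun h2 => hy ⟨y.2.1, h2⟩
      omega
    · intro h2 hy
      have := hy.2
      omega
  have hcont : Continuous F' := by
    refine LocallyFinite.continuous (f := fun j : skel O (d + 1) =>
      (Subtype.val ⁻¹' box O j.1 : Set (Skel O (d + 1)))) ?_ ?_ ?_ ?_
    · exact (locallyFinite_box_of_subset hO fun j hj => hj.1).preimage_continuous continuous_subtype_val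
    · exact eq_univ_of_forall fun y => mem_iUnion.2 ⟨⟨_, y.2⟩, mem_box_cell y.1⟩
    · exact fun j => (isClosed_box _).preimage continuous_subtype_val
    · rintro ⟨j, hj⟩
      by_cases hjd : j ∈ skel O d
      · have hmem : ∀ y : (Subtype.val ⁻¹' box O j : Set (Skel O (d + 1))), cell y.1.1 ∈ skel O d :=
          fun y => skel_closed hO d j hjd _ y.2
        rw [continuousOn_iff_continuous_domRestrict]
        exact (F.continuous.comp ((continuous_subtype_val.comp continuous_subtype_val).subtype_mk
          hmem)).congr fun y => (hF'1 _ (hmem y)).symm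
      · have hjc : (free j).card = d + 1 := by
          have h1 := hj.2
          have h2 : ¬ (free j).card ≤ d := fun h2 => hjd ⟨hj.1, h2⟩
          omega
        refine ((hG j hj.1 hjc).comp continuous_subtype_val).continuousOn.congr fun y hy => ?_
        by_cases hyd : cell y.1 ∈ skel O d
        · rw [hF'1 y hyd]
          exact (hGF j hj.1 hjc ⟨y.1, hyd⟩ hy).symm
        · have he : cell y.1 = j := by
            by_contra hne
            have := card_free_lt hO hj.1 hy hne
            exact hyd ⟨y.2.1, by omega⟩
          rw [hF'2 y hyd, he]; rfl
  exact ⟨⟨F', hcont⟩, ContinuousMap.ext fun y => hF'1 (Skel.succ O d y) y.2,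
    fun y hy => hF'2 y ((hcard y).2 hy)⟩

theorem coord_point (hO : IsOpen O) {j : Idx} (hj : j ∈ cells O) (s : Fin 3 → I) {k : Fin 3}
    (hk : k ∈ free j) : coord j k (point hO hj s) = s k := by
  refine Subtype.ext ?_
  have hu : (j.2.2 k : ℝ) = j.2.1 k + 1 := by exact_mod_cast upper_eq_of_mem_free hj hk
  rw [coe_coord hj (point_mem_box hO hj s), mul_point_apply, hu]
  ring

theorem point_mem_skel (hO : IsOpen O) {j : Idx} (hj : j ∈ cells O) (hc : (free j).card = d + 1)
    {s : Fin 3 → I} {k : Fin 3} (hk : k ∈ free j) (h : s k = 0 ∨ s k = 1) :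
    cell (point hO hj s) ∈ skel O d := by
  have := card_free_lt hO hj (point_mem_box hO hj s) (cell_point_ne hO hj hk h)
  exact ⟨⟨_, rfl⟩, by omega⟩

theorem exists_coord_of_mem_skel (hO : IsOpen O) {j : Idx} (hj : j ∈ cells O)
    (hc : (free j).card = d + 1) (b : Skel O d) (hb : b.1 ∈ box O j) :
    ∃ k ∈ free j, coord j k b.1 = 0 ∨ coord j k b.1 = 1 := by
  by_contra hcon
  push Not at hcon
  have h1 := cell_eq_of_coord hO hj hb hcon
  have h2 := b.2.2
  rw [h1] at h2
  omega

/-- The boundary of a cell of dimension at least two is connected. -/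
theorem exists_path_in_boundary (hO : IsOpen O) {j : Idx} (hj : j ∈ cells O)
    (hc : (free j).card = d + 1) (hd : d ≠ 0) {b b' : Skel O d} (hb : b.1 ∈ box O j)
    (hb' : b'.1 ∈ box O j) : ∃ γ : Path b b', ∀ t, (γ t).1 ∈ box O j := by
  obtain ⟨k₀, hk₀⟩ := Finset.card_pos.1 (by omega : 0 < (free j).card)
  let c : Skel O d := ⟨point hO hj fun _ => 0, point_mem_skel hO hj hc hk₀ (Or.inl rfl)⟩
  have key : ∀ b : Skel O d, b.1 ∈ box O j → ∃ γ : Path b c, ∀ t, (γ t).1 ∈ box O j := by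
    intro b hb
    obtain ⟨k, hk, hk01⟩ := exists_coord_of_mem_skel hO hj hc b hb
    obtain ⟨m, hm, hmk⟩ := Finset.exists_mem_ne (by omega : 1 < (free j).card) k
    let s : Fin 3 → I := fun i => coord j i b.1
    -- First all coordinates but the one that keeps `b` on a face are shrunk to `0`. Then some other
    -- free coordinate `m` is `0`, so the point stays on the boundary while `w` shrinks the
    -- coordinate `k`. This needs two free directions.
    let v : I → Fin 3 → I := fun t i => if i = k then s k else unitInterval.symm t * s i
    let w : I → Fin 3 → I := fun t i => if i = k then unitInterval.symm t * s k else 0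
    have hv : Continuous v := by
      refine continuous_pi fun i => ?_
      by_cases hi : i = k
      · simp only [v, hi, if_true]; exact continuous_const
      · simp only [v, hi, if_false]; exact unitInterval.continuous_symm.mul continuous_const
    have hw : Continuous w := by
      refine continuous_pi fun i => ?_
      by_cases hi : i = k
      · simp only [w, hi, if_true]; exact unitInterval.continuous_symm.mul continuous_const
      · simp only [w, hi, if_false]; exact continuous_const
    have hvs : ∀ t, cell (point hO hj (v t)) ∈ skel O d := fun t =>
      point_mem_skel hO hj hc hk (by simpa [v] using hk01)
    have hws : ∀ t, cell (point hO hj (w t)) ∈ skel O d := fun t =>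
      point_mem_skel hO hj hc hm (by simp [w, hmk])
    have hvw : v 1 = w 0 := by
      funext i
      by_cases hi : i = k <;> simp [v, w, hi]
    have hv0 : v 0 = s := by
      funext i
      by_cases hi : i = k <;> simp [v, hi]
    have hw1 : w 1 = fun _ => 0 := by
      funext i
      by_cases hi : i = k <;> simp [w, hi]
    let α : Path b ⟨point hO hj (v 1), hvs 1⟩ :=
      { toFun := fun t => ⟨point hO hj (v t), hvs t⟩
        continuous_toFun := ((continuous_point hO hj).comp hv).subtype_mk _
        source' := Subtype.ext (by
          change point hO hj (v 0) = b.1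
          rw [hv0]
          exact point_coord hO hj hb fun _ _ => rfl)
        target' := rfl }
    let β : Path (⟨point hO hj (v 1), hvs 1⟩ : Skel O d) c :=
      { toFun := fun t => ⟨point hO hj (w t), hws t⟩
        continuous_toFun := ((continuous_point hO hj).comp hw).subtype_mk _
        source' := Subtype.ext (by
          change point hO hj (w 0) = point hO hj (v 1)
          rw [hvw])
        target' := Subtype.ext (by
          change point hO hj (w 1) = point hO hj fun _ => 0
          rw [hw1]) }
    exact ⟨α.trans β, Path.forall_mem_trans (P := fun z : Skel O d => z.1 ∈ box O j)
      (fun t => point_mem_box hO hj _) fun t => point_mem_box hO hj _⟩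
  obtain ⟨γ, hγ⟩ := key b hb
  obtain ⟨γ', hγ'⟩ := key b' hb'
  exact ⟨γ.trans γ'.symm, Path.forall_mem_trans (P := fun z : Skel O d => z.1 ∈ box O j) hγ
    fun t => hγ' (unitInterval.symm t)⟩

/-- The map `F'` with its connections extends the map `F` with its connections. -/
def Extends (F : C(Skel O d, X)) (τ : ∀ y, Homotopic.Quotient x₀ (F y))
    (g : ∀ y : Skel O d, Homotopic.Quotient p y.1) (F' : C(Skel O (d + 1), X))
    (τ' : ∀ y, Homotopic.Quotient x₀ (F' y)) (g' : ∀ y : Skel O (d + 1), Homotopic.Quotient p y.1) :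
    Prop :=
  ∀ y : Skel O d, g' (Skel.succ O d y) = g y ∧ ∀ c : Path x₀ (F y), τ y = Homotopic.Quotient.mk c →
    ∃ c' : Path x₀ (F' (Skel.succ O d y)), (∀ t, c' t = c t) ∧
      τ' (Skel.succ O d y) = Homotopic.Quotient.mk c'

/-- Extension over a skeleton of dimension at least two. -/
theorem Realizes.exists_succ (hO : IsOpen O) (hφ : ∀ a b, φ (a.trans b) = (φ a).trans (φ b))
    (hd : d ≠ 0) {F : C(Skel O d, X)} {τ : ∀ y : Skel O d, Homotopic.Quotient x₀ (F y)}
    {g : ∀ y : Skel O d, Homotopic.Quotient p y.1} (h : Realizes φ F τ g)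
    (hG : ∀ j ∈ cells O, (free j).card = d + 1 → ∃ G : O → X, Continuous G ∧
      ∀ y : Skel O d, y.1 ∈ box O j → G y.1 = F y) :
    ∃ (F' : C(Skel O (d + 1), X)) (τ' : ∀ y, Homotopic.Quotient x₀ (F' y))
      (g' : ∀ y : Skel O (d + 1), Homotopic.Quotient p y.1),
      Realizes φ F' τ' g' ∧ Extends F τ g F' τ' g' := by
  classical
  choose G hGc hGF using hG
  obtain ⟨F', hF', -⟩ := exists_extension_skel hO F
    (G := fun j => if h : j ∈ cells O ∧ (free j).card = d + 1 then G j h.1 h.2 else fun _ => x₀)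
    (fun j hj hc => by rw [dif_pos ⟨hj, hc⟩]; exact hGc j hj hc)
    (fun j hj hc y hy => by rw [dif_pos ⟨hj, hc⟩]; exact hGF j hj hc y hy)
  subst hF'
  obtain ⟨τ', g', h1, h2⟩ := h.succ hO hφ fun j hj hc b b' hb hb' => by
    obtain ⟨β, hβ⟩ := exists_path_in_boundary hO hj hc hd hb hb'
    exact ⟨β.map (Skel.succ O d).continuous, hβ, h b b' β⟩
  exact ⟨F', τ', g', h1, fun y => ⟨(h2 y).2, fun c hc => ⟨c, fun _ => rfl, (h2 y).1.trans hc⟩⟩⟩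

end DyadicBox


/-! ### Realizing a homomorphism on fundamental groups by a map. -/

namespace DyadicBox

open Set Filter Path

variable {O : Set (Fin 3 → ℝ)}

local notation "I" => unitInterval

variable {X : Type*} [TopologicalSpace X] {d : ℕ} {p : O} {x₀ : X}
  {φ : Homotopic.Quotient p p → Homotopic.Quotient x₀ x₀}

theorem eq_of_mem_box_of_card_zero (hO : IsOpen O) {x y : O} (hx : x ∈ box O (cell y))
    (h : (free (cell y)).card = 0) : x = y := by
  have h0 : free (cell y) = ∅ := Finset.card_eq_zero.1 h
  rw [← point_coord hO ⟨y, rfl⟩ hx (s := fun _ => 0) (by simp [h0])]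
  exact point_coord hO ⟨y, rfl⟩ (mem_box_cell y) (by simp [h0])

/-- The constant map on the vertices. -/
theorem realizes_vertices (hO : IsOpen O) (hφ : ∀ a b, φ (a.trans b) = (φ a).trans (φ b))
    (g : ∀ y : Skel O 0, Homotopic.Quotient p y.1) :
    Realizes φ (ContinuousMap.const (Skel O 0) x₀) (fun _ => Homotopic.Quotient.refl x₀) g := by
  refine realizes_of_box hO hφ fun x y s hs => ?_
  have hxy : x = y := Subtype.ext (eq_of_mem_box_of_card_zero hO (by simpa using hs 1)
    (Nat.le_zero.1 y.2.2))
  subst hxy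
  exact (Compat.refl hφ _ _).of_homotopic (homotopic_of_mem_box hO x.2 (fun _ => mem_box_cell x.1) hs)

/-- The boundary map of a square extends over the square. -/
theorem Realizes.exists_square (hO : IsOpen O) {F : C(Skel O 1, X)}
    {τ : ∀ y : Skel O 1, Homotopic.Quotient x₀ (F y)} {g : ∀ y : Skel O 1, Homotopic.Quotient p y.1}
    (h : Realizes φ F τ g) {j : Idx} (hj : j ∈ cells O) (hcard : (free j).card = 2) :
    ∃ G : O → X, Continuous G ∧ ∀ y : Skel O 1, y.1 ∈ box O j → G y.1 = F y := by
  obtain ⟨i₁, i₂, hne, hi⟩ := Finset.card_eq_two.1 hcard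
  let v : I → I → Fin 3 → I := fun s t k => if k = i₁ then s else t
  have hv : Continuous fun q : I × I => v q.1 q.2 := by
    refine continuous_pi fun k => ?_
    by_cases hk : k = i₁
    · simp only [v, hk, if_true]; exact continuous_fst
    · simp only [v, hk, if_false]; exact continuous_snd
  have hv1 : ∀ s t, (s = 0 ∨ s = 1) → cell (point hO hj (v s t)) ∈ skel O 1 := fun s t hs =>
    point_mem_skel hO hj hcard (k := i₁) (by simp [hi]) (by simpa [v] using hs)
  have hv2 : ∀ s t, (t = 0 ∨ t = 1) → cell (point hO hj (v s t)) ∈ skel O 1 := fun s t ht =>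
    point_mem_skel hO hj hcard (k := i₂) (by simp [hi]) (by simpa [v, hne.symm] using ht)
  have hpt : Continuous fun q : I × I => point hO hj (v q.1 q.2) := (continuous_point hO hj).comp hv
  let row : ∀ (t : I) (ht : t = 0 ∨ t = 1), Path (⟨point hO hj (v 0 t), hv2 0 t ht⟩ : Skel O 1)
      ⟨point hO hj (v 1 t), hv2 1 t ht⟩ := fun t ht =>
    { toFun := fun s => ⟨point hO hj (v s t), hv2 s t ht⟩
      continuous_toFun := (hpt.comp (continuous_id.prodMk continuous_const)).subtype_mk _
      source' := rfl
      target' := rfl }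
  let col : ∀ (s : I) (hs : s = 0 ∨ s = 1), Path (⟨point hO hj (v s 0), hv1 s 0 hs⟩ : Skel O 1)
      ⟨point hO hj (v s 1), hv1 s 1 hs⟩ := fun s hs =>
    { toFun := fun t => ⟨point hO hj (v s t), hv1 s t hs⟩
      continuous_toFun := (hpt.comp (continuous_const.prodMk continuous_id)).subtype_mk _
      source' := rfl
      target' := rfl }
  have hbox : ∀ q : Skel O 1, (∃ s, q.1 = point hO hj s) → q.1 ∈ box O j := by
    rintro q ⟨s, hs⟩; rw [hs]; exact point_mem_box hO hj s
  let ω := (row 0 (Or.inl rfl)).trans (col 1 (Or.inr rfl))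
  let ω' := (col 0 (Or.inl rfl)).trans (row 1 (Or.inr rfl))
  have hω : ∀ t, (ω t).1 ∈ box O j := Path.forall_mem_trans (P := fun q : Skel O 1 => q.1 ∈ box O j)
    (fun t => point_mem_box hO hj _) fun t => point_mem_box hO hj _
  have hω' : ∀ t, (ω' t).1 ∈ box O j := Path.forall_mem_trans (P := fun q : Skel O 1 => q.1 ∈ box O j)
    (fun t => point_mem_box hO hj _) fun t => point_mem_box hO hj _
  -- The two halves of the boundary are homotopic in `O` through the convex square. Compatibility
  -- turns this into a homotopy of their images, which fills the square in `X`.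
  have hhom : (ω.map (Skel.incl O 1).continuous).Homotopic (ω'.map (Skel.incl O 1).continuous) :=
    Path.homotopic_of_starConvex Topology.IsInducing.subtypeVal
      ((convex_boxSet j).starConvex (hω 0)) (fun v hv => ⟨⟨v, mem_of_mem_box hO hj hv⟩, rfl⟩)
      Subtype.val_injective hω hω'
  have hF := (h _ _ ω).homotopic_map (h _ _ ω') hhom
  rw [Path.map_trans, Path.map_trans] at hF
  obtain ⟨K, hK0, hK1, hKl, hKr⟩ := exists_square_of_homotopic _ _ _ _ hF
  refine ⟨fun y => K (coord j i₁ y, coord j i₂ y), K.continuous.comp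
    ((continuous_coord j i₁).prodMk (continuous_coord j i₂)), fun y hy => ?_⟩
  have hpy : ∀ s t, coord j i₁ y.1 = s → coord j i₂ y.1 = t → point hO hj (v s t) = y.1 :=
    fun s t hs ht => point_coord hO hj hy (by simp [hi, v, hs, ht, hne.symm])
  obtain ⟨k, hk, hk01⟩ := exists_coord_of_mem_skel hO hj hcard y hy
  have hk' : k = i₁ ∨ k = i₂ := by simpa [hi] using hk
  beta_reduce
  rcases hk' with rfl | rfl <;> rcases hk01 with h0 | h0
  · rw [h0, hKl]
    exact congrArg F (Subtype.ext (hpy _ _ h0 rfl))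
  · rw [h0, hKr]
    exact congrArg F (Subtype.ext (hpy _ _ h0 rfl))
  · rw [h0, hK0]
    exact congrArg F (Subtype.ext (hpy _ _ rfl h0))
  · rw [h0, hK1]
    exact congrArg F (Subtype.ext (hpy _ _ rfl h0))

/-- The boundary map of a cube extends over the cube if `π₂` vanishes. -/
theorem exists_extension_cube (hO : IsOpen O) (hpi : Subsingleton (π_ 2 X x₀)) {F : C(Skel O 2, X)}
    (hF : ∀ y, Joined (F y) x₀) {j : Idx} (hj : j ∈ cells O) (hcard : (free j).card = 3) :
    ∃ G : O → X, Continuous G ∧ ∀ y : Skel O 2, y.1 ∈ box O j → G y.1 = F y := by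
  classical
  have hfree : ∀ k, k ∈ free j := fun k => by
    rw [(Finset.card_eq_iff_eq_univ _).1 (hcard.trans (Fintype.card_fin 3).symm)]
    exact Finset.mem_univ k
  let v : I × I × I → Fin 3 → I := fun q => ![q.1, q.2.1, q.2.2]
  have hv : Continuous v := by
    refine continuous_pi fun k => ?_
    fin_cases k
    · exact continuous_fst
    · exact continuous_fst.comp continuous_snd
    · exact continuous_snd.comp continuous_snd
  have hvs : ∀ q ∈ tripleBoundary, cell (point hO hj (v q)) ∈ skel O 2 := by
    rintro q (hq | hq | hq)
    · exact point_mem_skel hO hj hcard (hfree 0) hq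
    · exact point_mem_skel hO hj hcard (hfree 1) hq
    · exact point_mem_skel hO hj hcard (hfree 2) hq
  let u : I × I × I → X := fun q =>
    if hq : cell (point hO hj (v q)) ∈ skel O 2 then F ⟨_, hq⟩ else x₀
  have hu1 : ∀ q (hq : q ∈ tripleBoundary), u q = F ⟨_, hvs q hq⟩ := fun q hq => dif_pos (hvs q hq)
  have hu : ContinuousOn u tripleBoundary := by
    rw [continuousOn_iff_continuous_domRestrict]
    exact (F.continuous.comp ((((continuous_point hO hj).comp hv).comp
      continuous_subtype_val).subtype_mk fun q : tripleBoundary => hvs q.1 q.2)).congr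
        fun q => (hu1 q.1 q.2).symm
  obtain ⟨U, hU⟩ := exists_extension_of_subsingleton_pi_two hpi hu fun q hq => by
    rw [hu1 q hq]; exact hF _
  refine ⟨fun y => U (coord j 0 y, coord j 1 y, coord j 2 y), U.continuous.comp
    ((continuous_coord j 0).prodMk ((continuous_coord j 1).prodMk (continuous_coord j 2))),
    fun y hy => ?_⟩
  have hpy : point hO hj (v (coord j 0 y.1, coord j 1 y.1, coord j 2 y.1)) = y.1 :=
    point_coord hO hj hy fun k _ => by fin_cases k <;> rfl
  have hmem : (coord j 0 y.1, coord j 1 y.1, coord j 2 y.1) ∈ tripleBoundary := by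
    obtain ⟨k, -, hk⟩ := exists_coord_of_mem_skel hO hj hcard y hy
    fin_cases k
    · exact Or.inl hk
    · exact Or.inr (Or.inl hk)
    · exact Or.inr (Or.inr hk)
  exact (hU hmem).trans ((hu1 _ hmem).trans (congrArg F (Subtype.ext hpy)))

/-- Extension from the vertices to the edges. -/
theorem Realizes.exists_edges (hO : IsOpen O) (hφ : ∀ a b, φ (a.trans b) = (φ a).trans (φ b))
    {F : C(Skel O 0, X)} {τ : ∀ y : Skel O 0, Homotopic.Quotient x₀ (F y)}
    {g : ∀ y : Skel O 0, Homotopic.Quotient p y.1} (h : Realizes φ F τ g) :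
    ∃ (F' : C(Skel O 1, X)) (τ' : ∀ y, Homotopic.Quotient x₀ (F' y))
      (g' : ∀ y : Skel O 1, Homotopic.Quotient p y.1),
      Realizes φ F' τ' g' ∧ Extends F τ g F' τ' g' := by
  classical
  have hends : ∀ j (hj : j ∈ cells O) (hc : (free j).card = 0 + 1) (s : I), (s = 0 ∨ s = 1) →
      cell (point hO hj fun _ => s) ∈ skel O 0 := by
    intro j hj hc s hs
    obtain ⟨k, hk⟩ := Finset.card_pos.1 (by omega : 0 < (free j).card)
    exact point_mem_skel hO hj hc hk hs
  let a : ∀ j (hj : j ∈ cells O) (hc : (free j).card = 0 + 1), Skel O 0 := fun j hj hc =>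
    ⟨point hO hj fun _ => 0, hends j hj hc 0 (Or.inl rfl)⟩
  let b : ∀ j (hj : j ∈ cells O) (hc : (free j).card = 0 + 1), Skel O 0 := fun j hj hc =>
    ⟨point hO hj fun _ => 1, hends j hj hc 1 (Or.inr rfl)⟩
  -- The path class on an edge is obtained by solving the compatibility equation for the image of
  -- the edge.
  have hP : ∀ j (hj : j ∈ cells O) (hc : (free j).card = 0 + 1),
      ∃ P : Path (F (a j hj hc)) (F (b j hj hc)), Homotopic.Quotient.mk P =
        (τ (a j hj hc)).symm.trans ((φ (((g (a j hj hc)).trans (Homotopic.Quotient.mk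
          (edgePath hO hj))).trans (g (b j hj hc)).symm)).trans (τ (b j hj hc))) := by
    intro j hj hc
    generalize (τ (a j hj hc)).symm.trans ((φ (((g (a j hj hc)).trans (Homotopic.Quotient.mk
          (edgePath hO hj))).trans (g (b j hj hc)).symm)).trans (τ (b j hj hc))) = q
    induction q using Path.Homotopic.Quotient.ind with | _ q => exact ⟨q, rfl⟩
  choose P hP using hP
  have hdir : ∀ j (_ : j ∈ cells O) (_ : (free j).card = 0 + 1), ∃ i, free j = {i} := fun j _ hc =>
    Finset.card_eq_one.1 hc
  choose i hi using hdir
  have hab : ∀ j (hj : j ∈ cells O) (hc : (free j).card = 0 + 1) (y : Skel O 0), y.1 ∈ box O j →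
      (y = a j hj hc ∧ coord j (i j hj hc) y.1 = 0) ∨ (y = b j hj hc ∧ coord j (i j hj hc) y.1 = 1) := by
    intro j hj hc y hy
    obtain ⟨k, hk, hk01⟩ := exists_coord_of_mem_skel hO hj hc y hy
    have hk' : k = i j hj hc := by simpa [hi j hj hc] using hk
    subst hk'
    rcases hk01 with h0 | h0
    · exact Or.inl ⟨Subtype.ext (point_coord hO hj hy (by simp [hi j hj hc, h0])).symm, h0⟩
    · exact Or.inr ⟨Subtype.ext (point_coord hO hj hy (by simp [hi j hj hc, h0])).symm, h0⟩
  obtain ⟨F', hF', hF'G⟩ := exists_extension_skel hO F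
    (G := fun j => if h : j ∈ cells O ∧ (free j).card = 0 + 1 then
      fun y => P j h.1 h.2 (coord j (i j h.1 h.2) y) else fun _ => x₀)
    (fun j hj hc => by
      rw [dif_pos ⟨hj, hc⟩]
      exact (P j hj hc).continuous.comp (continuous_coord _ _))
    (fun j hj hc y hy => by
      rw [dif_pos ⟨hj, hc⟩]
      rcases hab j hj hc y hy with ⟨h1, h2⟩ | ⟨h1, h2⟩
      · rw [h2, Path.source, h1]
      · rw [h2, Path.target, h1])
  subst hF'
  obtain ⟨τ', g', h1, h2⟩ := h.succ hO hφ fun j hj hc y y' hy hy' => by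
    have hjs : j ∈ skel O (0 + 1) := ⟨hj, hc.le⟩
    let β : Path (Skel.succ O 0 (a j hj hc)) (Skel.succ O 0 (b j hj hc)) :=
      { toFun := fun t => ⟨point hO hj fun _ => t, skel_closed hO _ j hjs _ (point_mem_box hO hj _)⟩
        continuous_toFun := (edgePath hO hj).continuous.subtype_mk _
        source' := rfl
        target' := rfl }
    have hβbox : ∀ t, (β t).1 ∈ box O j := fun t => point_mem_box hO hj _
    have hβP : β.map F'.continuous = P j hj hc := by
      ext t
      change F' (β t) = P j hj hc t
      by_cases ht : cell (β t).1 = j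
      · have hcell : (free (cell (β t).1)).card = 0 + 1 := by rw [ht]; exact hc
        rw [hF'G (β t) hcell, ht, dif_pos ⟨hj, hc⟩]
        congr 1
        exact coord_point hO hj (fun _ => t) (by simp [hi j hj hc])
      · have hsk : cell (β t).1 ∈ skel O 0 := ⟨⟨_, rfl⟩, by
          have := card_free_lt hO hj (hβbox t) ht
          omega⟩
        have hct : coord j (i j hj hc) (β t).1 = t := coord_point hO hj (fun _ => t) (by simp [hi j hj hc])
        rcases hab j hj hc ⟨(β t).1, hsk⟩ (hβbox t) with ⟨h1, h2⟩ | ⟨h1, h2⟩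
        · have ht0 : t = 0 := hct.symm.trans h2
          subst ht0
          rw [β.source, Path.source]; rfl
        · have ht0 : t = 1 := hct.symm.trans h2
          subst ht0
          rw [β.target, Path.target]; rfl
    have hβc : Compat φ (Skel.incl O (0 + 1)) F' (τ (a j hj hc)) (g (a j hj hc)) (τ (b j hj hc))
        (g (b j hj hc)) β := by
      refine (congrArg (fun q => (τ (a j hj hc)).trans (Homotopic.Quotient.mk q)) hβP).trans ?_
      refine (congrArg (fun q => (τ (a j hj hc)).trans q) (hP j hj hc)).trans ?_
      rw [← Homotopic.Quotient.trans_assoc, Homotopic.Quotient.trans_symm,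
        Homotopic.Quotient.refl_trans]
      rfl
    rcases hab j hj hc y hy with ⟨rfl, -⟩ | ⟨rfl, -⟩ <;>
      rcases hab j hj hc y' hy' with ⟨rfl, -⟩ | ⟨rfl, -⟩
    · exact ⟨Path.refl _, fun _ => hy, Compat.refl hφ _ _⟩
    · exact ⟨β, hβbox, hβc⟩
    · exact ⟨β.symm, fun t => hβbox (unitInterval.symm t), hβc.symm hφ⟩
    · exact ⟨Path.refl _, fun _ => hy, Compat.refl hφ _ _⟩
  exact ⟨F', τ', g', h1, fun y => ⟨(h2 y).2, fun c hc => ⟨c, fun _ => rfl, (h2 y).1.trans hc⟩⟩⟩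

theorem mk_cast_eq_of_trans_eq {x₀ x₁ : X} (h : x₁ = x₀) {P : Path x₁ x₁}
    {q : Homotopic.Quotient x₀ x₀} (hq : (Homotopic.Quotient.mk ((Path.refl x₀).cast rfl h)).trans
      (Homotopic.Quotient.mk P) = q.trans (Homotopic.Quotient.mk ((Path.refl x₀).cast rfl h))) :
    Homotopic.Quotient.mk (P.cast h.symm h.symm) = q := by
  subst h
  have e : Homotopic.Quotient.mk ((Path.refl x₁).cast rfl rfl) = Homotopic.Quotient.refl x₁ := rfl
  rw [e, Homotopic.Quotient.refl_trans, Homotopic.Quotient.trans_refl] at hq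
  exact hq

/-- Each homomorphism from the fundamental group of a connected open subset of `ℝ³` to that of a
space with vanishing second homotopy group is induced by a map. -/
theorem exists_map_of_hom (hO : IsOpen O) (hconn : PathConnectedSpace O)
    (hpi : Subsingleton (π_ 2 X x₀)) (hp : free (cell p) = ∅)
    (hφ : ∀ a b, φ (a.trans b) = (φ a).trans (φ b)) :
    ∃ (f : C(O, X)) (h : f p = x₀), ∀ ω : Path p p,
      Homotopic.Quotient.mk ((ω.map f.continuous).cast h.symm h.symm) = φ (Homotopic.Quotient.mk ω) := by
  classical
  have hps : ∀ d, cell p ∈ skel O d := fun d => ⟨⟨p, rfl⟩, by simp [hp]⟩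
  -- The connection at `p` is chosen trivial so that loops at `p` are mapped by `φ` itself and not
  -- by a conjugate.
  have hg : ∀ y : Skel O 0, ∃ g : Homotopic.Quotient p y.1, ∀ h : y.1 = p,
      g = Homotopic.Quotient.mk ((Path.refl p).cast rfl h) := by
    rintro ⟨y, hy⟩
    by_cases h : y = p
    · subst h
      exact ⟨Homotopic.Quotient.refl y, fun _ => rfl⟩
    · exact ⟨Homotopic.Quotient.mk (hconn.joined p y).somePath, fun h' => absurd h' h⟩
  choose g₀ hg₀ using hg
  obtain ⟨F₁, τ₁, g₁, h₁, e₁⟩ := (realizes_vertices (x₀ := x₀) hO hφ g₀).exists_edges hO hφ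
  obtain ⟨F₂, τ₂, g₂, h₂, e₂⟩ := h₁.exists_succ hO hφ one_ne_zero fun j hj hc => h₁.exists_square hO hj hc
  have hj₂ : ∀ y, Joined (F₂ y) x₀ := fun y => by
    have := τ₂ y
    induction this using Path.Homotopic.Quotient.ind with | _ c => exact ⟨c.symm⟩
  obtain ⟨F₃, τ₃, g₃, h₃, e₃⟩ := h₂.exists_succ hO hφ two_ne_zero fun j hj hc =>
    exists_extension_cube hO hpi hj₂ hj hc
  obtain ⟨eg₁, eτ₁⟩ := e₁ ⟨p, hps 0⟩
  obtain ⟨c₁, hc₁, hτ₁⟩ := eτ₁ (Path.refl x₀) rfl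
  obtain ⟨eg₂, eτ₂⟩ := e₂ (Skel.succ O 0 ⟨p, hps 0⟩)
  obtain ⟨c₂, hc₂, hτ₂⟩ := eτ₂ c₁ hτ₁
  obtain ⟨eg₃, eτ₃⟩ := e₃ (Skel.succ O 1 (Skel.succ O 0 ⟨p, hps 0⟩))
  obtain ⟨c₃, hc₃, hτ₃⟩ := eτ₃ c₂ hτ₂
  -- The connection of the image of `p` started as the constant path and has been preserved
  -- pointwise through all three extensions.
  have hc : ∀ t, c₃ t = x₀ := fun t => (hc₃ t).trans ((hc₂ t).trans (hc₁ t))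
  have hmem : ∀ y : O, cell y ∈ skel O 3 := fun y => ⟨⟨y, rfl⟩, by
    simpa using Finset.card_le_univ (free (cell y))⟩
  let s : C(O, Skel O 3) := ⟨fun y => ⟨y, hmem y⟩, continuous_id.subtype_mk _⟩
  have hfp : F₃ (s p) = x₀ := by
    have := hc 1
    rwa [c₃.target] at this
  have hg₃ : g₃ (s p) = Homotopic.Quotient.refl p :=
    eg₃.trans (eg₂.trans (eg₁.trans (hg₀ ⟨p, hps 0⟩ rfl)))
  have hc₃' : c₃ = (Path.refl x₀).cast rfl hfp := by
    ext t; exact hc t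
  refine ⟨F₃.comp s, hfp, fun ω => ?_⟩
  have h4 : (τ₃ (s p)).trans (Homotopic.Quotient.mk (ω.map (F₃.comp s).continuous)) =
      (φ (((g₃ (s p)).trans (Homotopic.Quotient.mk ω)).trans (g₃ (s p)).symm)).trans (τ₃ (s p)) :=
    h₃ _ _ (ω.map s.continuous)
  have h5 : τ₃ (s p) = Homotopic.Quotient.mk ((Path.refl x₀).cast rfl hfp) := hc₃' ▸ hτ₃
  have h6 : (Homotopic.Quotient.refl p).symm = Homotopic.Quotient.refl p := by
    have := Homotopic.Quotient.trans_symm (Homotopic.Quotient.refl p)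
    rwa [Homotopic.Quotient.refl_trans] at this
  rw [hg₃, h5, Homotopic.Quotient.refl_trans, h6, Homotopic.Quotient.trans_refl] at h4
  exact mk_cast_eq_of_trans_eq hfp h4

end DyadicBox


/-! ### Transfer of both extension theorems to retracts of open sets. -/

section OpenRetract

open Set

/-- `Y` is a retract of an open subset of `ℝ³`. -/
def IsOpenRetract (Y : Type*) [TopologicalSpace Y] : Prop :=
  ∃ O : Set (Fin 3 → ℝ), IsOpen O ∧ ∃ (i : C(Y, O)) (r : C(O, Y)), ∀ y, r (i y) = y

variable {Y : Type*} [TopologicalSpace Y]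

/-- A retraction is a quotient map, and quotients inherit local path-connectedness from the open
set. -/
theorem IsOpenRetract.locallyPathConnectedSpace (h : IsOpenRetract Y) : LocallyPathConnectedSpace Y := by
  obtain ⟨O, hO, i, r, hir⟩ := h
  have : LocallyPathConnectedSpace O := hO.locallyPathConnectedSpace
  have hq : IsQuotientMap r := IsQuotientMap.of_comp i.continuous r.continuous (by
    rw [show ⇑r ∘ ⇑i = id from funext hir]; exact IsQuotientMap.id)
  exact hq.locallyPathConnectedSpace

/-- Translation moves `i y₀` to the origin, which lies on every dyadic grid and hence is a vertex.
Passing to its path component keeps all of the image of `Y` and makes the open set connected. -/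
theorem IsOpenRetract.exists_normalized (h : IsOpenRetract Y) [PathConnectedSpace Y] (y₀ : Y) :
    ∃ O : Set (Fin 3 → ℝ), IsOpen O ∧ PathConnectedSpace O ∧ ∃ (i : C(Y, O)) (r : C(O, Y)),
      (∀ y, r (i y) = y) ∧ DyadicBox.free (DyadicBox.cell (i y₀)) = ∅ := by
  obtain ⟨O, hO, i, r, hir⟩ := h
  let c : Fin 3 → ℝ := (i y₀).1
  let O' : Set (Fin 3 → ℝ) := (fun v => v + c) ⁻¹' pathComponentIn O c
  have hcO : c ∈ O := (i y₀).2
  have hO' : IsOpen O' := (hO.pathComponentIn c).preimage (by fun_prop)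
  have himg : O' = (fun v => v - c) '' pathComponentIn O c := by
    ext v
    constructor
    · intro hv; exact ⟨v + c, hv, by simp⟩
    · rintro ⟨w, hw, rfl⟩; simpa [O'] using hw
  have hpc : IsPathConnected O' := by
    rw [himg]
    exact (isPathConnected_pathComponentIn hcO).image (by fun_prop)
  have hi : ∀ y, (i y).1 ∈ pathComponentIn O c := by
    intro y
    obtain ⟨γ⟩ := PathConnectedSpace.joined y₀ y
    exact ⟨γ.map (continuous_subtype_val.comp i.continuous), fun t => (i (γ t)).2⟩
  have hir0 : ∀ y, (i y).1 - c ∈ O' := fun y => by simpa [O'] using hi y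
  refine ⟨O', hO', isPathConnected_iff_pathConnectedSpace.1 hpc,
    ⟨fun y => ⟨(i y).1 - c, hir0 y⟩,
      ((continuous_subtype_val.comp i.continuous).sub continuous_const).subtype_mk _⟩,
    ⟨fun v => r ⟨v.1 + c, pathComponentIn_subset v.2⟩,
      r.continuous.comp ((continuous_subtype_val.add continuous_const).subtype_mk _)⟩, ?_, ?_⟩
  · intro y
    change r ⟨(i y).1 - c + c, _⟩ = y
    have : (⟨(i y).1 - c + c, pathComponentIn_subset (hir0 y)⟩ : O) = i y :=
      Subtype.ext (sub_add_cancel _ _)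
    rw [this, hir]
  · refine Finset.eq_empty_iff_forall_notMem.2 fun k hk => ?_
    rw [DyadicBox.mem_free_cell] at hk
    exact hk ⟨0, by simp [c]⟩

theorem Path.Homotopic.cast {x y x' y' : Y} {α β : Path x y} (h : α.Homotopic β) (hx : x' = x)
    (hy : y' = y) : (α.cast hx hy).Homotopic (β.cast hx hy) := by
  subst hx hy; exact h

variable {X : Type*} [TopologicalSpace X] {x₀ : X}

theorem IsOpenRetract.exists_homotopy (h : IsOpenRetract Y) [PathConnectedSpace Y]
    (hpi : Subsingleton (π_ 2 X x₀)) {f g : C(Y, X)} {y₀ : Y} (hf : Joined (f y₀) x₀)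
    (δ : Path (f y₀) (g y₀))
    (hδ : ∀ ω : Path y₀ y₀, ((ω.map f.continuous).trans δ).Homotopic (δ.trans (ω.map g.continuous))) :
    ∃ H : C(Y × unitInterval, X), (∀ y, H (y, 0) = f y) ∧ (∀ y, H (y, 1) = g y) ∧
      ∀ t, H (y₀, t) = δ t := by
  obtain ⟨O, hO, hconn, i, r, hir, hfree⟩ := h.exists_normalized y₀
  have h0 := hir y₀
  have h1 : (f.comp r) (i y₀) = f y₀ := congrArg f h0
  have h2 : (g.comp r) (i y₀) = g y₀ := congrArg g h0
  obtain ⟨H, H0, H1, Hδ⟩ := DyadicBox.exists_homotopy (f := f.comp r) (g := g.comp r) hO hconn hpi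
    hfree (by rw [h1]; exact hf) (δ.cast h1 h2) (fun ω => by
      have h3 := (hδ ((ω.map r.continuous).cast h0.symm h0.symm)).cast h1 h2
      have e1 : ((((ω.map r.continuous).cast h0.symm h0.symm).map f.continuous).trans δ).cast h1 h2 =
          (ω.map (f.comp r).continuous).trans (δ.cast h1 h2) := rfl
      have e2 : (δ.trans (((ω.map r.continuous).cast h0.symm h0.symm).map g.continuous)).cast h1 h2 =
          (δ.cast h1 h2).trans (ω.map (g.comp r).continuous) := rfl
      rwa [e1, e2] at h3)
  refine ⟨H.comp (i.prodMap (ContinuousMap.id _)), fun y => ?_, fun y => ?_, fun t => ?_⟩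
  · exact (H0 (i y)).trans (congrArg f (hir y))
  · exact (H1 (i y)).trans (congrArg g (hir y))
  · exact Hδ t

theorem IsOpenRetract.exists_map_of_hom (h : IsOpenRetract Y) [PathConnectedSpace Y] {y₀ : Y}
    (hpi : Subsingleton (π_ 2 X x₀))
    {φ : Path.Homotopic.Quotient y₀ y₀ → Path.Homotopic.Quotient x₀ x₀}
    (hφ : ∀ a b, φ (a.trans b) = (φ a).trans (φ b)) :
    ∃ (f : C(Y, X)) (h : f y₀ = x₀), ∀ ω : Path y₀ y₀, Path.Homotopic.Quotient.mk
      ((ω.map f.continuous).cast h.symm h.symm) = φ (Path.Homotopic.Quotient.mk ω) := by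
  obtain ⟨O, hO, hconn, i, r, hir, hfree⟩ := h.exists_normalized y₀
  have h0 := hir y₀
  let ψ : Path.Homotopic.Quotient (i y₀) (i y₀) → Path.Homotopic.Quotient y₀ y₀ := fun q =>
    (q.map r).cast h0.symm h0.symm
  have hψ : ∀ a b, ψ (a.trans b) = (ψ a).trans (ψ b) := by
    intro a b
    induction a using Path.Homotopic.Quotient.ind with | _ a =>
    induction b using Path.Homotopic.Quotient.ind with | _ b =>
    change Path.Homotopic.Quotient.mk (((a.trans b).map r.continuous).cast h0.symm h0.symm) =
      Path.Homotopic.Quotient.mk (((a.map r.continuous).cast h0.symm h0.symm).trans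
        ((b.map r.continuous).cast h0.symm h0.symm))
    rw [Path.map_trans]
    rfl
  obtain ⟨f, hf, hfφ⟩ := DyadicBox.exists_map_of_hom (φ := φ ∘ ψ) hO hconn hpi hfree
    fun a b => by simp only [Function.comp, hψ, hφ]
  refine ⟨f.comp i, hf, fun ω => (hfφ (ω.map i.continuous)).trans (congrArg φ ?_)⟩
  change Path.Homotopic.Quotient.mk (((ω.map i.continuous).map r.continuous).cast h0.symm h0.symm) = _
  congr 1
  ext t
  exact hir (ω t)

/-- The complement of a point in the 3-sphere is homeomorphic to `ℝ³`. -/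
theorem exists_chart_compl_singleton (z : S3) : ∃ Ψ : OpenPartialHomeomorph S3 (Fin 3 → ℝ),
    Ψ.source = {z}ᶜ ∧ Ψ.target = univ := by
  have hfin : Module.finrank ℝ (Euc 3) + 1 = Fintype.card (Fin 4) := by simp
  let e := onePointEquivSphereOfFinrankEq hfin
  have : Fact (Module.finrank ℝ (EuclideanSpace ℝ (Fin 4)) = 3 + 1) := ⟨by simp⟩
  refine ⟨(e.toOpenPartialHomeomorph.trans (stereographic' 3 (e z))).trans
    (EuclideanSpace.equiv (Fin 3) ℝ).toHomeomorph.toOpenPartialHomeomorph, ?_, ?_⟩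
  · ext x
    simp
  · ext x
    simp

/-- An open set missing a point of the 3-sphere becomes an open subset of `ℝ³` by stereographic
projection from that point. -/
theorem isOpenRetract_of_subset {A V : Set S3} (hV : IsOpen V) (hne : V ≠ univ) {ρ : S3 → S3}
    (hρ : ContinuousOn ρ V) (hρA : MapsTo ρ V A) (hAV : A ⊆ V) (hid : ∀ x ∈ A, ρ x = x) :
    IsOpenRetract A := by
  obtain ⟨z, hz⟩ := (ne_univ_iff_exists_notMem V).1 hne
  obtain ⟨Ψ, hs, -⟩ := exists_chart_compl_singleton z
  have hVs : V ⊆ Ψ.source := fun x hx => by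
    rw [hs]; rintro rfl; exact hz hx
  have hmem : ∀ x ∈ A, Ψ x ∈ Ψ.target ∩ Ψ.symm ⁻¹' V := fun x hx =>
    ⟨Ψ.map_source (hVs (hAV hx)), by rw [mem_preimage, Ψ.left_inv (hVs (hAV hx))]; exact hAV hx⟩
  refine ⟨Ψ.target ∩ Ψ.symm ⁻¹' V, Ψ.isOpen_inter_preimage_symm hV,
    ⟨fun x => ⟨Ψ x.1, hmem x.1 x.2⟩, ?_⟩, ⟨fun v => ⟨ρ (Ψ.symm v.1), hρA v.2.2⟩, ?_⟩, ?_⟩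
  · exact (Ψ.continuousOn.comp_continuous continuous_subtype_val fun x => hVs (hAV x.2)).subtype_mk _
  · refine Continuous.subtype_mk ?_ _
    exact hρ.comp_continuous (Ψ.symm.continuousOn.comp_continuous continuous_subtype_val
      fun v => v.2.1) fun v => v.2.2
  · rintro ⟨x, hx⟩
    refine Subtype.ext ?_
    change ρ (Ψ.symm (Ψ x)) = x
    rw [Ψ.left_inv (hVs (hAV hx)), hid x hx]

end OpenRetract


/-! ### From homotopy theorems to the bijection with homomorphisms. -/

section Bookkeeping

open Path

variable {S U X : Type*} [TopologicalSpace S] [TopologicalSpace U] [TopologicalSpace X]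

theorem inducedAlong_mk (ι : C(S, U)) {pt : U} {s : S} (γ : Path pt (ι s)) (ω : Path s s) :
    inducedAlong ι γ (Homotopic.Quotient.mk ω) =
      Homotopic.Quotient.mk (γ.trans ((ω.map ι.continuous).trans γ.symm)) := by
  rfl

theorem mapOfEq_mk (f : C(U, X)) {pt : U} {x₀ : X} (h : f pt = x₀) (ω : Path pt pt) :
    FundamentalGroup.mapOfEq f h (Homotopic.Quotient.mk ω) =
      Homotopic.Quotient.mk ((ω.map f.continuous).cast h.symm h.symm) := by
  rw [FundamentalGroup.mapOfEq_apply]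
  rfl

/-- Multiplication in `FundamentalGroup` is concatenation in the reverse order, which decides the
side on which `k` appears. -/
theorem FundamentalGroup.mul_mul_inv_eq_iff {x₀ : X} {k a b : FundamentalGroup X x₀} :
    k * a * k⁻¹ = b ↔ Homotopic.Quotient.trans a k = Homotopic.Quotient.trans k b := by
  rw [mul_inv_eq_iff_eq_mul, FundamentalGroup.mul_def, FundamentalGroup.mul_def]

theorem Path.Homotopic.Quotient.conj_comm_iff {x₀ y : X} {a : Homotopic.Quotient x₀ y}
    {L : Homotopic.Quotient y y} {c : Homotopic.Quotient y x₀} {B : Homotopic.Quotient x₀ x₀} :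
    (a.trans (L.trans a.symm)).trans (a.trans c) = (a.trans c).trans B ↔ L.trans c = c.trans B := by
  have h1 : (a.trans (L.trans a.symm)).trans (a.trans c) = a.trans (L.trans c) := by
    simp only [Homotopic.Quotient.trans_assoc]
    rw [← Homotopic.Quotient.trans_assoc a.symm a, Homotopic.Quotient.symm_trans,
      Homotopic.Quotient.refl_trans]
  rw [h1, Homotopic.Quotient.trans_assoc]
  constructor
  · intro h
    have h2 := congrArg (fun q => a.symm.trans q) h
    simp only [← Homotopic.Quotient.trans_assoc, Homotopic.Quotient.symm_trans,
      Homotopic.Quotient.refl_trans] at h2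
    exact h2
  · intro h; rw [h]

theorem Path.homotopic_cast_iff {x₀ y z : X} (h : z = x₀) {A : Path y y} {c : Path y x₀} {B : Path z z} :
    (A.trans (c.cast rfl h)).Homotopic ((c.cast rfl h).trans B) ↔
      (Homotopic.Quotient.mk A).trans (Homotopic.Quotient.mk c) =
        (Homotopic.Quotient.mk c).trans (Homotopic.Quotient.mk (B.cast h.symm h.symm)) := by
  subst h
  exact (Homotopic.Quotient.eq).symm

/-- The action of a map on the loops which are connected to the base point by `γ`. -/
theorem mapOfEq_inducedAlong_mk (ι : C(S, U)) {pt : U} {s : S} (γ : Path pt (ι s)) (f : C(U, X))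
    {x₀ : X} (h : f pt = x₀) (ω : Path s s) :
    FundamentalGroup.mapOfEq f h (inducedAlong ι γ (Homotopic.Quotient.mk ω)) =
      (Homotopic.Quotient.mk ((γ.map f.continuous).cast h.symm rfl)).trans
        ((Homotopic.Quotient.mk (ω.map (f.comp ι).continuous)).trans
          (Homotopic.Quotient.mk ((γ.map f.continuous).cast h.symm rfl)).symm) := by
  rw [inducedAlong_mk, mapOfEq_mk]
  subst h
  rw [← Homotopic.Quotient.mk_symm, ← Homotopic.Quotient.mk_trans, ← Homotopic.Quotient.mk_trans]
  congr 1
  ext t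
  simp only [Path.map_trans]
  rfl

theorem areConj_iff {H G K : Type*} [Group H] [Group G] [Group K] (e : K ≃* G) (α β : H →* K) :
    AreConj (e.toMonoidHom.comp α) (e.toMonoidHom.comp β) ↔ ∃ k : K, ∀ x, k * α x * k⁻¹ = β x := by
  constructor
  · rintro ⟨g, hg⟩
    refine ⟨e.symm g, fun x => e.injective ?_⟩
    have := hg x
    simpa using this
  · rintro ⟨k, hk⟩
    refine ⟨e k, fun x => ?_⟩
    simp [← hk x]

/-- The classification of based maps by their action on fundamental groups. -/
theorem exists_bijective_of_isOpenRetract [PathConnectedSpace S] [PathConnectedSpace U]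
    (hS : IsOpenRetract S) (hU : IsOpenRetract U) (ι : C(S, U)) {pt : U} {s : S}
    {G : Type*} [Group G] (x₀ : X) (e : FundamentalGroup X x₀ ≃* G)
    (hpi2 : Subsingleton (π_ 2 X x₀)) (f₀ : C(S, X)) (hf₀ : f₀ s = x₀) (γ : Path pt (ι s)) :
    ∃ θ : Quotient (basedHomotopy ι f₀ pt x₀) →
        {φ : FundamentalGroup U pt →* G // AreConj (φ.comp (inducedAlong ι γ))
          (e.toMonoidHom.comp (FundamentalGroup.mapOfEq f₀ hf₀))},
      (∀ f : BasedFields ι f₀ pt x₀,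
        (θ (Quotient.mk _ f)).1 = e.toMonoidHom.comp (FundamentalGroup.mapOfEq f.1 f.2.1)) ∧
      Function.Bijective θ := by
  have key : ∀ (f : C(U, X)) (hf : f pt = x₀),
      AreConj ((e.toMonoidHom.comp (FundamentalGroup.mapOfEq f hf)).comp (inducedAlong ι γ))
        (e.toMonoidHom.comp (FundamentalGroup.mapOfEq f₀ hf₀)) ↔ (f.comp ι).Homotopic f₀ := by
    intro f hf
    rw [MonoidHom.comp_assoc, areConj_iff]
    set a := Homotopic.Quotient.mk ((γ.map f.continuous).cast hf.symm rfl) with ha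
    constructor
    · rintro ⟨k, hk⟩
      -- The conjugating element, precomposed with the reverse of the image of `γ`, becomes a track
      -- from `f (ι s)` to `x₀` along which the homotopy on `S` moves the base point.
      let c : Homotopic.Quotient (f (ι s)) x₀ := a.symm.trans k
      have hac : a.trans c = k := by
        simp only [c]
        rw [← Homotopic.Quotient.trans_assoc, Homotopic.Quotient.trans_symm,
          Homotopic.Quotient.refl_trans]
      obtain ⟨c', hc'⟩ : ∃ c', Homotopic.Quotient.mk c' = c := by
        generalize c = q
        induction q using Path.Homotopic.Quotient.ind with | _ q => exact ⟨q, rfl⟩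
      have hδ : ∀ ω : Path s s, ((ω.map (f.comp ι).continuous).trans (c'.cast rfl hf₀)).Homotopic
          ((c'.cast rfl hf₀).trans (ω.map f₀.continuous)) := by
        intro ω
        rw [Path.homotopic_cast_iff, hc', ← Path.Homotopic.Quotient.conj_comm_iff (a := a), hac]
        have h1 := FundamentalGroup.mul_mul_inv_eq_iff.1 (hk (Homotopic.Quotient.mk ω))
        rw [MonoidHom.comp_apply, mapOfEq_inducedAlong_mk, mapOfEq_mk] at h1
        exact h1
      have hj : Joined ((f.comp ι) s) x₀ := ⟨c'⟩
      obtain ⟨H, H0, H1, -⟩ := hS.exists_homotopy hpi2 hj (c'.cast rfl hf₀) hδ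
      exact ⟨⟨⟨fun p => H (p.2, p.1), H.continuous.comp continuous_swap⟩, H0, H1⟩⟩
    · rintro ⟨H⟩
      -- Conversely, the track of `s` under a free homotopy supplies the conjugating element.
      let c' : Path (f (ι s)) x₀ := (H.evalAt s).cast rfl hf₀.symm
      refine ⟨a.trans (Homotopic.Quotient.mk c'), fun x => ?_⟩
      induction x using Path.Homotopic.Quotient.ind with | _ ω =>
      rw [FundamentalGroup.mul_mul_inv_eq_iff, MonoidHom.comp_apply, mapOfEq_inducedAlong_mk, mapOfEq_mk]
      refine Path.Homotopic.Quotient.conj_comm_iff.2 ?_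
      exact (Path.homotopic_cast_iff (z := f₀ s) hf₀).1 (Path.Homotopic.map_trans_evalAt H ω)
  refine ⟨Quotient.lift (fun f => ⟨_, (key f.1 f.2.1).2 f.2.2⟩) ?_, fun f => rfl, ?_, ?_⟩
  · rintro f g ⟨H⟩
    refine Subtype.ext (MonoidHom.ext fun x => ?_)
    induction x using Path.Homotopic.Quotient.ind with | _ ω =>
    refine congrArg e ?_
    rw [mapOfEq_mk, mapOfEq_mk]
    have h1 := Path.Homotopic.map_trans_evalAt H.toHomotopy ω
    have h2 : (H.toHomotopy.evalAt pt) = (Path.refl x₀).cast f.2.1 g.2.1 := by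
      ext t
      exact (H.prop t pt rfl).trans f.2.1
    rw [h2] at h1
    have h3 := h1.cast f.2.1.symm g.2.1.symm
    have e1 : ((ω.map f.1.continuous).trans ((Path.refl x₀).cast f.2.1 g.2.1)).cast f.2.1.symm g.2.1.symm =
      ((ω.map f.1.continuous).cast f.2.1.symm f.2.1.symm).trans (Path.refl x₀) := rfl
    have e2 : (((Path.refl x₀).cast f.2.1 g.2.1).trans (ω.map g.1.continuous)).cast f.2.1.symm g.2.1.symm =
      (Path.refl x₀).trans ((ω.map g.1.continuous).cast g.2.1.symm g.2.1.symm) := rfl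
    rw [e1, e2] at h3
    have h4 := Homotopic.Quotient.eq.2 h3
    simpa using h4
  · intro q q'
    induction q using Quotient.inductionOn with | _ f =>
    induction q' using Quotient.inductionOn with | _ g =>
    intro h
    have h1 : e.toMonoidHom.comp (FundamentalGroup.mapOfEq f.1 f.2.1) =
      e.toMonoidHom.comp (FundamentalGroup.mapOfEq g.1 g.2.1) := congrArg Subtype.val h
    refine Quotient.sound ?_
    -- The constant track makes the resulting homotopy base-point preserving.
    let δ : Path (f.1 pt) (g.1 pt) := (Path.refl x₀).cast f.2.1 g.2.1
    have hδ : ∀ ω : Path pt pt, ((ω.map f.1.continuous).trans δ).Homotopic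
        (δ.trans (ω.map g.1.continuous)) := by
      intro ω
      have h2 : FundamentalGroup.mapOfEq f.1 f.2.1 (Homotopic.Quotient.mk ω) =
          FundamentalGroup.mapOfEq g.1 g.2.1 (Homotopic.Quotient.mk ω) :=
        e.injective (DFunLike.congr_fun h1 (Homotopic.Quotient.mk ω))
      rw [mapOfEq_mk, mapOfEq_mk] at h2
      have h3 := Homotopic.Quotient.exact h2
      have h4 : (((ω.map f.1.continuous).cast f.2.1.symm f.2.1.symm).trans (Path.refl x₀)).Homotopic
          ((Path.refl x₀).trans ((ω.map g.1.continuous).cast g.2.1.symm g.2.1.symm)) := by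
        refine Homotopic.Quotient.exact ?_
        simpa using h2
      exact h4.cast f.2.1 g.2.1
    obtain ⟨H, H0, H1, Hδ⟩ := hU.exists_homotopy hpi2 (x₀ := x₀) (by rw [f.2.1]) δ hδ
    refine ⟨⟨⟨⟨fun p => H (p.2, p.1), H.continuous.comp continuous_swap⟩, H0, H1⟩, ?_⟩⟩
    rintro t x rfl
    exact (Hδ t).trans f.2.1.symm
  · rintro ⟨φ, hφ⟩
    let ψ : Homotopic.Quotient pt pt → Homotopic.Quotient x₀ x₀ := fun q =>
      e.symm (φ (q : FundamentalGroup U pt))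
    have hψ : ∀ a b, ψ (a.trans b) = (ψ a).trans (ψ b) := by
      intro a b
      let a' : FundamentalGroup U pt := a
      let b' : FundamentalGroup U pt := b
      have h : e.symm (φ (b' * a')) = e.symm (φ b') * e.symm (φ a') := by rw [map_mul, map_mul]
      exact h
    obtain ⟨f, hf, hfψ⟩ := hU.exists_map_of_hom hpi2 hψ
    have hfφ : e.toMonoidHom.comp (FundamentalGroup.mapOfEq f hf) = φ := by
      refine MonoidHom.ext fun x => ?_
      induction x using Path.Homotopic.Quotient.ind with | _ ω =>
      have h1 := hfψ ω
      rw [← mapOfEq_mk f hf] at h1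
      have h2 : e (FundamentalGroup.mapOfEq f hf (Homotopic.Quotient.mk ω)) =
        φ (Homotopic.Quotient.mk ω : FundamentalGroup U pt) := by
        rw [h1]; exact e.apply_symm_apply _
      exact h2
    have hf' : (f.comp ι).Homotopic f₀ := by
      rw [← key f hf, hfφ]; exact hφ
    exact ⟨Quotient.mk _ ⟨f, hf, hf'⟩, Subtype.ext hfφ⟩

end Bookkeeping


/-! ### Handlebodies, their spines, and the resulting retractions. -/

section Handlebody

open Set

/-- The radial projection of the disc to its boundary sphere (fixing the centre). -/
noncomputable def radialProj {n : ℕ} (y : Disc n) : Disc n :=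
  ⟨‖(y : Euc n)‖⁻¹ • (y : Euc n), by
    rw [mem_closedBall_zero_iff, norm_smul, norm_inv, norm_norm]
    exact inv_mul_le_one⟩

theorem norm_radialProj {n : ℕ} {y : Disc n} (hy : (y : Euc n) ≠ 0) :
    ‖(radialProj y : Euc n)‖ = 1 := by
  change ‖‖(y : Euc n)‖⁻¹ • (y : Euc n)‖ = 1
  rw [norm_smul, norm_inv, norm_norm, inv_mul_cancel₀ (norm_ne_zero_iff.2 hy)]

theorem radialProj_of_norm {n : ℕ} {y : Disc n} (hy : ‖(y : Euc n)‖ = 1) : radialProj y = y :=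
  Subtype.ext (by simp [radialProj, hy])

theorem continuousOn_radialProj {n : ℕ} :
    ContinuousOn (radialProj (n := n)) {y | (y : Euc n) ≠ 0} := by
  refine Topology.IsInducing.subtypeVal.continuousOn_iff.2 ?_
  exact (continuous_subtype_val.norm.continuousOn.inv₀ fun y hy => norm_ne_zero_iff.2 hy).smul
    continuous_subtype_val.continuousOn

/-- The disc scaled by a number of the unit interval. -/
def discSmul {n : ℕ} (t : unitInterval) (y : Disc n) : Disc n :=
  ⟨(t : ℝ) • (y : Euc n), by
    rw [mem_closedBall_zero_iff, norm_smul, Real.norm_of_nonneg t.2.1]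
    exact mul_le_one₀ t.2.2 (norm_nonneg _) (mem_closedBall_zero_iff.1 y.2)⟩

@[simp] theorem coe_discSmul {n : ℕ} (t : unitInterval) (y : Disc n) :
    (discSmul t y : Euc n) = (t : ℝ) • (y : Euc n) := rfl

theorem continuous_discSmul {n : ℕ} :
    Continuous fun p : unitInterval × Disc n => discSmul p.1 p.2 := by
  refine Continuous.subtype_mk ?_ _
  exact (continuous_subtype_val.comp continuous_fst).smul
    (continuous_subtype_val.comp continuous_snd)

theorem exists_discSmul_radialProj {n : ℕ} (y : Disc n) : ∃ t, discSmul t (radialProj y) = y := by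
  refine ⟨⟨‖(y : Euc n)‖, norm_nonneg _, mem_closedBall_zero_iff.1 y.2⟩, Subtype.ext ?_⟩
  change ‖(y : Euc n)‖ • (‖(y : Euc n)‖⁻¹ • (y : Euc n)) = y
  by_cases hy : (y : Euc n) = 0
  · simp [hy]
  · rw [smul_inv_smul₀ (norm_ne_zero_iff.2 hy)]

theorem ContinuousOn.of_isClosed_cover {X Y : Type*} [TopologicalSpace X] [TopologicalSpace Y]
    {f : X → Y} {V A C : Set X} (hA : IsClosed A) (hC : IsClosed C) (hV : V ⊆ A ∪ C)
    (hfA : ContinuousOn f (V ∩ A)) (hfC : ContinuousOn f (V ∩ C)) : ContinuousOn f V := by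
  have key : ∀ {D : Set X}, IsClosed D → ContinuousOn f (V ∩ D) → ∀ x ∈ V,
      ContinuousWithinAt f (V ∩ D) x := by
    intro D hD hf x hx
    by_cases hxD : x ∈ D
    · exact hf x ⟨hx, hxD⟩
    · have : x ∉ closure (V ∩ D) := fun h => hxD (hD.closure_subset_iff.2 inter_subset_right h)
      rw [mem_closure_iff_nhdsWithin_neBot, Filter.not_neBot] at this
      rw [ContinuousWithinAt, this]
      exact Filter.tendsto_bot
  intro x hx
  refine ((key hA hfA x hx).union (key hC hfC x hx)).mono fun y hy => ?_
  exact (hV hy).imp (fun h => ⟨hy, h⟩) fun h => ⟨hy, h⟩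

theorem Topology.IsEmbedding.continuousOn_extend {X Y Z : Type*} [TopologicalSpace X]
    [TopologicalSpace Y] [TopologicalSpace Z] {b : X → Y} (hb : IsEmbedding b) {g : X → Z}
    {e : Y → Z} {s : Set X} (hg : ContinuousOn g s) :
    ContinuousOn (Function.extend b g e) (b '' s) := by
  rintro _ ⟨x, hx, rfl⟩
  rw [ContinuousWithinAt, hb.injective.extend_apply, ← hb.map_nhdsWithin_eq, Filter.tendsto_map'_iff]
  have h : Function.extend b g e ∘ b = g := funext fun y => hb.injective.extend_apply g e y
  rw [h]
  exact hg x hx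

/-- A handlebody presented by the characteristic maps of the 0-handle and of all 1-handles. -/
structure IsHandleDecomposition {k : ℕ} (b : Disc 3 → S3)
    (H : Fin k × Set.Icc (-1 : ℝ) 1 × Disc 2 → S3) (W B : Set S3) : Prop where
  ball : IsClosedEmbedding b
  handles : IsClosedEmbedding H
  mem_ball_iff : ∀ q, H q ∈ range b ↔ |(q.2.1 : ℝ)| = 1
  mem_sphere : ∀ q, |(q.2.1 : ℝ)| = 1 → H q ∈ b '' {y | ‖(y : Euc 3)‖ = 1}
  eq_union : W = range b ∪ range H
  boundary_eq : B = (b '' {y | ‖(y : Euc 3)‖ = 1} \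
    H '' {q | |(q.2.1 : ℝ)| = 1 ∧ ‖(q.2.2 : Euc 2)‖ < 1}) ∪ H '' {q | ‖(q.2.2 : Euc 2)‖ = 1}

theorem IsHandlebody.exists_isHandleDecomposition {k : ℕ} {W B : Set S3}
    (hW : IsHandlebody k W B) : ∃ b H, IsHandleDecomposition (k := k) b H W B := by
  obtain ⟨b, h, hb, hh, hd, hmem, hsph, hWe, hBe⟩ := hW
  have him : ∀ p : Icc (-1 : ℝ) 1 × Disc 2 → Prop,
      (⋃ i, h i '' {q | p q}) = (fun q : Fin k × Icc (-1 : ℝ) 1 × Disc 2 => h q.1 q.2) ''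
        {q | p q.2} := by
    intro p
    ext x
    simp only [mem_iUnion, mem_image]
    constructor
    · rintro ⟨i, q, hq, rfl⟩
      exact ⟨(i, q), hq, rfl⟩
    · rintro ⟨⟨i, q⟩, hq, rfl⟩
      exact ⟨i, q, hq, rfl⟩
  refine ⟨b, fun q => h q.1 q.2, ?_, ?_, fun q => hmem q.1 q.2, fun q => hsph q.1 q.2, ?_, ?_⟩
  · exact hb.continuous.isClosedEmbedding hb.injective
  · refine Continuous.isClosedEmbedding ?_ ?_
    · exact continuous_prod_of_discrete_left.2 fun i => (hh i).continuous
    · rintro ⟨i, q⟩ ⟨j, r⟩ (h1 : h i q = h j r)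
      by_cases hij : i = j
      · subst hij
        rw [(hh i).injective h1]
      · exact absurd h1 ((disjoint_iff_forall_ne.1 (hd i j hij)) ⟨q, rfl⟩ ⟨r, rfl⟩)
  · have := him fun _ => True
    simp only [ofPred_true, image_univ] at this
    rw [hWe, this]
  · rw [hBe, him, him]

namespace IsHandleDecomposition

variable {k : ℕ} {b : Disc 3 → S3} {H : Fin k × Set.Icc (-1 : ℝ) 1 × Disc 2 → S3} {W B : Set S3}

theorem isClosed (hd : IsHandleDecomposition b H W B) : IsClosed W := by
  rw [hd.eq_union]
  exact hd.ball.isClosed_range.union hd.handles.isClosed_range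

theorem norm_of_mem_ball (hd : IsHandleDecomposition b H W B) {y q} (h : b y = H q) :
    ‖(y : Euc 3)‖ = 1 ∧ |(q.2.1 : ℝ)| = 1 := by
  have h1 := (hd.mem_ball_iff q).1 ⟨y, h⟩
  obtain ⟨y', hy', h'⟩ := hd.mem_sphere q h1
  rw [← h] at h'
  rw [← hd.ball.injective h']
  exact ⟨hy', h1⟩

theorem handle_mem_boundary_iff (hd : IsHandleDecomposition b H W B) {q} :
    H q ∈ B ↔ ‖(q.2.2 : Euc 2)‖ = 1 := by
  rw [hd.boundary_eq]
  constructor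
  · rintro (⟨⟨y, hy, h1⟩, h2⟩ | ⟨q', hq', h⟩)
    · by_contra hne
      exact h2 ⟨q, ⟨(hd.norm_of_mem_ball h1).2,
        lt_of_le_of_ne (mem_closedBall_zero_iff.1 q.2.2.2) hne⟩, rfl⟩
    · rw [← hd.handles.injective h]
      exact hq'
  · intro h
    exact Or.inr ⟨q, h, rfl⟩

theorem ball_mem_boundary_iff (hd : IsHandleDecomposition b H W B) {y} :
    b y ∈ B ↔ ‖(y : Euc 3)‖ = 1 ∧ ∀ q, b y = H q → ‖(q.2.2 : Euc 2)‖ = 1 := by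
  constructor
  · intro h
    refine ⟨?_, fun q hq => hd.handle_mem_boundary_iff.1 (hq ▸ h)⟩
    rw [hd.boundary_eq] at h
    rcases h with ⟨⟨y', hy', h1⟩, h2⟩ | ⟨q', hq', h⟩
    · rw [← hd.ball.injective h1]; exact hy'
    · exact (hd.norm_of_mem_ball h.symm).1
  · rintro ⟨h1, h2⟩
    rw [hd.boundary_eq]
    refine Or.inl ⟨⟨y, h1, rfl⟩, ?_⟩
    rintro ⟨q, hq, hqy⟩
    exact hq.2.ne (h2 q hqy.symm)

theorem boundary_subset (hd : IsHandleDecomposition b H W B) : B ⊆ W := by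
  rw [hd.boundary_eq, hd.eq_union]
  rintro x (⟨⟨y, -, rfl⟩, -⟩ | ⟨q, -, rfl⟩)
  · exact Or.inl ⟨y, rfl⟩
  · exact Or.inr ⟨q, rfl⟩

/-- The radial projection of the 0-handle to its boundary sphere, the identity elsewhere. -/
noncomputable def projBall (b : Disc 3 → S3) : S3 → S3 :=
  Function.extend b (fun y => b (radialProj y)) id

/-- The radial projection of the 1-handles to their sides, the identity elsewhere. -/
noncomputable def projHandles (H : Fin k × Set.Icc (-1 : ℝ) 1 × Disc 2 → S3) : S3 → S3 :=
  Function.extend H (fun q => H (q.1, q.2.1, radialProj q.2.2)) id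

/-- The cores of the 1-handles. -/
def cores (H : Fin k × Set.Icc (-1 : ℝ) 1 × Disc 2 → S3) : Set S3 :=
  H '' {q | (q.2.2 : Euc 2) = 0}

theorem isClosed_cores (hd : IsHandleDecomposition b H W B) : IsClosed (cores H) :=
  hd.handles.isClosedMap _ (isClosed_eq (by fun_prop) continuous_const)

theorem projBall_ball (hd : IsHandleDecomposition b H W B) (y) :
    projBall b (b y) = b (radialProj y) := hd.ball.injective.extend_apply _ _ _

/-- Handles meet the 0-handle only in its boundary sphere, which the radial projection fixes. The
two projections can therefore be performed one after the other. -/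
theorem projBall_handle (hd : IsHandleDecomposition b H W B) (q) : projBall b (H q) = H q := by
  by_cases h : ∃ y, b y = H q
  · obtain ⟨y, hy⟩ := h
    rw [← hy, hd.projBall_ball, radialProj_of_norm (hd.norm_of_mem_ball hy).1]
  · exact Function.extend_apply' _ _ _ h

theorem projHandles_handle (hd : IsHandleDecomposition b H W B) (q) :
    projHandles H (H q) = H (q.1, q.2.1, radialProj q.2.2) :=
  hd.handles.injective.extend_apply _ _ _

theorem projHandles_of_mem_boundary (hd : IsHandleDecomposition b H W B) {x} (hx : x ∈ B) :
    projHandles H x = x := by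
  by_cases h : ∃ q, H q = x
  · obtain ⟨q, rfl⟩ := h
    rw [hd.projHandles_handle, radialProj_of_norm (hd.handle_mem_boundary_iff.1 hx)]
  · exact Function.extend_apply' _ _ _ h

theorem projBall_of_mem_boundary (hd : IsHandleDecomposition b H W B) {x} (hx : x ∈ B) :
    projBall b x = x := by
  by_cases h : ∃ y, b y = x
  · obtain ⟨y, rfl⟩ := h
    rw [hd.projBall_ball, radialProj_of_norm (hd.ball_mem_boundary_iff.1 hx).1]
  · exact Function.extend_apply' _ _ _ h

theorem continuousOn_projBall (hd : IsHandleDecomposition b H W B) :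
    ContinuousOn (projBall b) (W \ {x | ∃ y : Disc 3, (y : Euc 3) = 0 ∧ b y = x}) := by
  refine ContinuousOn.of_isClosed_cover hd.ball.isClosed_range hd.handles.isClosed_range
    (by rw [hd.eq_union]; exact sdiff_subset) ?_ ?_
  · refine (hd.ball.isEmbedding.continuousOn_extend (hd.ball.continuous.comp_continuousOn
      continuousOn_radialProj)).mono ?_
    rintro _ ⟨⟨-, h0⟩, y, rfl⟩
    exact ⟨y, fun hy => h0 ⟨y, hy, rfl⟩, rfl⟩
  · refine continuousOn_id.congr ?_
    rintro _ ⟨-, q, rfl⟩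
    exact hd.projBall_handle q

theorem continuousOn_projHandles (hd : IsHandleDecomposition b H W B) (hB : IsClosed B) :
    ContinuousOn (projHandles H) ((b '' {y | ‖(y : Euc 3)‖ = 1} ∪ range H) \ cores H) := by
  refine ContinuousOn.of_isClosed_cover hB hd.handles.isClosed_range ?_ ?_ ?_
  · rintro x ⟨⟨y, hy, rfl⟩ | h, -⟩
    · by_cases hq : ∃ q, b y = H q
      · obtain ⟨q, hq⟩ := hq
        exact Or.inr ⟨q, hq.symm⟩
      · exact Or.inl (hd.ball_mem_boundary_iff.2 ⟨hy, fun q h => (hq ⟨q, h⟩).elim⟩)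
    · exact Or.inr h
  · refine continuousOn_id.congr ?_
    rintro x ⟨-, hx⟩
    exact hd.projHandles_of_mem_boundary hx
  · have h : ContinuousOn (fun q : Fin k × Icc (-1 : ℝ) 1 × Disc 2 =>
        H (q.1, q.2.1, radialProj q.2.2)) {q | (q.2.2 : Euc 2) ≠ 0} := by
      refine hd.handles.continuous.comp_continuousOn ?_
      refine continuousOn_fst.prodMk (ContinuousOn.prodMk (by fun_prop) ?_)
      exact continuousOn_radialProj.comp (by fun_prop) fun q hq => hq
    refine (hd.handles.isEmbedding.continuousOn_extend h).mono ?_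
    rintro _ ⟨⟨-, h0⟩, q, rfl⟩
    exact ⟨q, fun hy => h0 ⟨q, hy, rfl⟩, rfl⟩

theorem projHandles_mem_boundary (hd : IsHandleDecomposition b H W B) {x}
    (hx : x ∈ (b '' {y | ‖(y : Euc 3)‖ = 1} ∪ range H) \ cores H) : projHandles H x ∈ B := by
  by_cases hq : ∃ q, H q = x
  · obtain ⟨q, rfl⟩ := hq
    rw [hd.projHandles_handle, hd.handle_mem_boundary_iff]
    exact norm_radialProj fun h => hx.2 ⟨q, h, rfl⟩
  · have hxB : x ∈ B := by
      rcases hx.1 with ⟨y, hy, rfl⟩ | h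
      · exact hd.ball_mem_boundary_iff.2 ⟨hy, fun q h => (hq ⟨q, h.symm⟩).elim⟩
      · exact (hq h).elim
    rwa [hd.projHandles_of_mem_boundary hxB]

/-- A handlebody retracts to its boundary in the complement of a spine. -/
theorem exists_retraction (hd : IsHandleDecomposition b H W B) (hB : IsClosed B) :
    ∃ (Z : Set S3) (ρ : S3 → S3), IsClosed Z ∧ Z.Nonempty ∧ Disjoint Z B ∧ Z ⊆ W ∧
      ContinuousOn ρ (W \ Z) ∧ MapsTo ρ (W \ Z) B ∧ ∀ x ∈ B, ρ x = x := by
  let zero : Disc 3 := ⟨0, by simp⟩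
  -- The radii of the 0-handle ending at the ends of the cores. They belong to the spine because
  -- projecting them radially would land on the cores, where the second projection is undefined as a
  -- retraction.
  let K : Set (unitInterval × Disc 3) := {p | ‖(p.2 : Euc 3)‖ = 1 ∧ b p.2 ∈ cores H}
  have hK : IsCompact K := by
    refine IsClosed.isCompact (IsClosed.inter ?_ ?_)
    · exact isClosed_eq (by fun_prop) continuous_const
    · exact hd.isClosed_cores.preimage (hd.ball.continuous.comp continuous_snd)
  have hZK : IsClosed ((fun p : unitInterval × Disc 3 => b (discSmul p.1 p.2)) '' K) :=
    (hK.image (hd.ball.continuous.comp continuous_discSmul)).isClosed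
  have hmem : ∀ x ∈ W \ ({b zero} ∪ cores H ∪
      (fun p : unitInterval × Disc 3 => b (discSmul p.1 p.2)) '' K),
      projBall b x ∈ (b '' {y | ‖(y : Euc 3)‖ = 1} ∪ range H) \ cores H := by
    rintro x ⟨hxW, hx⟩
    rw [hd.eq_union] at hxW
    simp only [mem_union, mem_singleton_iff, not_or] at hx
    rcases hxW with ⟨y, rfl⟩ | ⟨q, rfl⟩
    · have hy : (y : Euc 3) ≠ 0 := fun h => hx.1.1 (congrArg b (Subtype.ext h))
      rw [hd.projBall_ball]
      refine ⟨Or.inl ⟨_, norm_radialProj hy, rfl⟩, fun hc => hx.2 ?_⟩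
      obtain ⟨t, ht⟩ := exists_discSmul_radialProj y
      exact ⟨(t, radialProj y), ⟨norm_radialProj hy, hc⟩, congrArg b ht⟩
    · rw [hd.projBall_handle]
      exact ⟨Or.inr ⟨q, rfl⟩, hx.1.2⟩
  refine ⟨{b zero} ∪ cores H ∪ (fun p : unitInterval × Disc 3 => b (discSmul p.1 p.2)) '' K,
    projHandles H ∘ projBall b, (isClosed_singleton.union hd.isClosed_cores).union hZK,
    ⟨b zero, Or.inl (Or.inl rfl)⟩, ?_, ?_, ?_, ?_, ?_⟩
  · rw [Set.disjoint_left]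
    have hcore : ∀ x ∈ cores H, x ∉ B := by
      rintro _ ⟨q, hq, rfl⟩ hB
      have := hd.handle_mem_boundary_iff.1 hB
      rw [show (q.2.2 : Euc 2) = 0 from hq, norm_zero] at this
      exact zero_ne_one this
    rintro x ((rfl | hx) | ⟨⟨t, y⟩, ⟨hy, hc⟩, rfl⟩) hxB
    · have := (hd.ball_mem_boundary_iff.1 hxB).1
      simp [zero] at this
    · exact hcore x hx hxB
    · have h1 := (hd.ball_mem_boundary_iff.1 hxB).1
      have h2 : (t : ℝ) = 1 := by
        rw [coe_discSmul, norm_smul, Real.norm_of_nonneg t.2.1, show ‖(y : Euc 3)‖ = 1 from hy,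
          mul_one] at h1
        exact h1
      have h3 : discSmul t y = y := Subtype.ext (by rw [coe_discSmul, h2, one_smul])
      exact hcore _ hc (by simpa only [h3] using hxB)
  · rw [hd.eq_union]
    rintro x ((rfl | ⟨q, -, rfl⟩) | ⟨p, -, rfl⟩)
    · exact Or.inl ⟨_, rfl⟩
    · exact Or.inr ⟨_, rfl⟩
    · exact Or.inl ⟨_, rfl⟩
  · refine (hd.continuousOn_projHandles hB).comp (hd.continuousOn_projBall.mono ?_) hmem
    refine sdiff_subset_sdiff_right ?_
    rintro x ⟨y, hy, rfl⟩
    exact Or.inl (Or.inl (congrArg b (Subtype.ext hy)))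
  · exact fun x hx => hd.projHandles_mem_boundary (hmem x hx)
  · intro x hx
    rw [Function.comp, hd.projBall_of_mem_boundary hx, hd.projHandles_of_mem_boundary hx]

end IsHandleDecomposition

section Unknotted

variable {W B Z : Set S3} {ρ : S3 → S3}

theorem exterior_inter (hBW : B ⊆ W) : exterior W B ∩ W = B := by
  ext x
  simp only [exterior, mem_inter_iff, mem_compl_iff, mem_sdiff, not_and, not_not]
  exact ⟨fun h => h.1 h.2, fun h => ⟨fun _ => h, hBW h⟩⟩

/-- The retraction of `W \ Z` to `B` is the identity on `B`, the common part with the exterior, so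
it glues with the identity of the exterior. -/
theorem exists_retraction_exterior (hW : IsClosed W) (hM : IsClosed (exterior W B)) (hBW : B ⊆ W)
    (hρ : ContinuousOn ρ (W \ Z)) (hρB : MapsTo ρ (W \ Z) B) (hid : ∀ x ∈ B, ρ x = x) :
    ∃ R : S3 → S3, ContinuousOn R Zᶜ ∧ MapsTo R Zᶜ (exterior W B) ∧ ∀ x ∈ exterior W B, R x = x := by
  classical
  have hB := exterior_inter hBW
  have hRM : ∀ x ∈ exterior W B, (exterior W B).piecewise id ρ x = x := fun x hx =>
    piecewise_eq_of_mem _ _ _ hx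
  have hRW : ∀ x ∈ W, (exterior W B).piecewise id ρ x = ρ x := by
    intro x hx
    by_cases hxM : x ∈ exterior W B
    · rw [hRM x hxM, hid x (hB ▸ ⟨hxM, hx⟩)]
    · exact piecewise_eq_of_notMem _ _ _ hxM
  have hcover : ∀ x, x ∈ exterior W B ∪ W := by
    intro x
    by_cases hx : x ∈ W
    · exact Or.inr hx
    · exact Or.inl fun h => hx h.1
  refine ⟨(exterior W B).piecewise id ρ, ?_, ?_, hRM⟩
  · refine ContinuousOn.of_isClosed_cover hM hW (fun x _ => hcover x) ?_ ?_
    · exact continuousOn_id.congr fun x hx => hRM x hx.2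
    · exact (hρ.mono fun x hx => ⟨hx.2, hx.1⟩).congr fun x hx => hRW x hx.2
  · intro x hx
    rcases hcover x with h | h
    · rw [hRM x h]; exact h
    · rw [hRW x h]
      exact (hB.symm ▸ hρB ⟨h, hx⟩ : ρ x ∈ exterior W B ∩ W).1

end Unknotted

/-- One retraction pushes the inside of `W` out to the exterior, and this suffices for `exterior W B
\ Γ`. Composing it with a retraction of the exterior handlebody, which is where unknottedness
enters, reaches the surface. -/
theorem IsUnknottedHandlebody.isOpenRetract {k : ℕ} {W B P Γ : Set S3}
    (hW : IsUnknottedHandlebody k W B) (hP : IsClosed P) (hΓ : IsClosed Γ) :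
    IsOpenRetract ↥(exterior W B \ Γ) ∧ IsOpenRetract ↥(B \ P) := by
  obtain ⟨hW, m, hM⟩ := hW
  obtain ⟨b, H, hd⟩ := hW.exists_isHandleDecomposition
  obtain ⟨b', H', hd'⟩ := hM.exists_isHandleDecomposition
  have hBW := hd.boundary_subset
  have hB : IsClosed B := exterior_inter hBW ▸ hd'.isClosed.inter hd.isClosed
  obtain ⟨Z, ρ, hZ, hZne, hZB, hZW, hρ, hρB, hid⟩ := hd.exists_retraction hB
  obtain ⟨Z', ρ', hZ', -, hZB', -, hρ', hρB', hid'⟩ := hd'.exists_retraction hB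
  obtain ⟨R, hR, hRM, hRid⟩ := exists_retraction_exterior hd.isClosed hd'.isClosed hBW hρ hρB hid
  have hMZ : exterior W B ⊆ Zᶜ := fun x hx hxZ =>
    disjoint_left.1 hZB hxZ ((exterior_inter hBW).subset ⟨hx, hZW hxZ⟩)
  have hne : ∀ C : Set S3, Zᶜ ∩ C ≠ univ := fun C h => by
    obtain ⟨z, hz⟩ := hZne
    exact (h.symm ▸ mem_univ z : z ∈ Zᶜ ∩ C).1 hz
  constructor
  · refine isOpenRetract_of_subset (V := Zᶜ ∩ R ⁻¹' Γᶜ) (ρ := R)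
      (hR.isOpen_inter_preimage hZ.isOpen_compl hΓ.isOpen_compl) (hne _)
      (hR.mono inter_subset_left) (fun x hx => ⟨hRM hx.1, hx.2⟩) ?_ fun x hx => hRid x hx.1
    exact fun x hx => ⟨hMZ hx.1, by rw [mem_preimage, hRid x hx.1]; exact hx.2⟩
  · have hBM : B ⊆ exterior W B := fun x hx h => h.2 hx
    have h1 : IsOpen (Zᶜ ∩ R ⁻¹' Z'ᶜ) := hR.isOpen_inter_preimage hZ.isOpen_compl hZ'.isOpen_compl
    have h2 : ContinuousOn (ρ' ∘ R) (Zᶜ ∩ R ⁻¹' Z'ᶜ) :=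
      hρ'.comp (hR.mono inter_subset_left) fun x hx => ⟨hRM hx.1, hx.2⟩
    have h3 : ∀ x ∈ B, (ρ' ∘ R) x = x := fun x hx => by
      rw [Function.comp, hRid x (hBM hx), hid' x hx]
    -- Successively excluded are the spine of `W`, the points sent to the spine of the exterior, and
    -- the points sent to `P`. The nonempty `Z` provides the missing point for stereographic
    -- projection.
    refine isOpenRetract_of_subset (V := (Zᶜ ∩ R ⁻¹' Z'ᶜ) ∩ (ρ' ∘ R) ⁻¹' Pᶜ) (ρ := ρ' ∘ R)
      (h2.isOpen_inter_preimage h1 hP.isOpen_compl) (by rw [inter_assoc]; exact hne _)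
      (h2.mono inter_subset_left) (fun x hx => ⟨hρB' ⟨hRM hx.1.1, hx.1.2⟩, hx.2⟩) ?_
      fun x hx => h3 x hx.1
    refine fun x hx => ⟨⟨hMZ (hBM hx.1), ?_⟩, ?_⟩
    · rw [mem_preimage, hRid x (hBM hx.1)]
      exact fun h => disjoint_left.1 hZB' h hx.1
    · rw [mem_preimage, h3 x hx.1]
      exact hx.2

end Handlebody


/-! ### A spatial graph does not separate the exterior. -/

section Connectivity

open Set

/-- A closed set with dense complement that does not separate locally does not separate. -/
theorem IsPreconnected.sdiff_of_locally {X : Type*} [TopologicalSpace X] {V L : Set X}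
    (hVc : IsPreconnected V) (hV : IsOpen V) (hL : IsClosed L) (hd : Dense Lᶜ)
    (hloc : ∀ x ∈ V ∩ L, ∃ N, IsOpen N ∧ x ∈ N ∧ N ⊆ V ∧ IsPreconnected (N \ L)) :
    IsPreconnected (V \ L) := by
  intro u v hu hv huv ⟨xu, hxu, hxu'⟩ ⟨xv, hxv, hxv'⟩
  by_contra hne
  have hdisj : ∀ x, x ∈ V → x ∉ L → x ∈ u → x ∈ v → False := fun x h1 h2 h3 h4 =>
    hne ⟨x, ⟨h1, h2⟩, h3, h4⟩
  -- `F w` enlarges the part of `V \ L` in `w` by the points of `L` near which the complement of `L`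
  -- lies in `w`. Local connectedness of the complement makes `F u` and `F v` cover `V`, and density
  -- of the complement shows that an overlap already occurs off `L`.
  let F : Set X → Set X := fun w => ⋃₀ {N | IsOpen N ∧ N ⊆ V ∧ N \ L ⊆ w}
  have hFo : ∀ w, IsOpen (F w) := fun w => isOpen_sUnion fun N hN => hN.1
  have hF : ∀ w x, x ∈ F w → x ∉ L → x ∈ w := fun w x ⟨N, hN, hx⟩ hxL => hN.2.2 ⟨hx, hxL⟩
  have hFV : ∀ w x, x ∈ F w → x ∈ V := fun w x ⟨N, hN, hx⟩ => hN.2.1 hx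
  have hself : ∀ w, IsOpen w → ∀ x ∈ V \ L, x ∈ w → x ∈ F w := fun w hw x hx hxw =>
    ⟨(V \ L) ∩ w, ⟨(hV.sdiff hL).inter hw, fun y hy => hy.1.1, fun y hy => hy.1.2⟩, hx, hxw⟩
  obtain ⟨z, hzV, hzu, hzv⟩ := hVc (F u) (F v) (hFo u) (hFo v) (by
    intro x hx
    by_cases hxL : x ∈ L
    · obtain ⟨N, hNo, hxN, hNV, hNc⟩ := hloc x ⟨hx, hxL⟩
      by_cases h : ((N \ L) ∩ u).Nonempty
      · refine Or.inl ⟨N, ⟨hNo, hNV, fun y hy => ?_⟩, hxN⟩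
        by_contra hyu
        obtain ⟨w, ⟨hw1, hw2⟩, hw3, hw4⟩ := hNc u v hu hv
          (fun y hy => huv ⟨hNV hy.1, hy.2⟩) h
          ⟨y, hy, (huv ⟨hNV hy.1, hy.2⟩).resolve_left hyu⟩
        exact hdisj w (hNV hw1) hw2 hw3 hw4
      · refine Or.inr ⟨N, ⟨hNo, hNV, fun y hy => ?_⟩, hxN⟩
        exact (huv ⟨hNV hy.1, hy.2⟩).resolve_left fun hyu => h ⟨y, hy, hyu⟩
    · exact (huv ⟨hx, hxL⟩).imp (hself u hu x ⟨hx, hxL⟩) (hself v hv x ⟨hx, hxL⟩))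
    ⟨xu, hxu.1, hself u hu xu hxu hxu'⟩ ⟨xv, hxv.1, hself v hv xv hxv hxv'⟩
  obtain ⟨w, hw, hwL⟩ := hd.exists_mem_open ((hFo u).inter (hFo v)) ⟨z, hzu, hzv⟩
  exact hdisj w (hFV u w hwL.1) hw (hF u w hwL.1 hw) (hF v w hwL.2 hw)

theorem one_lt_rank_quotient_span_singleton (w : Euc 3) :
    1 < Module.rank ℝ (Euc 3 ⧸ Submodule.span ℝ {w}) := by
  have h1 := Submodule.finrank_quotient_add_finrank (Submodule.span ℝ {w})
  have h2 : Module.finrank ℝ (Submodule.span ℝ {w}) ≤ 1 := (finrank_span_le_card {w}).trans (by simp)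
  rw [finrank_euclideanSpace_fin] at h1
  rw [← Module.finrank_eq_rank, ← Nat.cast_one, Nat.cast_lt]
  omega

/-- The standard homeomorphism from the whole space to the ball multiplies each vector by a nonzero
scalar, so it preserves the line. The complement of a line in `ℝ³` is connected because the line has
codimension greater than one. -/
theorem isPreconnected_ball_diff_line (c w : Euc 3) {r : ℝ} (hr : 0 < r) :
    IsPreconnected (Metric.ball c r \ {x | x - c ∈ Submodule.span ℝ {w}}) := by
  let φ := OpenPartialHomeomorph.univBall c r
  have hφ : ∀ x : Euc 3, φ x - c = (r * (√(1 + ‖x‖ ^ 2))⁻¹) • x := by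
    intro x
    simp only [φ, OpenPartialHomeomorph.univBall, dif_pos hr]
    change r • ((√(1 + ‖x‖ ^ 2))⁻¹ • x) + c - c = _
    rw [add_sub_cancel_right, smul_smul]
  have hφ' : ∀ x : Euc 3, φ x - c ∈ Submodule.span ℝ {w} ↔ x ∈ Submodule.span ℝ {w} := by
    intro x
    rw [hφ]
    refine Submodule.smul_mem_iff _ (mul_ne_zero hr.ne' (inv_ne_zero ?_))
    exact (Real.sqrt_pos.2 (by positivity)).ne'
  have hcont : ContinuousOn φ univ := by
    rw [← OpenPartialHomeomorph.univBall_source c r]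
    exact φ.continuousOn
  have himage : Metric.ball c r \ {x | x - c ∈ Submodule.span ℝ {w}} =
      φ '' ((Submodule.span ℝ {w} : Submodule ℝ (Euc 3)) : Set (Euc 3))ᶜ := by
    ext x
    rw [← OpenPartialHomeomorph.univBall_target c hr]
    constructor
    · rintro ⟨hx, hxL⟩
      refine ⟨φ.symm x, fun h => hxL ?_, φ.right_inv hx⟩
      rw [mem_ofPred_eq, ← φ.right_inv hx]
      exact (hφ' _).2 h
    · rintro ⟨y, hy, rfl⟩
      exact ⟨φ.map_source (by simp [φ]), fun h => hy ((hφ' y).1 h)⟩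
  rw [himage]
  exact (isConnected_compl_of_one_lt_codim
    (one_lt_rank_quotient_span_singleton w)).isPreconnected.image φ (hcont.mono (subset_univ _))

theorem dense_compl_line (c w : Euc 3) : Dense {x : Euc 3 | x - c ∈ Submodule.span ℝ {w}}ᶜ := by
  have h1 : (Submodule.span ℝ {w} : Submodule ℝ (Euc 3)) ≠ ⊤ := by
    intro h
    have h2 : Module.finrank ℝ (Submodule.span ℝ {w}) ≤ 1 := (finrank_span_le_card {w}).trans (by simp)
    rw [h, finrank_top, finrank_euclideanSpace_fin] at h2
    omega
  have h2 : Dense ((Submodule.span ℝ {w} : Submodule ℝ (Euc 3)) : Set (Euc 3))ᶜ :=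
    interior_eq_empty_iff_dense_compl.1
      (not_nonempty_iff_eq_empty.1 fun h => h1 (Submodule.eq_top_of_nonempty_interior' _ h))
  exact h2.preimage (Homeomorph.subRight c).isOpenMap

theorem segment_subset_line {u v p : Euc 3} (hp : p ∈ segment ℝ u v) :
    segment ℝ u v ⊆ {x | x - p ∈ Submodule.span ℝ {v - u}} := by
  rw [segment_eq_image'] at hp ⊢
  obtain ⟨t, -, rfl⟩ := hp
  rintro _ ⟨s, -, rfl⟩
  refine Submodule.mem_span_singleton.2 ⟨s - t, ?_⟩
  module

/-- A segment does not separate connected open sets in the 3-sphere. -/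
theorem IsPreconnected.sdiff_segment {V : Set S3} (hVc : IsPreconnected V) (hV : IsOpen V)
    (u v : Euc 3) :
    IsOpen (V \ (fun x : Euc 3 => (x : S3)) '' segment ℝ u v) ∧
      IsPreconnected (V \ (fun x : Euc 3 => (x : S3)) '' segment ℝ u v) := by
  have hemb : IsOpenEmbedding fun x : Euc 3 => (x : S3) := OnePoint.isOpenEmbedding_coe
  have hcpt : IsCompact (segment ℝ u v) := by
    rw [segment_eq_image]
    exact isCompact_Icc.image (by fun_prop)
  have hL : IsClosed ((fun x : Euc 3 => (x : S3)) '' segment ℝ u v) :=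
    (hcpt.image hemb.continuous).isClosed
  refine ⟨hV.sdiff hL, hVc.sdiff_of_locally hV hL ?_ ?_⟩
  · have h1 : Dense (segment ℝ u v)ᶜ := (dense_compl_line u (v - u)).mono
      (compl_subset_compl.2 (segment_subset_line (left_mem_segment ℝ u v)))
    refine (OnePoint.denseRange_coe.dense_image hemb.continuous h1).mono ?_
    rintro _ ⟨x, hx, rfl⟩ ⟨y, hy, hyx⟩
    exact hx (hemb.injective hyx ▸ hy)
  · rintro _ ⟨hpV, p, hp, rfl⟩
    obtain ⟨r, hr, hball⟩ := Metric.isOpen_iff.1 (hV.preimage hemb.continuous) p hpV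
    refine ⟨(fun x : Euc 3 => (x : S3)) '' Metric.ball p r, hemb.isOpenMap _ Metric.isOpen_ball,
      ⟨p, Metric.mem_ball_self hr, rfl⟩, image_subset_iff.2 hball, ?_⟩
    rw [← image_sdiff hemb.injective]
    refine IsPreconnected.image ?_ _ hemb.continuous.continuousOn
    -- The ball minus the segment lies between the ball minus the whole line and its closure, so end
    -- points of the segment need no separate treatment.
    refine (isPreconnected_ball_diff_line p (v - u) hr).subset_closure
      (sdiff_subset_sdiff_right (segment_subset_line hp)) ?_
    exact sdiff_subset.trans
      ((dense_compl_line p (v - u)).open_subset_closure_inter Metric.isOpen_ball)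

theorem IsPreconnected.sdiff_iUnion_segment {V : Set S3} (hVc : IsPreconnected V) (hV : IsOpen V)
    {n : ℕ} (u v : Fin n → Euc 3) :
    IsPreconnected (V \ ⋃ i, (fun x : Euc 3 => (x : S3)) '' segment ℝ (u i) (v i)) := by
  classical
  have key : ∀ s : Finset (Fin n),
      IsOpen (V \ ⋃ i ∈ s, (fun x : Euc 3 => (x : S3)) '' segment ℝ (u i) (v i)) ∧
      IsPreconnected (V \ ⋃ i ∈ s, (fun x : Euc 3 => (x : S3)) '' segment ℝ (u i) (v i)) := by
    intro s
    induction s using Finset.induction_on with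
    | empty => simpa using ⟨hV, hVc⟩
    | insert a s _ ih =>
      rw [Finset.set_biUnion_insert, union_comm, ← sdiff_sdiff]
      exact ih.2.sdiff_segment ih.1 _ _
  simpa using (key Finset.univ).2

theorem IsSpatialGraph.isClosed {Γ : Set S3} (hΓ : IsSpatialGraph Γ) : IsClosed Γ := by
  obtain ⟨n, u, v, K, -, hK, hΓ⟩ := hΓ
  have hL : IsClosed (⋃ i, (fun x : Euc 3 => (x : S3)) '' segment ℝ (u i) (v i)) := by
    refine isClosed_iUnion_of_finite fun i => IsCompact.isClosed (IsCompact.image ?_ ?_)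
    · rw [segment_eq_image]
      exact isCompact_Icc.image (by fun_prop)
    · exact OnePoint.continuous_coe
  rw [← preimage_image_eq Γ (hK 1).injective, hΓ]
  exact hL.preimage (hK 1).continuous

/-- A spatial graph does not separate connected open sets. -/
theorem IsSpatialGraph.isPreconnected_sdiff {Γ V : Set S3} (hΓ : IsSpatialGraph Γ)
    (hVc : IsPreconnected V) (hV : IsOpen V) : IsPreconnected (V \ Γ) := by
  obtain ⟨n, u, v, K, -, hK, hΓ⟩ := hΓ
  have h := (hVc.image _ (hK 1).continuous.continuousOn).sdiff_iUnion_segment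
    ((hK 1).isOpenMap _ hV) u v
  rw [← hΓ, ← image_sdiff (hK 1).injective] at h
  exact (hK 1).isInducing.isPreconnected_image.1 h

theorem isPreconnected_disc_interior (n : ℕ) :
    IsPreconnected {y : Disc n | ‖(y : Euc n)‖ < 1} := by
  refine IsInducing.subtypeVal.isPreconnected_image.1 ?_
  convert! (convex_ball (0 : Euc n) 1).isPreconnected
  ext y
  simp only [mem_image, mem_ofPred_eq, Subtype.exists, exists_and_left, exists_prop, exists_eq_right_right,
    mem_ball_zero_iff, mem_closedBall_zero_iff]
  exact ⟨fun h => h.1, fun h => ⟨h, h.le⟩⟩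

theorem dense_disc_interior (n : ℕ) : Dense {y : Disc n | ‖(y : Euc n)‖ < 1} := by
  intro y
  rw [IsInducing.subtypeVal.closure_eq_preimage_closure_image]
  have : Subtype.val '' {y : Disc n | ‖(y : Euc n)‖ < 1} = Metric.ball (0 : Euc n) 1 := by
    ext y
    simp only [mem_image, mem_ofPred_eq, Subtype.exists, exists_and_left, exists_prop, exists_eq_right_right,
      mem_ball_zero_iff, mem_closedBall_zero_iff]
    exact ⟨fun h => h.1, fun h => ⟨h, h.le⟩⟩
  rw [this, mem_preimage, closure_ball _ one_ne_zero]
  exact y.2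

instance : PreconnectedSpace (Icc (-1 : ℝ) 1) := Subtype.preconnectedSpace isPreconnected_Icc

namespace IsHandleDecomposition

variable {k : ℕ} {b : Disc 3 → S3} {H : Fin k × Set.Icc (-1 : ℝ) 1 × Disc 2 → S3} {W B : Set S3}

theorem ball_interior_notMem (hd : IsHandleDecomposition b H W B) {y : Disc 3}
    (hy : ‖(y : Euc 3)‖ < 1) : b y ∉ B :=
  fun h => hy.ne (hd.ball_mem_boundary_iff.1 h).1

theorem handle_interior_notMem (hd : IsHandleDecomposition b H W B) {q}
    (hq : ‖(q.2.2 : Euc 2)‖ < 1) : H q ∉ B :=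
  fun h => hq.ne (hd.handle_mem_boundary_iff.1 h)

theorem subset_closure_interior (hd : IsHandleDecomposition b H W B) : W ⊆ closure (W \ B) := by
  intro x hx
  rw [hd.eq_union] at hx
  rcases hx with ⟨y, rfl⟩ | ⟨⟨i, s, x⟩, rfl⟩
  · refine map_mem_closure hd.ball.continuous (dense_disc_interior 3 y) fun y hy => ⟨?_, ?_⟩
    · rw [hd.eq_union]; exact Or.inl ⟨y, rfl⟩
    · exact hd.ball_interior_notMem hy
  · refine map_mem_closure (f := fun x => H (i, s, x)) (hd.handles.continuous.comp (by fun_prop))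
      (dense_disc_interior 2 x) fun x hx => ⟨?_, ?_⟩
    · rw [hd.eq_union]; exact Or.inr ⟨_, rfl⟩
    · exact hd.handle_interior_notMem hx

theorem isPreconnected_interior (hd : IsHandleDecomposition b H W B) :
    IsPreconnected (W \ B) := by
  have hball : IsPreconnected (b '' {y | b y ∉ B}) := by
    refine IsPreconnected.image ?_ _ hd.ball.continuous.continuousOn
    exact (isPreconnected_disc_interior 3).subset_closure (fun y hy => hd.ball_interior_notMem hy)
      fun y _ => dense_disc_interior 3 y
  have hhandle : ∀ i, IsPreconnected
      ((fun q : Icc (-1 : ℝ) 1 × Disc 2 => H (i, q)) ''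
        (univ ×ˢ {x : Disc 2 | ‖(x : Euc 2)‖ < 1})) := by
    intro i
    refine IsPreconnected.image (isPreconnected_univ.prod (isPreconnected_disc_interior 2)) _ ?_
    exact (hd.handles.continuous.comp (by fun_prop)).continuousOn
  have heq : W \ B = ⋃ j : Option (Fin k), j.elim (b '' {y | b y ∉ B}) fun i =>
      (b '' {y | b y ∉ B}) ∪ (fun q : Icc (-1 : ℝ) 1 × Disc 2 => H (i, q)) ''
        (univ ×ˢ {x : Disc 2 | ‖(x : Euc 2)‖ < 1}) := by
    ext x
    rw [mem_sdiff, hd.eq_union, mem_iUnion]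
    constructor
    · rintro ⟨⟨y, rfl⟩ | ⟨⟨i, q⟩, rfl⟩, hx⟩
      · exact ⟨none, y, hx, rfl⟩
      · refine ⟨some i, Or.inr ⟨q, ⟨mem_univ _, ?_⟩, rfl⟩⟩
        refine lt_of_le_of_ne (mem_closedBall_zero_iff.1 q.2.2) fun h => hx ?_
        exact hd.handle_mem_boundary_iff.2 h
    · rintro ⟨_ | i, hx⟩
      · obtain ⟨y, hy, rfl⟩ := hx
        exact ⟨Or.inl ⟨y, rfl⟩, hy⟩
      · rcases hx with ⟨y, hy, rfl⟩ | ⟨q, hq, rfl⟩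
        · exact ⟨Or.inl ⟨y, rfl⟩, hy⟩
        · exact ⟨Or.inr ⟨_, rfl⟩, hd.handle_interior_notMem hq.2⟩
  let zero : Disc 3 := ⟨0, by simp⟩
  have hzero : b zero ∈ b '' {y | b y ∉ B} :=
    ⟨zero, hd.ball_interior_notMem (by simp [zero]), rfl⟩
  rw [heq]
  refine isPreconnected_iUnion ⟨b zero, mem_iInter.2 ?_⟩ ?_
  · rintro (_ | i)
    · exact hzero
    · exact Or.inl hzero
  · rintro (_ | i)
    · exact hball
    · let q : Icc (-1 : ℝ) 1 × Disc 2 := (⟨1, by simp⟩, ⟨0, by simp⟩)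
      obtain ⟨y, hy⟩ := (hd.mem_ball_iff (i, q)).2 (by simp [q])
      have hq : H (i, q) ∉ B := hd.handle_interior_notMem (by simp [q])
      refine IsPreconnected.union (H (i, q)) ⟨y, ?_, hy⟩ ⟨q, ⟨mem_univ _, ?_⟩, rfl⟩ hball
        (hhandle i)
      · rw [mem_ofPred_eq, hy]; exact hq
      · simp [q]

end IsHandleDecomposition

/-- The exterior of an unknotted handlebody minus a spatial graph is connected. -/
theorem IsUnknottedHandlebody.isPreconnected_exterior_sdiff {k : ℕ} {W B Γ : Set S3}
    (hW : IsUnknottedHandlebody k W B) (hΓ : IsSpatialGraph Γ) :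
    IsPreconnected (exterior W B \ Γ) := by
  obtain ⟨hW, m, hM⟩ := hW
  obtain ⟨b, H, hd⟩ := hW.exists_isHandleDecomposition
  obtain ⟨b', H', hd'⟩ := hM.exists_isHandleDecomposition
  have hopen : exterior W B \ B = Wᶜ := by
    ext x
    simp only [exterior, mem_sdiff, mem_compl_iff, not_and, not_not]
    exact ⟨fun h hx => h.2 (h.1 hx), fun h => ⟨fun hx => (h hx).elim,
      fun hx => h (hd.boundary_subset hx)⟩⟩
  -- The graph is first removed from the interior of the exterior, which is open in the 3-sphere.
  -- The boundary points off `Γ` are then added as limit points.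
  have h1 : IsPreconnected ((exterior W B \ B) \ Γ) :=
    hΓ.isPreconnected_sdiff hd'.isPreconnected_interior (hopen ▸ hd.isClosed.isOpen_compl)
  refine h1.subset_closure (fun x hx => ⟨hx.1.1, hx.2⟩) fun x hx => ?_
  have := hΓ.isClosed.isOpen_compl.inter_closure ⟨hx.2, hd'.subset_closure_interior hx.1⟩
  rwa [inter_comm] at this

end Connectivity


/-! ### Continuous logarithms and separation of the 2-sphere. -/

section Logarithms

open Set

/-- The contraction is a homotopy from the constant `f y₀` to `f`. The constant has a logarithm, and
the homotopy lifts through the covering `exp`. -/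
theorem exists_log_of_contraction {Y : Type*} [TopologicalSpace Y] {y₀ : Y}
    (c : C(unitInterval × Y, Y)) (h0 : ∀ y, c (0, y) = y₀) (h1 : ∀ y, c (1, y) = y)
    (f : C(Y, ℂ)) (hf : ∀ y, f y ≠ 0) : ∃ g : C(Y, ℂ), ∀ y, Complex.exp (g y) = f y := by
  let K : C(unitInterval × Y, {z : ℂ // z ≠ 0}) :=
    ⟨fun p => ⟨f (c p), hf _⟩, (f.continuous.comp c.continuous).subtype_mk _⟩
  have hK : ∀ y, K (0, y) = (⟨_, Complex.exp_ne_zero _⟩ : {z : ℂ // z ≠ 0}) := fun y =>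
    Subtype.ext (show f (c (0, y)) = Complex.exp (Complex.log (f y₀)) by
      rw [h0, Complex.exp_log (hf _)])
  let g := Complex.isCoveringMap_exp.liftHomotopy K (.const Y (Complex.log (f y₀))) hK
  refine ⟨⟨fun y => g (1, y), by fun_prop⟩, fun y => ?_⟩
  have h := congrFun (Complex.isCoveringMap_exp.liftHomotopy_lifts K
    (.const Y (Complex.log (f y₀))) hK) (1, y)
  exact (congrArg Subtype.val h).trans (congrArg f (h1 y))

/-- Nonvanishing continuous complex functions on `K` have continuous logarithms. -/
def HasLogs {X : Type*} [TopologicalSpace X] (K : Set X) : Prop :=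
  ∀ f : X → ℂ, ContinuousOn f K → (∀ x ∈ K, f x ≠ 0) →
    ∃ g : X → ℂ, ContinuousOn g K ∧ ∀ x ∈ K, Complex.exp (g x) = f x

namespace HasLogs

variable {X Y : Type*} [TopologicalSpace X] [TopologicalSpace Y]

theorem singleton (x : X) : HasLogs {x} := by
  intro f _ hf
  refine ⟨fun _ => Complex.log (f x), continuousOn_const, ?_⟩
  rintro _ rfl
  exact Complex.exp_log (hf _ rfl)

theorem iUnion {ι : Type*} [Finite ι] {K : ι → Set X} (hc : ∀ i, IsClosed (K i))
    (hd : ∀ i j, i ≠ j → Disjoint (K i) (K j)) (h : ∀ i, HasLogs (K i)) :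
    HasLogs (⋃ i, K i) := by
  classical
  intro f hf hf0
  choose g hg hgf using fun i => h i f (hf.mono (subset_iUnion K i))
    fun x hx => hf0 x (mem_iUnion_of_mem i hx)
  let G : X → ℂ := fun x => if hx : ∃ i, x ∈ K i then g hx.choose x else 0
  have hG : ∀ i, ∀ x ∈ K i, G x = g i x := by
    intro i x hx
    have hx' : ∃ i, x ∈ K i := ⟨i, hx⟩
    have : hx'.choose = i := by
      by_contra hne
      exact disjoint_left.1 (hd _ _ hne) hx'.choose_spec hx
    simp only [G, dif_pos hx', this]
  refine ⟨G, ?_, fun x hx => ?_⟩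
  · exact LocallyFinite.continuousOn_iUnion (locallyFinite_of_finite K) hc
      fun i => (hg i).congr (hG i)
  · obtain ⟨i, hi⟩ := mem_iUnion.1 hx
    rw [hG i x hi, hgf i x hi]

theorem union {K L : Set X} (hK : IsClosed K) (hL : IsClosed L) (hd : Disjoint K L)
    (h : HasLogs K) (h' : HasLogs L) : HasLogs (K ∪ L) := by
  rw [union_eq_iUnion]
  refine HasLogs.iUnion ?_ ?_ ?_
  · rintro (_ | _) <;> assumption
  · rintro (_ | _) (_ | _) hne <;> first | exact (hne rfl).elim | exact hd | exact hd.symm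
  · rintro (_ | _) <;> assumption

theorem image {φ : X → Y} (hφ : IsEmbedding φ) {K : Set X} (h : HasLogs K) :
    HasLogs (φ '' K) := by
  intro f hf hf0
  obtain ⟨g, hg, hgf⟩ := h (f ∘ φ) (hf.comp hφ.continuous.continuousOn (mapsTo_image φ K))
    fun x hx => hf0 _ (mem_image_of_mem φ hx)
  refine ⟨Function.extend φ g 0, hφ.continuousOn_extend hg, ?_⟩
  rintro _ ⟨x, hx, rfl⟩
  rw [hφ.injective.extend_apply]
  exact hgf x hx

theorem preimage {φ : X → Y} (hφ : IsEmbedding φ) {K : Set Y} (hK : K ⊆ range φ)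
    (h : HasLogs K) : HasLogs (φ ⁻¹' K) := by
  intro f hf hf0
  have hK' : φ '' (φ ⁻¹' K) = K := image_preimage_eq_of_subset hK
  obtain ⟨g, hg, hgf⟩ := h (Function.extend φ f 0) (by
    rw [← hK']; exact hφ.continuousOn_extend hf) (by
    rw [← hK']
    rintro _ ⟨x, hx, rfl⟩
    rw [hφ.injective.extend_apply]
    exact hf0 x hx)
  refine ⟨g ∘ φ, hg.comp hφ.continuous.continuousOn fun x hx => hx, fun x hx => ?_⟩
  rw [Function.comp, hgf _ hx, hφ.injective.extend_apply]

theorem of_star {n : ℕ} {A : Set (Disc n)} (hA : ∀ t, ∀ a ∈ A, discSmul t a ∈ A) :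
    HasLogs A := by
  classical
  intro f hf hf0
  rcases A.eq_empty_or_nonempty with rfl | ⟨a₀, ha₀⟩
  · exact ⟨0, continuousOn_empty _, fun x hx => hx.elim⟩
  let c : C(unitInterval × A, A) := ⟨fun p => ⟨discSmul p.1 p.2, hA _ _ p.2.2⟩, by
    refine Continuous.subtype_mk ?_ _
    exact continuous_discSmul.comp
      (continuous_fst.prodMk (continuous_subtype_val.comp continuous_snd))⟩
  have hz : ∀ y : Disc n, discSmul 0 y = discSmul 0 a₀ := fun y => Subtype.ext (by simp)
  obtain ⟨g, hg⟩ := exists_log_of_contraction (y₀ := ⟨discSmul 0 a₀, hA _ _ ha₀⟩) c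
    (fun y => Subtype.ext (hz y)) (fun y => Subtype.ext (Subtype.ext (by simp [c])))
    ⟨A.domRestrict f, continuousOn_iff_continuous_domRestrict.1 hf⟩ fun y => hf0 _ y.2
  refine ⟨fun x => if hx : x ∈ A then g ⟨x, hx⟩ else 0, ?_, fun x hx => ?_⟩
  · rw [continuousOn_iff_continuous_domRestrict]
    convert! g.continuous
    ext x
    simp [Set.domRestrict]
  · simp only [dif_pos hx]
    exact hg ⟨x, hx⟩

end HasLogs

/-- A continuous nonvanishing function on the plane cannot agree with `z - p` outside of a
disc. -/
theorem exists_ne_sub_of_ne_zero (F : C(ℂ, ℂ)) (hF : ∀ z, F z ≠ 0) (p : ℂ) {R : ℝ} (hR : 0 < R) :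
    ∃ z, ‖z - p‖ = R ∧ F z ≠ z - p := by
  by_contra! h
  obtain ⟨g, hg⟩ := exists_log_of_contraction (y₀ := 0)
    (⟨fun q : unitInterval × ℂ => ((q.1 : ℝ) : ℂ) * q.2, by fun_prop⟩) (by simp) (by simp) F hF
  let z : ℝ → ℂ := fun t => p + R * Complex.exp (t * Complex.I)
  have hz : ∀ t, ‖z t - p‖ = R := fun t => by
    simp only [z, add_sub_cancel_left, norm_mul, Complex.norm_real, Complex.norm_exp_ofReal_mul_I,
      mul_one, Real.norm_of_nonneg hR.le]
  have hexp : ∀ t, Complex.exp (g (z t)) = R * Complex.exp (t * Complex.I) := fun t => by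
    rw [hg, h _ (hz t), add_sub_cancel_left]
  have h0 : Complex.exp (g (z 0)) = R := by rw [hexp]; simp
  -- A winding number argument: by uniqueness of lifts, a logarithm along the circle gains `2πi` in
  -- one turn, whereas `g ∘ z` is periodic.
  have heq : (fun t => g (z t)) = fun t : ℝ => (t : ℂ) * Complex.I + g (z 0) := by
    refine Complex.isCoveringMap_exp.eq_of_comp_eq (by fun_prop) (by fun_prop) ?_ 0 (by simp)
    refine funext fun t => Subtype.ext ?_
    change Complex.exp (g (z t)) = Complex.exp ((t : ℂ) * Complex.I + g (z 0))
    rw [hexp, Complex.exp_add, h0, mul_comm]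
  have h2 := congrFun heq (2 * Real.pi)
  have h3 : z (2 * Real.pi) = z 0 := by simp [z]
  simp only [h3] at h2
  have h4 : ((2 * Real.pi : ℝ) : ℂ) * Complex.I = 0 := by
    linear_combination -h2
  simp [Real.pi_ne_zero] at h4

theorem exists_chart_sphere (q : Metric.sphere (0 : Euc 3) 1) :
    ∃ Ψ : OpenPartialHomeomorph (Metric.sphere (0 : Euc 3) 1) ℂ,
      Ψ.source = {q}ᶜ ∧ Ψ.target = univ := by
  have : Fact (Module.finrank ℝ (Euc 3) = 2 + 1) := ⟨by simp⟩
  refine ⟨(stereographic' 2 q).trans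
    Complex.orthonormalBasisOneI.repr.symm.toHomeomorph.toOpenPartialHomeomorph, ?_, ?_⟩
  · ext x
    simp
  · ext x
    simp

/-- A compact subset of the 2-sphere with continuous logarithms does not separate the sphere. -/
theorem HasLogs.isPreconnected_compl {K : Set (Metric.sphere (0 : Euc 3) 1)} (hK : IsClosed K)
    (h : HasLogs K) : IsPreconnected Kᶜ := by
  classical
  intro u v hu hv huv ⟨p, hpK, hpu⟩ ⟨q, hqK, hqv⟩
  by_contra hne
  have hdisj : ∀ x, x ∉ K → x ∈ u → x ∈ v → False := fun x h1 h2 h3 => hne ⟨x, h1, h2, h3⟩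
  obtain ⟨Ψ, hs, ht⟩ := exists_chart_sphere q
  have hsymm : Continuous Ψ.symm := by
    rw [← continuousOn_univ, ← ht]; exact Ψ.continuousOn_symm
  have hsource : ∀ x, x ≠ q → x ∈ Ψ.source := fun x hx => by rw [hs]; exact hx
  have hleft : ∀ x, x ≠ q → Ψ.symm (Ψ x) = x := fun x hx => Ψ.left_inv (hsource x hx)
  have hpq : p ≠ q := fun h => hdisj p hpK hpu (h ▸ hqv)
  have hKs : ∀ x ∈ K, x ≠ q := fun x hx h => hqK (h ▸ hx)
  let K' : Set ℂ := Ψ.symm ⁻¹' K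
  have hK' : IsClosed K' := hK.preimage hsymm
  let U : Set ℂ := Ψ.symm ⁻¹' (Kᶜ ∩ u)
  have hU : IsOpen U := (hK.isOpen_compl.inter hu).preimage hsymm
  have hU' : IsOpen (Ψ.symm ⁻¹' (Kᶜ ∩ v)) := (hK.isOpen_compl.inter hv).preimage hsymm
  -- The part `v` of the complement contains `q`, which corresponds to infinity, so the other part
  -- `U` is bounded.
  obtain ⟨r, hr⟩ : ∃ r, ∀ z ∈ U, ‖z - Ψ p‖ ≤ r := by
    have hc : IsCompact (Ψ '' (Kᶜ ∩ v)ᶜ) := by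
      refine (hK.isOpen_compl.inter hv).isClosed_compl.isCompact.image_of_continuousOn
        (Ψ.continuousOn.mono fun x hx => hsource x ?_)
      rintro rfl
      exact hx ⟨hqK, hqv⟩
    obtain ⟨r, hr⟩ := hc.isBounded.subset_closedBall (Ψ p)
    refine ⟨r, fun z hz => ?_⟩
    have hz' : z ∈ Ψ '' (Kᶜ ∩ v)ᶜ :=
      ⟨Ψ.symm z, fun h' => hdisj _ h'.1 hz.2 h'.2, Ψ.right_inv (by rw [ht]; trivial)⟩
    have := hr hz'
    rwa [Metric.mem_closedBall, dist_eq_norm] at this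
  obtain ⟨g, hg, hgf⟩ := h (fun x => Ψ x - Ψ p)
    ((Ψ.continuousOn.mono fun x hx => hsource x (hKs x hx)).sub continuousOn_const)
    fun x hx h0 => hpK (Ψ.injOn (hsource x (hKs x hx)) (hsource p hpq) (sub_eq_zero.1 h0) ▸ hx)
  have hg' : ContinuousOn (g ∘ Ψ.symm) K' := hg.comp hsymm.continuousOn fun x hx => hx
  obtain ⟨L, hL⟩ := ContinuousMap.exists_restrict_eq hK'
    ⟨K'.domRestrict (g ∘ Ψ.symm), continuousOn_iff_continuous_domRestrict.1 hg'⟩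
  have hLK : ∀ z ∈ K', Complex.exp (L z) = z - Ψ p := by
    intro z hz
    have h1 : L z = g (Ψ.symm z) := DFunLike.congr_fun hL ⟨z, hz⟩
    rw [h1, hgf _ hz, Ψ.right_inv (by rw [ht]; trivial)]
  have hfront : ∀ z ∈ frontier U, z ∈ K' := by
    intro z hz
    by_contra hzK
    rw [hU.frontier_eq] at hz
    rcases huv hzK with h1 | h1
    · exact hz.2 ⟨hzK, h1⟩
    · obtain ⟨w, hw, hwU⟩ := mem_closure_iff.1 hz.1 _ hU' ⟨hzK, h1⟩
      exact hdisj _ hw.1 hwU.2 hw.2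
  -- The logarithm of `z - Ψ p` on `K'`, extended by Tietze, replaces `z - Ψ p` on `U` by a
  -- nonvanishing function. Continuity holds because the frontier of `U` lies in `K'`. The only zero
  -- `Ψ p` lies in `U`, so `F` has no zero although it equals `z - Ψ p` far away.
  let F : C(ℂ, ℂ) := ⟨fun z => if z ∈ U then Complex.exp (L z) else z - Ψ p, by
    refine Continuous.if (fun z hz => hLK z (hfront z hz)) (by fun_prop) (by fun_prop)⟩
  have hF : ∀ z, F z ≠ 0 := by
    intro z
    by_cases hz : z ∈ U
    · simp only [F, ContinuousMap.coe_mk, if_pos hz]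
      exact Complex.exp_ne_zero _
    · simp only [F, ContinuousMap.coe_mk, if_neg hz]
      intro h0
      refine hz ?_
      rw [sub_eq_zero.1 h0, mem_preimage, hleft p hpq]
      exact ⟨hpK, hpu⟩
  obtain ⟨z, hz, hzF⟩ := exists_ne_sub_of_ne_zero F hF (Ψ p) (R := |r| + 1) (by positivity)
  refine hzF ?_
  have hzU : z ∉ U := fun hzU => by
    have := hr z hzU
    linarith [le_abs_self r]
  simp only [F, ContinuousMap.coe_mk, if_neg hzU]

end Logarithms


/-! ### The boundary surface minus finitely many points is connected. -/

section BoundaryConnectivity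

open Set

/-- The two end points of the interval `[-1, 1]`. -/
def intervalEnd : Bool → Icc (-1 : ℝ) 1
  | true => ⟨1, by simp⟩
  | false => ⟨-1, by simp⟩

theorem abs_intervalEnd (c : Bool) : |(intervalEnd c : ℝ)| = 1 := by cases c <;> simp [intervalEnd]

theorem exists_eq_intervalEnd {s : Icc (-1 : ℝ) 1} (hs : |(s : ℝ)| = 1) :
    ∃ c, intervalEnd c = s := by
  rcases eq_or_eq_neg_of_abs_eq hs with h | h
  · exact ⟨true, Subtype.ext h.symm⟩
  · exact ⟨false, Subtype.ext h.symm⟩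

theorem intervalEnd_injective : Function.Injective intervalEnd := by
  have h : (-1 : ℝ) ≠ 1 := by norm_num
  rintro (_ | _) (_ | _) heq <;> first | rfl | exact (h (congrArg Subtype.val heq)).elim |
    exact (h (congrArg Subtype.val heq).symm).elim

theorem isPreconnected_circle : IsPreconnected {x : Disc 2 | ‖(x : Euc 2)‖ = 1} := by
  refine IsInducing.subtypeVal.isPreconnected_image.1 ?_
  have h : Subtype.val '' {x : Disc 2 | ‖(x : Euc 2)‖ = 1} = Metric.sphere (0 : Euc 2) 1 := by
    ext y
    rw [mem_sphere_zero_iff_norm]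
    constructor
    · rintro ⟨x, hx, rfl⟩; exact hx
    · exact fun hy => ⟨⟨y, mem_closedBall_zero_iff.2 hy.le⟩, hy, rfl⟩
  rw [h]
  refine isPreconnected_sphere ?_ _ _
  rw [← Module.finrank_eq_rank, finrank_euclideanSpace_fin]
  norm_num

theorem infinite_circle : {x : Disc 2 | ‖(x : Euc 2)‖ = 1}.Infinite := by
  refine isPreconnected_circle.infinite_of_nontrivial ?_
  let w : Euc 2 := EuclideanSpace.single 0 1
  have hw : ‖w‖ = 1 := by simp [w]
  refine ⟨⟨w, by simp [hw]⟩, hw, ⟨-w, by simp [hw]⟩, ?_, ?_⟩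
  · simp [hw]
  · intro h
    have h1 : w = -w := congrArg Subtype.val h
    have h2 : (w 0 : ℝ) = -w 0 := congrFun (congrArg (fun v : Euc 2 => (v : Fin 2 → ℝ)) h1) 0
    simp only [w, PiLp.single_apply, if_true] at h2
    norm_num at h2

/-- An annulus minus a finite set is connected, and it contains a full transversal arc. -/
theorem isPreconnected_annulus_sdiff {F : Set (Icc (-1 : ℝ) 1 × Disc 2)} (hF : F.Finite) :
    IsPreconnected ({q | ‖(q.2 : Euc 2)‖ = 1} \ F) ∧
      ∃ x : Disc 2, ‖(x : Euc 2)‖ = 1 ∧ ∀ s, (s, x) ∉ F := by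
  obtain ⟨x₀, hx₀, hx₀F⟩ := (infinite_circle.sdiff (hF.image Prod.snd)).nonempty
  have hx₀F' : ∀ s, (s, x₀) ∉ F := fun s hs => hx₀F ⟨_, hs, rfl⟩
  refine ⟨?_, x₀, hx₀, hx₀F'⟩
  have hline : IsPreconnected ((fun s : Icc (-1 : ℝ) 1 => (s, x₀)) '' univ) :=
    isPreconnected_univ.image _ (by fun_prop)
  have hcirc : ∀ s : Icc (-1 : ℝ) 1, IsPreconnected
      ((fun x : Disc 2 => (s, x)) '' {x | ‖(x : Euc 2)‖ = 1}) := fun s =>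
    isPreconnected_circle.image _ (by fun_prop)
  -- The comb made of one transversal arc missing `F` and all circles missing `F`. It is connected,
  -- and it is dense because only finitely many circles are left out.
  have hcomb : IsPreconnected (⋃ s : ((Prod.fst '' F)ᶜ : Set (Icc (-1 : ℝ) 1)),
      ((fun s : Icc (-1 : ℝ) 1 => (s, x₀)) '' univ ∪
        (fun x : Disc 2 => (s.1, x)) '' {x | ‖(x : Euc 2)‖ = 1})) := by
    refine isPreconnected_iUnion ⟨(⟨1, by simp⟩, x₀), mem_iInter.2 fun s => ?_⟩ fun s => ?_
    · exact Or.inl ⟨_, trivial, rfl⟩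
    · exact IsPreconnected.union (s.1, x₀) ⟨_, trivial, rfl⟩ ⟨x₀, hx₀, rfl⟩ hline (hcirc _)
  have : Nontrivial (Icc (-1 : ℝ) 1) :=
    ⟨intervalEnd true, intervalEnd false, fun h => Bool.noConfusion (intervalEnd_injective h)⟩
  have : ConnectedSpace (Icc (-1 : ℝ) 1) := { toNonempty := ⟨intervalEnd true⟩ }
  have hdense : Dense ((Prod.fst '' F)ᶜ : Set (Icc (-1 : ℝ) 1)) := by
    have := dense_univ.sdiff_finite (hF.image Prod.fst)
    rwa [← compl_eq_univ_sdiff] at this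
  refine hcomb.subset_closure ?_ ?_
  · refine iUnion_subset fun s => union_subset ?_ ?_
    · rintro _ ⟨t, -, rfl⟩
      exact ⟨hx₀, hx₀F' t⟩
    · rintro _ ⟨x, hx, rfl⟩
      exact ⟨hx, fun h => s.2 ⟨_, h, rfl⟩⟩
  · rintro ⟨s, x⟩ ⟨hx, -⟩
    refine map_mem_closure (f := fun s => (s, x)) (by fun_prop) (hdense s) fun t ht => ?_
    exact mem_iUnion.2 ⟨⟨t, ht⟩, Or.inr ⟨x, hx, rfl⟩⟩

namespace IsHandleDecomposition

variable {k : ℕ} {b : Disc 3 → S3} {H : Fin k × Set.Icc (-1 : ℝ) 1 × Disc 2 → S3} {W B P : Set S3}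

/-- The union of the radii of the disc `{s} × D²` of the `i`-th handle which end in `P`. -/
def attachingStar (H : Fin k × Set.Icc (-1 : ℝ) 1 × Disc 2 → S3) (P : Set S3) (i : Fin k)
    (s : Set.Icc (-1 : ℝ) 1) : Set (Disc 2) :=
  (fun p : unitInterval × Disc 2 => discSmul p.1 p.2) ''
    {p | (p.2 : Euc 2) = 0 ∨ H (i, s, p.2) ∈ P}

theorem discSmul_mem_attachingStar {i s} {a : Disc 2} (ha : (a : Euc 2) = 0 ∨ H (i, s, a) ∈ P)
    (t) : discSmul t a ∈ attachingStar H P i s :=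
  ⟨(t, a), ha, rfl⟩

theorem isClosed_attachingStar (hd : IsHandleDecomposition b H W B) (hP : IsClosed P) (i s) :
    IsClosed (attachingStar H P i s) := by
  refine (IsCompact.image (IsClosed.isCompact ?_) continuous_discSmul).isClosed
  refine IsClosed.union (isClosed_eq (by fun_prop) continuous_const) ?_
  exact hP.preimage (hd.handles.continuous.comp (by fun_prop))

theorem hasLogs_attachingStar (i s) : HasLogs (attachingStar H P i s) := by
  refine HasLogs.of_star ?_
  rintro t _ ⟨⟨t', a⟩, ha, rfl⟩
  exact ⟨(t * t', a), ha, Subtype.ext (by simp [mul_smul])⟩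

theorem eq_or_mem_attachingStar (hd : IsHandleDecomposition b H W B) (hPB : P ⊆ B) {i s}
    {x : Disc 2} (hx : x ∈ attachingStar H P i s) :
    ‖(x : Euc 2)‖ < 1 ∨ H (i, s, x) ∈ P := by
  obtain ⟨⟨t, a⟩, ha, rfl⟩ := hx
  rcases ha with ha | (ha : H (i, s, a) ∈ P)
  · left
    simp [show (a : Euc 2) = 0 from ha]
  · have hB : H (i, s, a) ∈ B := hPB ha
    have h1 : ‖(a : Euc 2)‖ = 1 := (hd.handle_mem_boundary_iff (q := (i, s, a))).1 hB
    rcases eq_or_ne (t : ℝ) 1 with ht | ht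
    · right
      have : discSmul t a = a := Subtype.ext (by rw [coe_discSmul, ht, one_smul])
      simpa only [this] using ha
    · left
      change ‖(t : ℝ) • (a : Euc 2)‖ < 1
      rw [norm_smul, h1, mul_one, Real.norm_of_nonneg t.2.1]
      exact lt_of_le_of_ne t.2.2 ht

/-- A set of disjoint stars in the boundary sphere of the 0-handle, outside of which the sphere
can be projected to the boundary of the handlebody minus `P`. -/
def stars (H : Fin k × Set.Icc (-1 : ℝ) 1 × Disc 2 → S3) (P : Set S3) : Set S3 :=
  (⋃ j : Fin k × Bool, (fun x => H (j.1, intervalEnd j.2, x)) ''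
    attachingStar H P j.1 (intervalEnd j.2)) ∪ (P \ range H)

theorem handle_mem_stars {i c} {x : Disc 2} (hx : x ∈ attachingStar H P i (intervalEnd c)) :
    H (i, intervalEnd c, x) ∈ stars H P :=
  Or.inl (mem_iUnion_of_mem (i, c) ⟨x, hx, rfl⟩)

theorem handle_mem_cores_iff (hd : IsHandleDecomposition b H W B) {q} :
    H q ∈ cores H ↔ (q.2.2 : Euc 2) = 0 := by
  refine ⟨?_, fun h => ⟨q, h, rfl⟩⟩
  rintro ⟨q', hq', h⟩
  rw [← hd.handles.injective h]
  exact hq'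

theorem boundary_inter_stars_subset (hd : IsHandleDecomposition b H W B) (hPB : P ⊆ B) :
    B ∩ stars H P ⊆ P := by
  rintro x ⟨hxB, hx | hx⟩
  · obtain ⟨⟨i, c⟩, y, hy, rfl⟩ := mem_iUnion.1 hx
    refine (hd.eq_or_mem_attachingStar hPB hy).resolve_left fun hlt => ?_
    exact hlt.ne ((hd.handle_mem_boundary_iff (q := (i, intervalEnd c, y))).1 hxB)
  · exact hx.1

theorem mem_sphere_of_notMem_handles (hd : IsHandleDecomposition b H W B) {x} (hx : x ∈ B)
    (hxH : x ∉ range H) : x ∈ b '' {y | ‖(y : Euc 3)‖ = 1} := by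
  rw [hd.boundary_eq] at hx
  rcases hx with hx | ⟨q, -, rfl⟩
  · exact hx.1
  · exact (hxH ⟨q, rfl⟩).elim

theorem stars_subset_sphere (hd : IsHandleDecomposition b H W B) (hPB : P ⊆ B) :
    stars H P ⊆ b '' {y | ‖(y : Euc 3)‖ = 1} := by
  rintro x (hx | ⟨hxP, hxH⟩)
  · obtain ⟨⟨i, c⟩, y, hy, rfl⟩ := mem_iUnion.1 hx
    exact hd.mem_sphere (i, intervalEnd c, y) (abs_intervalEnd c)
  · exact hd.mem_sphere_of_notMem_handles (hPB hxP) hxH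

/-- Outside of the stars, the boundary sphere of the 0-handle projects to the boundary of the
handlebody minus `P`. -/
theorem projHandles_of_notMem_stars (hd : IsHandleDecomposition b H W B) {y : Disc 3}
    (hy : ‖(y : Euc 3)‖ = 1) (h : b y ∉ stars H P) :
    b y ∈ (b '' {y | ‖(y : Euc 3)‖ = 1} ∪ range H) \ cores H ∧ projHandles H (b y) ∉ P := by
  by_cases hq : ∃ q, H q = b y
  · obtain ⟨⟨i, s, a⟩, hq⟩ := hq
    obtain ⟨c, rfl⟩ := exists_eq_intervalEnd (hd.norm_of_mem_ball hq.symm).2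
    rw [← hq] at h ⊢
    refine ⟨⟨Or.inr ⟨_, rfl⟩, fun hc => h (handle_mem_stars ?_)⟩, fun hP => h (handle_mem_stars ?_)⟩
    · have ha : (a : Euc 2) = 0 := hd.handle_mem_cores_iff.1 hc
      have h1 := discSmul_mem_attachingStar (H := H) (P := P) (i := i) (s := intervalEnd c)
        (Or.inl ha) 1
      rwa [show discSmul 1 a = a from Subtype.ext (by simp)] at h1
    · rw [hd.projHandles_handle] at hP
      obtain ⟨t, ht⟩ := exists_discSmul_radialProj a
      rw [← ht]
      exact discSmul_mem_attachingStar (Or.inr hP) t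
  · have hproj : projHandles H (b y) = b y := Function.extend_apply' _ _ _ hq
    rw [hproj]
    refine ⟨⟨Or.inl ⟨y, hy, rfl⟩, ?_⟩, fun hP => h (Or.inr ⟨hP, hq⟩)⟩
    rintro ⟨q, -, hqy⟩
    exact hq ⟨q, hqy⟩

theorem isEmbedding_handle_disc (hd : IsHandleDecomposition b H W B) (i s) :
    IsClosedEmbedding fun x => H (i, s, x) :=
  (hd.handles.continuous.comp (by fun_prop)).isClosedEmbedding fun x y h => by
    simpa using hd.handles.injective h

/-- The set is a finite disjoint union of points and embedded compact sets star-shaped about the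
centre of a disc. Each piece has logarithms, and disjoint closed pieces do not interact. -/
theorem isClosed_and_hasLogs_stars (hd : IsHandleDecomposition b H W B) (hP : P.Finite) :
    IsClosed (stars H P) ∧ HasLogs (stars H P) := by
  have h1 : ∀ j : Fin k × Bool, IsClosed ((fun x => H (j.1, intervalEnd j.2, x)) ''
      attachingStar H P j.1 (intervalEnd j.2)) := fun j =>
    (hd.isEmbedding_handle_disc _ _).isClosedMap _ (hd.isClosed_attachingStar hP.isClosed _ _)
  have h2 : IsClosed (⋃ j : Fin k × Bool, (fun x => H (j.1, intervalEnd j.2, x)) ''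
      attachingStar H P j.1 (intervalEnd j.2)) := isClosed_iUnion_of_finite h1
  have hfin : (P \ range H).Finite := hP.subset sdiff_subset
  refine ⟨h2.union hfin.isClosed, HasLogs.union h2 hfin.isClosed ?_ ?_ ?_⟩
  · rw [Set.disjoint_left]
    rintro x hx ⟨-, hx'⟩
    obtain ⟨j, y, -, rfl⟩ := mem_iUnion.1 hx
    exact hx' ⟨_, rfl⟩
  · refine HasLogs.iUnion h1 ?_ fun j =>
      (hasLogs_attachingStar _ _).image (hd.isEmbedding_handle_disc _ _).isEmbedding
    rintro ⟨i, c⟩ ⟨i', c'⟩ hne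
    rw [Set.disjoint_left]
    rintro _ ⟨x, -, rfl⟩ ⟨x', -, h⟩
    have h' := hd.handles.injective h
    simp only [Prod.mk.injEq] at h'
    exact hne (Prod.ext h'.1.symm (intervalEnd_injective h'.2.1.symm))
  · have := hfin.to_subtype
    rw [← iUnion_of_singleton_coe (P \ range H)]
    refine HasLogs.iUnion (fun _ => isClosed_singleton) ?_ fun _ => HasLogs.singleton _
    intro x y hxy
    simpa using fun h => hxy (Subtype.ext h)

/-- The boundary of a handlebody minus a finite set is connected. -/
theorem isPreconnected_boundary_sdiff (hd : IsHandleDecomposition b H W B) (hB : IsClosed B)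
    (hP : P.Finite) (hPB : P ⊆ B) : IsPreconnected (B \ P) := by
  let β : Metric.sphere (0 : Euc 3) 1 → S3 := fun x =>
    b ⟨x, Metric.sphere_subset_closedBall x.2⟩
  have hβ : IsEmbedding β := ((hd.ball.continuous.comp (by fun_prop)).isClosedEmbedding
    fun x y h => by simpa [Subtype.ext_iff] using hd.ball.injective h).isEmbedding
  have hrange : ∀ x ∈ b '' {y | ‖(y : Euc 3)‖ = 1}, x ∈ range β := by
    rintro _ ⟨y, hy, rfl⟩
    exact ⟨⟨y, mem_sphere_zero_iff_norm.2 hy⟩, rfl⟩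
  obtain ⟨hTc, hTl⟩ := hd.isClosed_and_hasLogs_stars hP
  have hTβ : stars H P ⊆ range β := fun x hx => hrange x (hd.stars_subset_sphere hPB hx)
  have hmem := fun (x : Metric.sphere (0 : Euc 3) 1) (hx : x ∈ (β ⁻¹' stars H P)ᶜ) =>
    hd.projHandles_of_notMem_stars (y := ⟨x, Metric.sphere_subset_closedBall x.2⟩)
      (mem_sphere_zero_iff_norm.1 x.2) hx
  -- The sphere minus the stars is connected, and projecting the punctured attaching discs to their
  -- rims carries it into `B \ P`. The image contains all of `B \ P` on the sphere.
  let C : Set S3 := (projHandles H ∘ β) '' (β ⁻¹' stars H P)ᶜ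
  have hC : IsPreconnected C :=
    ((hTl.preimage hβ hTβ).isPreconnected_compl (hTc.preimage hβ.continuous)).image _
      ((hd.continuousOn_projHandles hB).comp hβ.continuous.continuousOn fun x hx => (hmem x hx).1)
  have hCB : C ⊆ B \ P := by
    rintro _ ⟨x, hx, rfl⟩
    exact ⟨hd.projHandles_mem_boundary (hmem x hx).1, (hmem x hx).2⟩
  have hBC : ∀ x ∈ B \ P, x ∈ range β → x ∈ C := by
    rintro _ hx ⟨y, rfl⟩
    exact ⟨y, fun h => hx.2 (hd.boundary_inter_stars_subset hPB ⟨hx.1, h⟩), hd.projHandles_of_mem_boundary hx.1⟩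
  -- The sides of the handles minus `P`. Each is connected and meets `C` at the end of a transversal
  -- arc avoiding `P`.
  let N : Fin k → Set S3 := fun i => (fun q : Icc (-1 : ℝ) 1 × Disc 2 => H (i, q)) ''
    ({q | ‖(q.2 : Euc 2)‖ = 1} \ {q | H (i, q) ∈ P})
  have hfin : ∀ i, {q : Icc (-1 : ℝ) 1 × Disc 2 | H (i, q) ∈ P}.Finite := fun i =>
    hP.preimage fun q _ q' _ h => by simpa using hd.handles.injective h
  have hN : ∀ i, IsPreconnected (N i) := fun i =>
    (isPreconnected_annulus_sdiff (hfin i)).1.image _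
      (hd.handles.continuous.comp (by fun_prop)).continuousOn
  have hNB : ∀ i, N i ⊆ B \ P := by
    rintro i _ ⟨q, hq, rfl⟩
    exact ⟨(hd.handle_mem_boundary_iff (q := (i, q))).2 hq.1, hq.2⟩
  have hNC : ∀ i, (N i ∩ C).Nonempty := by
    intro i
    obtain ⟨x, hx, hxF⟩ := (isPreconnected_annulus_sdiff (hfin i)).2
    have hxN : H (i, intervalEnd true, x) ∈ N i := ⟨(intervalEnd true, x), ⟨hx, hxF _⟩, rfl⟩
    exact ⟨_, hxN, hBC _ (hNB i hxN) (hrange _ (hd.mem_sphere (i, intervalEnd true, x) (abs_intervalEnd true)))⟩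
  have heq : B \ P = C ∪ ⋃ i, (C ∪ N i) := by
    refine Subset.antisymm (fun x hx => ?_) (union_subset hCB (iUnion_subset fun i =>
      union_subset hCB (hNB i)))
    by_cases hxH : x ∈ range H
    · obtain ⟨⟨i, q⟩, rfl⟩ := hxH
      exact Or.inr (mem_iUnion.2 ⟨i, Or.inr ⟨q, ⟨(hd.handle_mem_boundary_iff (q := (i, q))).1 hx.1, hx.2⟩, rfl⟩⟩)
    · exact Or.inl (hBC x hx (hrange x (hd.mem_sphere_of_notMem_handles hx.1 hxH)))
  rw [heq]
  rcases isEmpty_or_nonempty (Fin k) with hk | ⟨⟨i₀⟩⟩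
  · simpa using hC
  · obtain ⟨c, -, hc⟩ := hNC i₀
    refine IsPreconnected.union c hc (mem_iUnion.2 ⟨i₀, Or.inl hc⟩) hC ?_
    refine isPreconnected_iUnion ⟨c, mem_iInter.2 fun i => Or.inl hc⟩ fun i => ?_
    obtain ⟨z, hzN, hzC⟩ := hNC i
    exact IsPreconnected.union z hzC hzN hC (hN i)

end IsHandleDecomposition

theorem IsUnknottedHandlebody.isPreconnected_boundary_sdiff {k : ℕ} {W B P : Set S3}
    (hW : IsUnknottedHandlebody k W B) (hP : P.Finite) (hPB : P ⊆ B) :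
    IsPreconnected (B \ P) := by
  obtain ⟨hW, m, hM⟩ := hW
  obtain ⟨b, H, hd⟩ := hW.exists_isHandleDecomposition
  obtain ⟨b', H', hd'⟩ := hM.exists_isHandleDecomposition
  have hB : IsClosed B :=
    exterior_inter hd.boundary_subset ▸ hd'.isClosed.inter hd.isClosed
  exact hd.isPreconnected_boundary_sdiff hB hP hPB

/-- Retracts of open sets are locally path-connected, so for them connectedness and
path-connectedness agree. -/
theorem IsOpenRetract.pathConnectedSpace {A : Set S3} (h : IsOpenRetract A) (hA : IsPreconnected A)
    (x : A) : PathConnectedSpace A := by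
  have := h.locallyPathConnectedSpace
  have : ConnectedSpace A :=
    { toPreconnectedSpace := Subtype.preconnectedSpace hA, toNonempty := ⟨x⟩ }
  exact pathConnectedSpace_iff_connectedSpace.2 this

end BoundaryConnectivity

/-! ### The classification for the complement of the defects. -/

theorem lemma3p3
    -- the handlebody `M = exterior W B` with boundary `B`
    {k : ℕ} {W B : Set S3} (hW : IsUnknottedHandlebody k W B)
    -- the boundary defects `P` and the defect graph `Γ` in `M`
    {P : Set S3} (hPfin : P.Finite) (hPB : P ⊆ B)
    {Γ : Set S3} (hΓ : IsSpatialGraph Γ) (hΓM : Γ ⊆ exterior W B)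
    (hΓB : B ∩ Γ = P ∩ graphEnds Γ)
    -- the base points of `M ∖ Γ` and of `∂M ∖ P`
    (pt : ↥(exterior W B \ Γ)) (ptB : ↥(B \ P))
    -- the order parameter space `X`
    {G : Type*} [Group G]
    {X : Type*} [TopologicalSpace X] [T2Space X] [CWComplex (Set.univ : Set X)]
    (x₀ : X) (e : FundamentalGroup X x₀ ≃* G) (hpi2 : Subsingleton (π_ 2 X x₀))
    -- the boundary values
    (f₀ : C(↥(B \ P), X)) (hf₀ : f₀ ptB = x₀) :
    Nonempty (Path pt (boundaryInclusion (W := W) hΓB ptB)) ∧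
    -- for every choice of path used to define `ι_* : π₁(∂M ∖ P) → π₁(M ∖ Γ)`
    ∀ γ : Path pt (boundaryInclusion (W := W) hΓB ptB),
      ∃ θ : Quotient (basedHomotopy (boundaryInclusion (W := W) hΓB) f₀ pt x₀) →
          {φ : FundamentalGroup ↥(exterior W B \ Γ) pt →* G //
            AreConj (φ.comp (inducedAlong (boundaryInclusion (W := W) hΓB) γ))
              (e.toMonoidHom.comp (FundamentalGroup.mapOfEq f₀ hf₀))},
        (∀ f : BasedFields (boundaryInclusion (W := W) hΓB) f₀ pt x₀,
          (θ (Quotient.mk _ f)).1 = e.toMonoidHom.comp (FundamentalGroup.mapOfEq f.1 f.2.1)) ∧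
        Function.Bijective θ := by
  obtain ⟨hU, hS⟩ := hW.isOpenRetract (P := P) hPfin.isClosed hΓ.isClosed
  have := hU.pathConnectedSpace (hW.isPreconnected_exterior_sdiff hΓ) pt
  have := hS.pathConnectedSpace (hW.isPreconnected_boundary_sdiff hPfin hPB) ptB
  exact ⟨PathConnectedSpace.joined _ _, fun γ =>
    exists_bijective_of_isOpenRetract hS hU (boundaryInclusion (W := W) hΓB) x₀ e hpi2 f₀ hf₀ γ⟩
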